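/- **Setting.** Let $\mathbb K=\mathbb Z/2$. A *space* is a simplicial set, $\Delta^p$ is the standard $p$-simplex, and $X$ is a cosimplicial space with spaces $X^p$, cofaces $d^i$ and codegeneracies $s^i$; the products $X\times X$ are formed levelwise. $S_*(Z)$ is the normalized mod $2$ chain complex of a space $Z$ (the free $\mathbb K$-modules on the simplices modulo degenerate simplices), $H_*(Z)$ is its homology, and $\nabla: S_*(Z)\otimes S_*(Z')\to S_*(Z\times Z')$ is the shuffle map. *The spectral sequence.* Let $C^pS_q(X)\subseteq S_q(X^p)$ be the conormalization, the subspace of all elements that are annihilated by the codegeneracies. Let $TCS_*(X)$ be the product total complex with $TCS_*(X)_n=\prod_p C^pS_{n+p}(X)$ and with differential $\sum_i d^i+\partial$, filtered by $F^{-s}=\prod_{p\ge s}$. With $Z^r_{-s,t}=\{x\in F^{-s}TCS_*(X)_{t-s} : \partial x\in F^{-s-r}\}$, the spectral sequence of $X$ is the one of this filtered complex, and its limit term is $$E^\infty_{-s,t}(S_*(X))=\bigcap_{r}\bigl(Z^r_{-s,t}+F^{-s-1}\bigr)\Big/\bigcup_r\bigl(\partial Z^{r}_{-s+r,t-r+1}+F^{-s-1}\bigr),$$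 where $F^{-s-1}$ means its part in degree $t-s$. *Totalization and abutment.* $\operatorname{Tot}X$ is the space whose $q$-simplices are the cosimplicial maps $f:\Delta^\bullet\times\Delta^q\to X$. Let $\imath_k\in S_k(\Delta^k)$ be the class of the top simplex and $\imath_k\wedge\imath_q=\nabla(\imath_k\otimes\imath_q)\in S_{k+q}(\Delta^k\times\Delta^q)$. There is a chain map $\phi: S_*(\operatorname{Tot}X)\to TCS_*(X)$, $\phi(f)=\prod_{k\ge0} f_*(\imath_k\wedge\imath_q)$ for $f\in(\operatorname{Tot}X)_q$. Put $$F^{-s}H_n(\operatorname{Tot}X)=\ker\bigl(H_n(\operatorname{Tot}X)\xrightarrow{\phi}H_n(TCS_*(X))\to H_n(TCS_*(X)/F^{-s})\bigr).$$ For a class in it, $\phi$ of this class is represented by a cycle in $F^{-s}TCS_*(X)_n$; sending it to the class of this cycle in $E^\infty$ gives the (well defined) abutment map $$\iota:(F^{-s}/F^{-s-1})H_n(\operatorname{Tot}X)\to E^\infty_{-s,s+n}(S_*(X)).$$ *Products.* The external product $H_n(\operatorname{Tot}X)\otimes H_{n'}(\operatorname{Tot}X)\to H_{n+n'}(\operatorname{Tot}(X\times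 X))$ is induced by $\nabla$ and the canonical isomorphism $\operatorname{Tot}X\times\operatorname{Tot}X\cong\operatorname{Tot}(X\times X)$, $(f,g)\mapsto(a\mapsto(f(a),g(a)))$. The external product $E^\infty_{-s,t}(S_*(X))\otimes E^\infty_{-s',t'}(S_*(X))\to E^\infty_{-s-s',t+t'}(S_*(X\times X))$ is induced by the filtered chain map $$TCS_*(X)\otimes TCS_*(X)\to TCS_*(X\times X),\qquad (x\cdot y)^P=\sum_{p+p'=P}\nabla\bigl(d^{P}\cdots d^{p+1}x^p\otimes d^{p-1}\cdots d^0y^{p'}\bigr),$$ the composite of the cosimplicial Alexander–Whitney map and the shuffle map. Let $\pi=\{e,\sigma\}$ be the group with two elements, $E\pi$ the contractible free $\pi$-space with $E\pi_q=\pi^{q+1}$, and for a space $Z$ let $E\pi\times_\pi Z^{\times2}$ be the quotient of $E\pi\times Z\times Z$ by the action $(a,x,y)\mapsto(\sigma a,y,x)$. Applying this to each $X^p$ gives a cosimplicial space $E\pi\times_\pi X^{\times2}$ and a cosimplicial map $\kappa:X\times X\to E\pi\times_\pi X^{\times2}$, $(x,y)\mapsto[(e,\dots,e),x,y]$. **Theorem.**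 Let $X$ be a cosimplicial space, and let $H_*(\operatorname{Tot}(X\times X))$ and $H_*(\operatorname{Tot}(E\pi\times_\pi X^{\times2}))$ be filtered as above. Then the external product takes $F^{-s}H_n(\operatorname{Tot}X)\otimes F^{-s'}H_{n'}(\operatorname{Tot}X)$ into $F^{-s-s'}H_{n+n'}(\operatorname{Tot}(X\times X))$, the map $H_n(\operatorname{Tot}\kappa)$ takes $F^{-s}$ into $F^{-s}$, and for all $s,s',n,n'$ and $t=s+n$, $t'=s'+n'$, the diagram $$\begin{array}{ccc} (F^{-s}/F^{-s-1})H_n(\operatorname{Tot}X)\otimes(F^{-s'}/F^{-s'-1})H_{n'}(\operatorname{Tot}X)&\xrightarrow{\ \iota\otimes\iota\ }&E^\infty_{-s,t}(S_*(X))\otimes E^\infty_{-s',t'}(S_*(X))\\ \downarrow&&\downarrow\\ (F^{-s-s'}/F^{-s-s'-1})H_{n+n'}(\operatorname{Tot}(X\times X))&\xrightarrow{\ \iota\ }&E^\infty_{-s-s',t+t'}(S_*(X\times X))\\ \downarrow&&\downarrow\\ (F^{-s-s'}/F^{-s-s'-1})H_{n+n'}(\operatorname{Tot}(E\pi\times_\pi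 X^{\times2}))&\xrightarrow{\ \iota\ }&E^\infty_{-s-s',t+t'}(S_*(E\pi\times_\pi X^{\times2})) \end{array}$$ commutes (both squares), where the upper vertical maps are the external products and the lower ones are induced by $\kappa$. -/

import Mathlib

open CategoryTheory Simplicial MonoidalCategory Opposite
universe u v w

namespace CosimplicialSS

/-- The ground field with two elements. -/
abbrev 𝕂 : Type := ZMod 2

section LinearAlgebra

variable {M : Type u} {M' : Type v} {M'' : Type w} [AddCommGroup M] [AddCommGroup M']
  [AddCommGroup M''] [Module 𝕂 M] [Module 𝕂 M'] [Module 𝕂 M'']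

/-- The subquotient `Z / (Z ∩ B)` of a vector space. -/
abbrev SubQ (Z B : Submodule 𝕂 M) : Type u := ↥Z ⧸ B.submoduleOf Z

/-- The class in `Z / (Z ∩ B)` of an element of `Z`. -/
def SubQ.mk {Z : Submodule 𝕂 M} (B : Submodule 𝕂 M) (x : Z) : SubQ Z B :=
  Submodule.Quotient.mk x

/-- The map induced on subquotients by a linear map. -/
def SubQ.map {Z B : Submodule 𝕂 M} {Z' B' : Submodule 𝕂 M'} (f : M →ₗ[𝕂] M')
    (hZ : ∀ x ∈ Z, f x ∈ Z') (hB : ∀ x ∈ Z, x ∈ B → f x ∈ B') :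
    SubQ Z B →ₗ[𝕂] SubQ Z' B' :=
  Submodule.mapQ _ _ (f.restrict hZ) (fun x hx => hB x x.2 hx)

/-- The map induced on subquotients by a bilinear map. -/
def SubQ.map₂ {Z B : Submodule 𝕂 M} {Z' B' : Submodule 𝕂 M'} {Z'' B'' : Submodule 𝕂 M''}
    (f : M →ₗ[𝕂] M' →ₗ[𝕂] M'')
    (hZ : ∀ x ∈ Z, ∀ y ∈ Z', f x y ∈ Z'')
    (hB : ∀ x ∈ Z, x ∈ B → ∀ y ∈ Z', f x y ∈ B'')
    (hB' : ∀ x ∈ Z, ∀ y ∈ Z', y ∈ B' → f x y ∈ B'') :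
    SubQ Z B →ₗ[𝕂] SubQ Z' B' →ₗ[𝕂] SubQ Z'' B'' :=
  Submodule.liftQ _
    { toFun := fun x => SubQ.map (f x) (hZ x x.2) (hB' x x.2)
      map_add' := fun x x' => by
        refine Submodule.linearMap_qext _ (LinearMap.ext fun y => ?_)
        change SubQ.mk B'' _ = SubQ.mk B'' _ + SubQ.mk B'' _
        rw [SubQ.mk, SubQ.mk, SubQ.mk, ← Submodule.Quotient.mk_add]
        congr 1
        exact Subtype.ext (by simp)
      map_smul' := fun a x => by
        refine Submodule.linearMap_qext _ (LinearMap.ext fun y => ?_)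
        change SubQ.mk B'' _ = a • SubQ.mk B'' _
        rw [SubQ.mk, SubQ.mk, ← Submodule.Quotient.mk_smul]
        congr 1
        exact Subtype.ext (by simp) }
    (fun x hx => by
      rw [LinearMap.mem_ker]
      refine Submodule.linearMap_qext _ (LinearMap.ext fun y => ?_)
      exact (Submodule.Quotient.mk_eq_zero _).2 (hB x x.2 hx y y.2))

end LinearAlgebra

/-- A chain complex of `𝕂`-vector spaces, presented inside an ambient vector space `M`: the space
of `n`-chains is `deg n ⊆ M`, and the differentials are the restrictions of `d`. -/
structure Cpx where
  /-- The ambient vector space. -/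
  M : Type u
  [grp : AddCommGroup M]
  [mod : Module 𝕂 M]
  /-- The space of chains of degree `n`. -/
  deg : ℤ → Submodule 𝕂 M
  /-- The differential. -/
  d : M →ₗ[𝕂] M
  d_deg : ∀ n, ∀ x ∈ deg n, d x ∈ deg (n - 1)
  d_d : ∀ x, d (d x) = 0

attribute [instance] Cpx.grp Cpx.mod

namespace Cpx

/-- The cycles of degree `n`. -/
def cycles (C : Cpx.{u}) (n : ℤ) : Submodule 𝕂 C.M := C.deg n ⊓ LinearMap.ker C.d

/-- The boundaries of degree `n`. -/
def boundaries (C : Cpx.{u}) (n : ℤ) : Submodule 𝕂 C.M := (C.deg (n + 1)).map C.d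

/-- The homology in degree `n`. -/
abbrev H (C : Cpx.{u}) (n : ℤ) : Type u := SubQ (C.cycles n) (C.boundaries n)

/-- Chain maps. -/
structure Hom (C D : Cpx.{u}) where
  /-- The underlying linear map. -/
  f : C.M →ₗ[𝕂] D.M
  map_deg : ∀ n, ∀ x ∈ C.deg n, f x ∈ D.deg n
  comm : ∀ n, ∀ x ∈ C.deg n, f (C.d x) = D.d (f x)

/-- The map induced in homology by a chain map. -/
def Hom.H {C D : Cpx.{u}} (g : Hom C D) (n : ℤ) : C.H n →ₗ[𝕂] D.H n :=
  SubQ.map g.f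
    (fun x hx => ⟨g.map_deg n x hx.1, by
      have h : C.d x = 0 := hx.2
      change D.d (g.f x) = 0
      rw [← g.comm n x hx.1, h, map_zero]⟩)
    (by
      rintro _ _ ⟨w, hw, rfl⟩
      exact ⟨g.f w, g.map_deg _ w hw, (g.comm _ w hw).symm⟩)

/-- Bilinear chain maps `C ⊗ D → E`. -/
structure Pairing (C D E : Cpx.{u}) where
  /-- The underlying bilinear map. -/
  f : C.M →ₗ[𝕂] D.M →ₗ[𝕂] E.M
  map_deg : ∀ m n, ∀ x ∈ C.deg m, ∀ y ∈ D.deg n, f x y ∈ E.deg (m + n)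
  leibniz : ∀ x y, E.d (f x y) = f (C.d x) y + f x (D.d y)

/-- The pairing induced in homology by a bilinear chain map. -/
def Pairing.H {C D E : Cpx.{u}} (g : Pairing C D E) (m n : ℤ) :
    C.H m →ₗ[𝕂] D.H n →ₗ[𝕂] E.H (m + n) :=
  SubQ.map₂ g.f
    (fun x hx y hy => ⟨g.map_deg m n x hx.1 y hy.1, by
      have h : C.d x = 0 := hx.2
      have h' : D.d y = 0 := hy.2
      change E.d (g.f x y) = 0
      rw [g.leibniz, h, h']; simp⟩)
    (by
      rintro _ _ ⟨w, hw, rfl⟩ y hy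
      have h' : D.d y = 0 := hy.2
      refine ⟨g.f w y, ?_, ?_⟩
      · have := g.map_deg _ _ w hw y hy.1
        rwa [add_right_comm] at this
      · rw [g.leibniz, h']; simp)
    (by
      rintro x hx _ _ ⟨w, hw, rfl⟩
      have h : C.d x = 0 := hx.2
      refine ⟨g.f x w, ?_, ?_⟩
      · have := g.map_deg _ _ x hx.1 w hw
        rwa [← add_assoc] at this
      · rw [g.leibniz, h]; simp)

end Cpx

/-- A filtered chain complex. The filtration is indexed decreasingly: `fil s` is the term which is
denoted by `F^{-s}`. -/
structure FCpx extends Cpx.{u} where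
  /-- The filtration. -/
  fil : ℤ → Submodule 𝕂 M
  exhaustive : ∀ x, ∃ s, x ∈ fil s
  fil_anti : ∀ s t, s ≤ t → fil t ≤ fil s
  d_fil : ∀ s, ∀ x ∈ fil s, d x ∈ fil s

namespace FCpx

/-- The quotient complex `C / F^{-s} C`. -/
def quot (C : FCpx.{u}) (s : ℤ) : Cpx.{u} where
  M := C.M ⧸ C.fil s
  deg n := (C.deg n).map (C.fil s).mkQ
  d := Submodule.mapQ _ _ C.d (C.d_fil s)
  d_deg n := by
    rintro _ ⟨x, hx, rfl⟩
    exact ⟨C.d x, C.d_deg n x hx, rfl⟩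
  d_d x := by
    obtain ⟨x, rfl⟩ := Submodule.Quotient.mk_surjective _ x
    change Submodule.Quotient.mk (C.d (C.d x)) = _
    rw [C.d_d]; rfl

/-- The projection `C → C / F^{-s} C`. -/
def proj (C : FCpx.{u}) (s : ℤ) : Cpx.Hom C.toCpx (C.quot s) where
  f := (C.fil s).mkQ
  map_deg _ x hx := ⟨x, hx, rfl⟩
  comm _ _ _ := rfl

/-- The filtration `F^{-s} H_n(C)`, the kernel of `H_n(C) → H_n(C / F^{-s} C)`. -/
def filH (C : FCpx.{u}) (n s : ℤ) : Submodule 𝕂 (C.toCpx.H n) := LinearMap.ker ((C.proj s).H n)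

/-- The `r`-cycles `Z^r_{-s,s+n} = {x ∈ F^{-s} C_n | ∂ x ∈ F^{-s-r} C}`. -/
def Zr (C : FCpx.{u}) (r : ℕ) (s n : ℤ) : Submodule 𝕂 C.M :=
  C.deg n ⊓ C.fil s ⊓ (C.fil (s + r)).comap C.d

/-- The infinite cycles, as a subspace of `F^{-s} C_n` containing `F^{-s-1} C_n`:
the intersection over all `r` of the subspaces `Z^r_{-s} + F^{-s-1}`. -/
def Zinf (C : FCpx.{u}) (s n : ℤ) : Submodule 𝕂 C.M :=
  ⨅ r : ℕ, (C.Zr r s n ⊔ (C.deg n ⊓ C.fil (s + 1)))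

/-- The infinite boundaries, as a subspace of `F^{-s} C_n` containing `F^{-s-1} C_n`:
the union over all `r` of the subspaces `∂ Z^r_{-s+r} + F^{-s-1}`. -/
def Binf (C : FCpx.{u}) (s n : ℤ) : Submodule 𝕂 C.M :=
  ⨆ r : ℕ, ((C.Zr r (s - r) (n + 1)).map C.d ⊔ (C.deg n ⊓ C.fil (s + 1)))

/-- The term `E^∞_{-s,s+n}` of the spectral sequence of a filtered complex. -/
abbrev Einf (C : FCpx.{u}) (s n : ℤ) : Type u := SubQ (C.Zinf s n) (C.Binf s n)

theorem mem_Zr {C : FCpx.{u}} {r : ℕ} {s n : ℤ} {x : C.M} :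
    x ∈ C.Zr r s n ↔ (x ∈ C.deg n ∧ x ∈ C.fil s) ∧ C.d x ∈ C.fil (s + r) := Iff.rfl

theorem mem_Zinf {C : FCpx.{u}} {s n : ℤ} {x : C.M} :
    x ∈ C.Zinf s n ↔ ∀ r : ℕ, ∃ y ∈ C.Zr r s n, ∃ z ∈ C.deg n ⊓ C.fil (s + 1), y + z = x := by
  simp only [Zinf, Submodule.mem_iInf, Submodule.mem_sup]

theorem mono_B (C : FCpx.{u}) (s n : ℤ) :
    Monotone fun r : ℕ => ((C.Zr r (s - r) (n + 1)).map C.d ⊔ (C.deg n ⊓ C.fil (s + 1))) := by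
  intro r r' h
  refine sup_le_sup_right (Submodule.map_mono ?_) _
  rintro x ⟨⟨h1, h2⟩, h3⟩
  refine ⟨⟨h1, C.fil_anti _ _ (by omega) h2⟩, ?_⟩
  have e : s - r + r = s - r' + (r' : ℤ) := by ring
  rw [e] at h3
  exact h3

theorem mem_Binf {C : FCpx.{u}} {s n : ℤ} {x : C.M} :
    x ∈ C.Binf s n ↔ ∃ r : ℕ, ∃ w, (w ∈ C.deg (n + 1) ∧ w ∈ C.fil (s - r)) ∧ C.d w ∈ C.fil s ∧
      ∃ z ∈ C.deg n ⊓ C.fil (s + 1), C.d w + z = x := by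
  rw [Binf, Submodule.mem_iSup_of_directed _ (C.mono_B s n).directed_le]
  refine exists_congr fun r => ?_
  rw [Submodule.mem_sup]
  constructor
  · rintro ⟨_, ⟨w, ⟨h1, h2⟩, rfl⟩, z, hz, rfl⟩
    exact ⟨w, h1, by simpa using h2, z, hz, rfl⟩
  · rintro ⟨w, h1, h2, z, hz, rfl⟩
    exact ⟨C.d w, ⟨w, ⟨h1, by simpa using h2⟩, rfl⟩, z, hz, rfl⟩

theorem Zinf_le {C : FCpx.{u}} {s n : ℤ} {x : C.M} (hx : x ∈ C.Zinf s n) :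
    x ∈ C.deg n ∧ x ∈ C.fil s := by
  obtain ⟨y, hy, z, hz, rfl⟩ := mem_Zinf.1 hx 0
  exact ⟨add_mem hy.1.1 hz.1, add_mem hy.1.2 (C.fil_anti _ _ (by omega) hz.2)⟩

/-- A cycle in `F^{-s}` is an infinite cycle. -/
theorem cycle_mem_Zinf {C : FCpx.{u}} {s n : ℤ} {x : C.M} (hx : x ∈ C.cycles n)
    (hs : x ∈ C.fil s) : x ∈ C.Zinf s n := by
  refine mem_Zinf.2 fun r => ⟨x, ⟨⟨hx.1, hs⟩, ?_⟩, 0, zero_mem _, add_zero x⟩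
  have h : C.d x = 0 := hx.2
  change C.d x ∈ C.fil (s + r)
  rw [h]
  exact zero_mem _

/-- Filtered chain maps. -/
structure Hom (C D : FCpx.{u}) extends Cpx.Hom C.toCpx D.toCpx where
  map_fil : ∀ s, ∀ x ∈ C.fil s, f x ∈ D.fil s

/-- The map induced on `E^∞` by a filtered chain map. -/
def Hom.Einf {C D : FCpx.{u}} (g : Hom C D) (s n : ℤ) : C.Einf s n →ₗ[𝕂] D.Einf s n :=
  SubQ.map g.f
    (fun x hx => by
      refine mem_Zinf.2 fun r => ?_
      obtain ⟨y, ⟨⟨h1, h2⟩, h3⟩, z, hz, rfl⟩ := mem_Zinf.1 hx r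
      refine ⟨g.f y, ⟨⟨g.map_deg _ _ h1, g.map_fil _ _ h2⟩, ?_⟩, g.f z,
        ⟨g.map_deg _ _ hz.1, g.map_fil _ _ hz.2⟩, (map_add _ _ _).symm⟩
      change D.d (g.f y) ∈ D.fil (s + r)
      rw [← g.comm _ _ h1]
      exact g.map_fil _ _ h3)
    (fun x _ hx => by
      obtain ⟨r, w, ⟨h1, h2⟩, h3, z, hz, rfl⟩ := mem_Binf.1 hx
      refine mem_Binf.2 ⟨r, g.f w, ⟨g.map_deg _ _ h1, g.map_fil _ _ h2⟩, ?_, g.f z,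
        ⟨g.map_deg _ _ hz.1, g.map_fil _ _ hz.2⟩, ?_⟩
      · rw [← g.comm _ _ h1]
        exact g.map_fil _ _ h3
      · rw [map_add, g.comm _ _ h1])

/-- Filtered bilinear chain maps `C ⊗ D → E`. -/
structure Pairing (C D E : FCpx.{u}) extends Cpx.Pairing C.toCpx D.toCpx E.toCpx where
  map_fil : ∀ s t, ∀ x ∈ C.fil s, ∀ y ∈ D.fil t, f x y ∈ E.fil (s + t)

theorem Pairing.Zinf {C D E : FCpx.{u}} (g : Pairing C D E) {s t m n : ℤ} {x : C.M} {y : D.M}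
    (hx : x ∈ C.Zinf s m) (hy : y ∈ D.Zinf t n) : g.f x y ∈ E.Zinf (s + t) (m + n) := by
  refine mem_Zinf.2 fun r => ?_
  have hy' := Zinf_le hy
  obtain ⟨x₁, ⟨⟨h1, h2⟩, h3⟩, x₂, hx2, rfl⟩ := mem_Zinf.1 hx r
  obtain ⟨y₁, ⟨⟨k1, k2⟩, k3⟩, y₂, hy2, rfl⟩ := mem_Zinf.1 hy r
  replace h3 : C.d x₁ ∈ C.fil (s + r) := h3
  replace k3 : D.d y₁ ∈ D.fil (t + r) := k3
  refine ⟨g.f x₁ y₁, ⟨⟨g.map_deg _ _ _ h1 _ k1, g.map_fil _ _ _ h2 _ k2⟩, ?_⟩,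
    g.f x₁ y₂ + g.f x₂ (y₁ + y₂),
    add_mem ⟨g.map_deg _ _ _ h1 _ hy2.1, ?_⟩ ⟨g.map_deg _ _ _ hx2.1 _ hy'.1, ?_⟩, ?_⟩
  · change E.d (g.f x₁ y₁) ∈ E.fil (s + t + r)
    rw [g.leibniz]
    refine add_mem ?_ ?_
    · have := g.map_fil _ _ _ h3 _ k2
      rwa [show s + r + t = s + t + (r : ℤ) by ring] at this
    · have := g.map_fil _ _ _ h2 _ k3
      rwa [← add_assoc] at this
  · have := g.map_fil _ _ _ h2 _ hy2.2
    rwa [← add_assoc] at this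
  · have := g.map_fil _ _ _ hx2.2 _ hy'.2
    rwa [show s + 1 + t = s + t + 1 by ring] at this
  · simp only [map_add, LinearMap.add_apply]; abel

theorem Pairing.Binf_left {C D E : FCpx.{u}} (g : Pairing C D E) {s t m n : ℤ} {x : C.M} {y : D.M}
    (hx : x ∈ C.Binf s m) (hy : y ∈ D.Zinf t n) : g.f x y ∈ E.Binf (s + t) (m + n) := by
  have hy' := Zinf_le hy
  obtain ⟨r, w, ⟨h1, h2⟩, h3, z, hz, rfl⟩ := mem_Binf.1 hx
  obtain ⟨y₁, ⟨⟨k1, k2⟩, k3⟩, y₂, hy2, rfl⟩ := mem_Zinf.1 hy (r + 1)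
  replace k3 : D.d y₁ ∈ D.fil (t + (r + 1 : ℕ)) := k3
  have hd := C.d_deg _ _ h1
  rw [add_sub_cancel_right] at hd
  have hd' := D.d_deg _ _ k1
  have hw : g.f w (D.d y₁) ∈ E.deg (m + n) ⊓ E.fil (s + t + 1) := by
    have a := g.map_deg _ _ _ h1 _ hd'
    have b := g.map_fil _ _ _ h2 _ k3
    rw [show m + 1 + (n - 1) = m + n by ring] at a
    rw [show s - r + (t + ((r + 1 : ℕ) : ℤ)) = s + t + 1 by push_cast; ring] at b
    exact ⟨a, b⟩
  refine mem_Binf.2 ⟨r, g.f w y₁, ⟨?_, ?_⟩, ?_,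
    - g.f w (D.d y₁) + g.f (C.d w) y₂ + g.f z (y₁ + y₂), ?_, ?_⟩
  · have := g.map_deg _ _ _ h1 _ k1
    rwa [add_right_comm] at this
  · have := g.map_fil _ _ _ h2 _ k2
    rwa [show s - r + t = s + t - (r : ℤ) by ring] at this
  · rw [g.leibniz]
    exact add_mem (g.map_fil _ _ _ h3 _ k2) (E.fil_anti _ _ (by omega) hw.2)
  · refine add_mem (add_mem (neg_mem hw) ⟨g.map_deg _ _ _ hd _ hy2.1, ?_⟩)
      ⟨g.map_deg _ _ _ hz.1 _ hy'.1, ?_⟩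
    · have := g.map_fil _ _ _ h3 _ hy2.2
      rwa [← add_assoc] at this
    · have := g.map_fil _ _ _ hz.2 _ hy'.2
      rwa [show s + 1 + t = s + t + 1 by ring] at this
  · rw [g.leibniz]
    simp only [map_add, LinearMap.add_apply]; abel

/-- The opposite pairing. -/
def Pairing.flip {C D E : FCpx.{u}} (g : Pairing C D E) : Pairing D C E where
  f := g.f.flip
  map_deg m n x hx y hy := by
    have := g.map_deg n m y hy x hx
    rwa [add_comm] at this
  leibniz x y := by
    have := g.leibniz y x
    rw [add_comm] at this
    exact this
  map_fil s t x hx y hy := by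
    have := g.map_fil t s y hy x hx
    rwa [add_comm] at this

/-- The pairing induced on `E^∞` by a filtered bilinear chain map. -/
def Pairing.Einf {C D E : FCpx.{u}} (g : Pairing C D E) (s t m n : ℤ) :
    C.Einf s m →ₗ[𝕂] D.Einf t n →ₗ[𝕂] E.Einf (s + t) (m + n) :=
  SubQ.map₂ g.f (fun _ hx _ hy => g.Zinf hx hy) (fun _ _ hx _ hy => g.Binf_left hx hy)
    (fun _ hx _ _ hy => by
      have := g.flip.Binf_left hy hx
      rw [add_comm t s, add_comm n m] at this
      exact this)

/-- The map from the cycles in `F^{-s} C_n` to `E^∞_{-s,s+n}`. -/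
def cycleToEinf (C : FCpx.{u}) (s n : ℤ) : ↥(C.cycles n ⊓ C.fil s) →ₗ[𝕂] C.Einf s n :=
  Submodule.mkQ _ ∘ₗ Submodule.inclusion (fun _ hx => cycle_mem_Zinf hx.1 hx.2)

theorem mk_mem_filH_iff (C : FCpx.{u}) (s n : ℤ) (x : C.cycles n) :
    SubQ.mk (C.boundaries n) x ∈ C.filH n s ↔ ∃ w ∈ C.deg (n + 1), x.1 - C.d w ∈ C.fil s := by
  rw [filH, LinearMap.mem_ker]
  change SubQ.mk _ _ = 0 ↔ _
  rw [SubQ.mk, Submodule.Quotient.mk_eq_zero]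
  constructor
  · rintro ⟨_, ⟨w, hw, rfl⟩, h⟩
    exact ⟨w, hw, (Submodule.Quotient.eq _).1 h.symm⟩
  · rintro ⟨w, hw, h⟩
    exact ⟨_, ⟨w, hw, rfl⟩, ((Submodule.Quotient.eq _).2 h).symm⟩

/-- The map from the cycles in `F^{-s} C_n` to `F^{-s} H_n(C) / F^{-s-1} H_n(C)`. -/
def cycleToGr (C : FCpx.{u}) (s n : ℤ) :
    ↥(C.cycles n ⊓ C.fil s) →ₗ[𝕂] SubQ (C.filH n s) (C.filH n (s + 1)) :=
  Submodule.mkQ _ ∘ₗ LinearMap.codRestrict _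
    (Submodule.mkQ _ ∘ₗ Submodule.inclusion inf_le_left)
    (fun x => (C.mk_mem_filH_iff s n ⟨x.1, x.2.1⟩).2
      ⟨0, zero_mem _, by simpa using x.2.2⟩)

theorem cycleToGr_surjective (C : FCpx.{u}) (s n : ℤ) :
    Function.Surjective (C.cycleToGr s n) := by
  intro y
  obtain ⟨⟨y, hy⟩, rfl⟩ := Submodule.Quotient.mk_surjective _ y
  obtain ⟨x, rfl⟩ := Submodule.Quotient.mk_surjective _ y
  obtain ⟨w, hw, h⟩ := (C.mk_mem_filH_iff s n x).1 hy
  have hdw : C.d w ∈ C.cycles n := by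
    refine ⟨?_, C.d_d w⟩
    have := C.d_deg _ _ hw
    rwa [add_sub_cancel_right] at this
  refine ⟨⟨x.1 - C.d w, sub_mem x.2 hdw, h⟩, ?_⟩
  change SubQ.mk _ _ = SubQ.mk _ _
  refine congrArg (SubQ.mk _) (Subtype.ext ?_)
  refine (Submodule.Quotient.eq _).2 ?_
  refine ⟨- w, neg_mem hw, ?_⟩
  change C.d (-w) = x.1 - C.d w - x.1
  rw [map_neg]; abel

theorem ker_cycleToGr_le (C : FCpx.{u}) (s n : ℤ) :
    LinearMap.ker (C.cycleToGr s n) ≤ LinearMap.ker (C.cycleToEinf s n) := by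
  intro x hx
  have hx' : SubQ.mk (C.boundaries n) ⟨x.1, x.2.1⟩ ∈ C.filH n (s + 1) := by
    have h0 : SubQ.mk (C.filH n (s + 1)) ⟨SubQ.mk (C.boundaries n) ⟨x.1, x.2.1⟩,
        (C.mk_mem_filH_iff s n ⟨x.1, x.2.1⟩).2 ⟨0, zero_mem _, by simpa using x.2.2⟩⟩ = 0 :=
      LinearMap.mem_ker.1 hx
    rw [SubQ.mk, Submodule.Quotient.mk_eq_zero] at h0
    exact h0
  obtain ⟨w, hw, h⟩ := (C.mk_mem_filH_iff _ _ _).1 hx'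
  have h1 : C.d w ∈ C.deg n := by
    have := C.d_deg _ _ hw
    rwa [add_sub_cancel_right] at this
  rw [LinearMap.mem_ker]
  change SubQ.mk (C.Binf s n) ⟨x.1, cycle_mem_Zinf x.2.1 x.2.2⟩ = 0
  rw [SubQ.mk, Submodule.Quotient.mk_eq_zero]
  change x.1 ∈ C.Binf s n
  obtain ⟨t, ht⟩ := C.exhaustive w
  refine mem_Binf.2 ⟨(s - t).toNat, w, ⟨hw, C.fil_anti _ _ (by omega) ht⟩, ?_, x.1 - C.d w,
    ⟨sub_mem x.2.1.1 h1, h⟩, by abel⟩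
  have := sub_mem x.2.2 (C.fil_anti _ _ (by omega : s ≤ s + 1) h)
  rwa [sub_sub_cancel] at this

/-- The abutment map `F^{-s} H_n(C) / F^{-s-1} H_n(C) → E^∞_{-s,s+n}`: every element of the source
is represented by a cycle in `F^{-s} C_n`, and it is sent to the class of this cycle. -/
noncomputable def abut (C : FCpx.{u}) (s n : ℤ) :
    SubQ (C.filH n s) (C.filH n (s + 1)) →ₗ[𝕂] C.Einf s n :=
  (LinearMap.ker (C.cycleToGr s n)).liftQ (C.cycleToEinf s n) (C.ker_cycleToGr_le s n) ∘ₗ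
    ((C.cycleToGr s n).quotKerEquivOfSurjective (C.cycleToGr_surjective s n)).symm.toLinearMap

end FCpx

/-- The map induced on filtration quotients by a linear map that preserves the filtrations. -/
def grMap {H : Type u} {H' : Type v} [AddCommGroup H] [AddCommGroup H'] [Module 𝕂 H] [Module 𝕂 H']
    {F : ℤ → Submodule 𝕂 H} {F' : ℤ → Submodule 𝕂 H'} (f : H →ₗ[𝕂] H')
    (h : ∀ s, ∀ x ∈ F s, f x ∈ F' s) (s : ℤ) :
    SubQ (F s) (F (s + 1)) →ₗ[𝕂] SubQ (F' s) (F' (s + 1)) :=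
  SubQ.map f (h s) (fun x _ hx => h (s + 1) x hx)

/-- The pairing induced on filtration quotients by a bilinear map that respects the filtrations. -/
def grMap₂ {H : Type u} {H' : Type v} {H'' : Type w} [AddCommGroup H] [AddCommGroup H']
    [AddCommGroup H''] [Module 𝕂 H] [Module 𝕂 H'] [Module 𝕂 H'']
    {F : ℤ → Submodule 𝕂 H} {F' : ℤ → Submodule 𝕂 H'} {F'' : ℤ → Submodule 𝕂 H''}
    (f : H →ₗ[𝕂] H' →ₗ[𝕂] H'')
    (h : ∀ s t, ∀ x ∈ F s, ∀ y ∈ F' t, f x y ∈ F'' (s + t)) (s t : ℤ) :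
    SubQ (F s) (F (s + 1)) →ₗ[𝕂] SubQ (F' t) (F' (t + 1)) →ₗ[𝕂]
      SubQ (F'' (s + t)) (F'' (s + t + 1)) :=
  SubQ.map₂ f (h s t)
    (fun x _ hx y hy => by
      have := h _ _ x hx y hy
      rwa [add_right_comm] at this)
    (fun x hx y _ hy => by
      have := h _ _ x hx y hy
      rwa [← add_assoc] at this)

section Shuffles

/-- Order preserving maps `[n] → [p] × [q]`, i.e. the `n`-simplices of `Δ^p × Δ^q`. -/
abbrev Chain (p q n : ℕ) : Type := Fin (n + 1) →o Fin (p + 1) × Fin (q + 1)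

/-- The `(p,q)`-shuffles, for `p + q = n`: these are the strictly increasing maps
`[n] → [p] × [q]`, or equivalently the nondegenerate `n`-simplices of `Δ^p × Δ^q`. At the `j`-th
step exactly one of the two coordinates increases, by one; so the first coordinate is
the composite of the codegeneracies that are indexed by the steps in the second direction, and
vice versa. -/
abbrev Shuffle (p q n : ℕ) : Type :=
  {c : Fin (n + 1) → Fin (p + 1) × Fin (q + 1) // p + q = n ∧ StrictMono c}

namespace Shuffle

variable {p q n : ℕ}

noncomputable instance : Fintype (Shuffle p q n) := Fintype.ofFinite _

/-- The underlying simplex of `Δ^p × Δ^q` of a shuffle. -/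
def chain (c : Shuffle p q n) : Chain p q n := ⟨c.1, c.2.2.monotone⟩

theorem rank (c : Shuffle p q n) (j : Fin (n + 1)) : ((c.1 j).1 : ℕ) + (c.1 j).2 = j := by
  have hs : StrictMono fun j : Fin (n + 1) =>
      (⟨((c.1 j).1 : ℕ) + (c.1 j).2, by have := c.2.1; omega⟩ : Fin (n + 1)) := by
    intro a b h
    have h' := c.2.2 h
    rw [Prod.lt_iff] at h'
    simp only [Fin.mk_lt_mk]
    rcases h' with h' | h'
    · have := h'.1; have := h'.2; omega
    · have := h'.1; have := h'.2; omega
  have := OrderHom.eq_id_of_injective ⟨_, hs.monotone⟩ hs.injective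
  exact congrArg Fin.val (DFunLike.congr_fun this j)

theorem fst_mono (c : Shuffle p q n) {j k : Fin (n + 1)} (h : j ≤ k) :
    ((c.1 j).1 : ℕ) ≤ (c.1 k).1 := (c.2.2.monotone h).1

theorem snd_mono (c : Shuffle p q n) {j k : Fin (n + 1)} (h : j ≤ k) :
    ((c.1 j).2 : ℕ) ≤ (c.1 k).2 := (c.2.2.monotone h).2

/-- Exchange of the two directions. -/
def swap (c : Shuffle p q n) : Shuffle q p n :=
  ⟨fun j => (c.1 j).swap, by rw [add_comm]; exact c.2.1, fun a b h => by
    have := c.2.2 h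
    rw [Prod.lt_iff] at this ⊢
    exact this.symm.imp And.symm And.symm⟩

end Shuffle

namespace Chain

variable {p q n : ℕ}

/-- The `i`-th face. -/
def face (c : Chain p q (n + 1)) (i : Fin (n + 2)) : Chain p q n :=
  c.comp (Fin.succAboveOrderEmb i).toOrderHom

/-- The inclusion of the `k`-th face in the first direction. -/
def col (k : Fin (p + 2)) (c : Chain p q n) : Chain (p + 1) q n :=
  ⟨fun j => (k.succAbove (c j).1, (c j).2), fun _ _ h =>
    ⟨(Fin.succAboveOrderEmb k).monotone (c.monotone h).1, (c.monotone h).2⟩⟩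

/-- The inclusion of the `k`-th face in the second direction. -/
def row (k : Fin (q + 2)) (c : Chain p q n) : Chain p (q + 1) n :=
  ⟨fun j => ((c j).1, k.succAbove (c j).2), fun _ _ h =>
    ⟨(c.monotone h).1, (Fin.succAboveOrderEmb k).monotone (c.monotone h).2⟩⟩

/-- Exchange of the two directions. -/
def swap (c : Chain p q n) : Chain q p n :=
  ⟨fun j => (c j).swap, fun _ _ h => ⟨(c.monotone h).2, (c.monotone h).1⟩⟩

end Chain

variable {A : Type w} [AddCommGroup A]

open Classical in
/-- The sum over those faces of shuffles that omit a vertex whose first coordinate is attained only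
at this vertex. -/
noncomputable def hSum (p q n : ℕ) (F : Chain p q n → A) : A :=
  ∑ x : Fin (n + 2) × Shuffle p q (n + 1),
    if ∀ j, j ≠ x.1 → (x.2.1 j).1 ≠ (x.2.1 x.1).1 then F (x.2.chain.face x.1) else 0

open Classical in
/-- The sum over those faces of shuffles that omit a vertex whose second coordinate is attained only
at this vertex. -/
noncomputable def vSum (p q n : ℕ) (F : Chain p q n → A) : A :=
  ∑ x : Fin (n + 2) × Shuffle p q (n + 1),
    if ∀ j, j ≠ x.1 → (x.2.1 j).2 ≠ (x.2.1 x.1).2 then F (x.2.chain.face x.1) else 0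

theorem vSum_eq (p q n : ℕ) (F : Chain p q n → A) :
    vSum p q n F = hSum q p n (fun c => F c.swap) := by
  classical
  exact Fintype.sum_equiv
    (⟨fun x => (x.1, x.2.swap), fun x => (x.1, x.2.swap), fun _ => rfl, fun _ => rfl⟩ :
      (Fin (n + 2) × Shuffle p q (n + 1)) ≃ (Fin (n + 2) × Shuffle q p (n + 1))) _ _ (fun _ => rfl)

theorem hSum_zero (q n : ℕ) (F : Chain 0 q n → A) : hSum 0 q n F = 0 := by
  classical
  refine Finset.sum_eq_zero fun x _ => if_neg ?_
  intro h
  obtain ⟨j, hj⟩ := exists_ne x.1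
  exact h j hj (Subsingleton.elim (α := Fin 1) _ _)

theorem hSum_succ (p q n : ℕ) (F : Chain (p + 1) q n → A) :
    hSum (p + 1) q n F = ∑ k : Fin (p + 2), ∑ c : Shuffle p q n, F (c.chain.col k) := by
  classical
  rw [hSum, ← Finset.sum_filter, ← Fintype.sum_prod_type']
  have key : ∀ x : Fin (n + 2) × Shuffle (p + 1) q (n + 1),
      (∀ j, j ≠ x.1 → (x.2.1 j).1 ≠ (x.2.1 x.1).1) →
      ∃ c : Shuffle p q n, x.2.chain.face x.1 = c.chain.col (x.2.1 x.1).1 := by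
    rintro ⟨i, c⟩ h
    have h' : ∀ j : Fin (n + 1), ∃ a, (c.1 i).1.succAbove a = (c.1 (i.succAbove j)).1 := fun j =>
      Fin.exists_succAbove_eq (h _ (Fin.succAbove_ne i j))
    choose a ha using h'
    refine ⟨⟨fun j => (a j, (c.1 (i.succAbove j)).2), by have := c.2.1; omega, ?_⟩, ?_⟩
    · intro j k hjk
      have h1 := c.2.2 ((Fin.succAboveOrderEmb i).strictMono hjk)
      change c.1 (i.succAbove j) < c.1 (i.succAbove k) at h1
      rw [Prod.lt_iff] at h1 ⊢
      rw [← ha j, ← ha k] at h1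
      simpa using h1
    · refine OrderHom.ext _ _ (funext fun j => ?_)
      exact Prod.ext (ha j).symm rfl
  choose g hg using key
  refine Finset.sum_bij (fun x hx => ((x.2.1 x.1).1, g x (Finset.mem_filter.1 hx).2))
    (fun _ _ => Finset.mem_univ _) ?_ ?_ ?_
  · rintro ⟨i, c⟩ hx ⟨i', c'⟩ hx' he
    have hk := congrArg Prod.fst he
    have hgg := congrArg Prod.snd he
    have e1 := hg _ (Finset.mem_filter.1 hx).2
    have e2 := hg _ (Finset.mem_filter.1 hx').2
    dsimp only at hk hgg e1 e2
    rw [hgg, hk, ← e2] at e1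
    have hf : ∀ j, c.1 (i.succAbove j) = c'.1 (i'.succAbove j) := fun j => DFunLike.congr_fun e1 j
    have hi : i = i' := by
      have : ∀ j, i.succAbove j = i'.succAbove j := fun j => by
        apply Fin.ext
        rw [← c.rank, ← c'.rank, hf]
      exact Fin.succAbove_left_injective (funext this)
    subst hi
    have hv : c.1 i = c'.1 i := by
      refine Prod.ext hk (Fin.ext ?_)
      have h1 := c.rank i
      have h2 := c'.rank i
      rw [hk] at h1
      omega
    have : c = c' := by
      apply Subtype.ext
      funext j
      rcases Fin.eq_self_or_eq_succAbove i j with rfl | ⟨j, rfl⟩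
      · exact hv
      · exact hf j
    rw [this]
  · rintro ⟨k, c⟩ -
    have hpq := c.2.1
    -- the position of the new vertex
    have hi : ∃ i : Fin (n + 2), ∀ j : Fin (n + 1), (j : ℕ) < i ↔ ((c.1 j).1 : ℕ) < k := by
      have hex : ∃ m : ℕ, ∀ j : Fin (n + 1), m ≤ j → (k : ℕ) ≤ (c.1 j).1 :=
        ⟨n + 1, fun j hj => absurd j.2 (by omega)⟩
      have hle : Nat.find hex ≤ n + 1 := Nat.find_min' _ (fun j hj => absurd j.2 (by omega))
      refine ⟨⟨Nat.find hex, by omega⟩, fun j => ⟨fun h => ?_, fun h => ?_⟩⟩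
      · by_contra h'
        refine Nat.find_min hex h fun l hl => ?_
        have := c.fst_mono (show j ≤ l from hl)
        omega
      · by_contra h'
        have := Nat.find_spec hex j (by simpa using h')
        omega
    obtain ⟨i, hi⟩ := hi
    have hki : (k : ℕ) ≤ i ∧ (i : ℕ) - k ≤ q ∧
        (∀ j : Fin (n + 1), (j : ℕ) < i → ((c.1 j).2 : ℕ) ≤ i - k) ∧
        (∀ j : Fin (n + 1), (i : ℕ) ≤ j → (i : ℕ) - k ≤ (c.1 j).2) := by
      rcases Nat.eq_zero_or_pos (i : ℕ) with h0 | h0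
      · have hk : (k : ℕ) = 0 := by
          have h1 := (hi 0).not
          have h2 := c.rank 0
          simp only [Fin.val_zero] at h1 h2
          omega
        refine ⟨by omega, by omega, fun j hj => by omega, fun j hj => by omega⟩
      · set l : Fin (n + 1) := ⟨i - 1, by omega⟩ with hl
        have hlv : (l : ℕ) = i - 1 := rfl
        have h1 := c.rank l
        have h2 := (hi l).1 (by omega)
        have h3 : ((c.1 l).1 : ℕ) + 1 = k := by
          rcases Nat.lt_or_ge (i : ℕ) (n + 1) with h4 | h4
          · have h5 := (hi ⟨i, h4⟩).not.1 (by simp)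
            have h6 := c.rank ⟨i, h4⟩
            have h7 := c.snd_mono (show l ≤ ⟨i, h4⟩ from by rw [Fin.le_def]; simp [hlv])
            simp only at h6
            omega
          · have := (c.1 l).1.2
            have := (c.1 l).2.2
            have := k.2
            omega
        refine ⟨by omega, by have := (c.1 l).2.2; omega, fun j hj => ?_, fun j hj => ?_⟩
        · have := c.snd_mono (show j ≤ l from by rw [Fin.le_def]; omega)
          omega
        · have := c.snd_mono (show l ≤ j from by rw [Fin.le_def]; omega)
          omega
    obtain ⟨h1, h2, h3, h4⟩ := hki
    let v : Fin (p + 2) × Fin (q + 1) := (k, ⟨i - k, by omega⟩)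
    let e : Fin (n + 2) → Fin (p + 2) × Fin (q + 1) :=
      Fin.insertNth i v (fun j => c.chain.col k j)
    have hei : e i = v := Fin.insertNth_apply_same ..
    have hej : ∀ j, e (i.succAbove j) = (k.succAbove (c.1 j).1, (c.1 j).2) := fun j =>
      Fin.insertNth_apply_succAbove ..
    have hmono : StrictMono e := by
      intro a b hab
      rcases Fin.eq_self_or_eq_succAbove i a with rfl | ⟨j, rfl⟩
      · rcases Fin.eq_self_or_eq_succAbove a b with rfl | ⟨l, rfl⟩
        · exact absurd hab (lt_irrefl _)
        · have hl : (a : ℕ) ≤ l := by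
            rw [Fin.lt_succAbove_iff_le_castSucc] at hab
            exact hab
          rw [hei, hej, Prod.lt_iff]
          refine Or.inl ⟨?_, ?_⟩
          · rw [Fin.lt_succAbove_iff_le_castSucc, Fin.le_def]
            have := (hi l).not.1 (by omega)
            simpa using this
          · exact h4 l hl
      · rcases Fin.eq_self_or_eq_succAbove i b with rfl | ⟨l, rfl⟩
        · have hl : (j : ℕ) < b := by
            rw [Fin.succAbove_lt_iff_castSucc_lt] at hab
            exact hab
          rw [hei, hej, Prod.lt_iff]
          refine Or.inl ⟨?_, ?_⟩
          · rw [Fin.succAbove_lt_iff_castSucc_lt, Fin.lt_def]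
            exact (hi j).1 hl
          · exact h3 j hl
        · have hjl : j < l := (Fin.succAboveOrderEmb i).lt_iff_lt.1 hab
          have := c.2.2 hjl
          rw [hej, hej]
          rw [Prod.lt_iff] at this ⊢
          simpa using this
    have hmem : ∀ j, j ≠ i → (e j).1 ≠ (e i).1 := by
      intro j hj
      obtain ⟨l, rfl⟩ := Fin.exists_succAbove_eq hj
      rw [hei, hej]
      exact Fin.succAbove_ne _ _
    refine ⟨(i, ⟨e, by omega, hmono⟩), Finset.mem_filter.2 ⟨Finset.mem_univ _, hmem⟩, ?_⟩
    have hgg := hg (i, ⟨e, by omega, hmono⟩) hmem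
    have hk : (e i).1 = k := by rw [hei]
    refine Prod.ext hk (Subtype.ext (funext fun j => ?_))
    have := DFunLike.congr_fun hgg j
    change e (i.succAbove j) = ((e i).1.succAbove _, _) at this
    rw [hej, hk] at this
    have e1 := Fin.succAbove_right_injective (congrArg Prod.fst this)
    have e2 := congrArg Prod.snd this
    exact (Prod.ext e1 e2).symm
  · rintro x hx
    exact congrArg F (hg _ _)

/-- The previous index. -/
def prv {n : ℕ} (i : Fin (n + 2)) : Fin (n + 2) := ⟨i - 1, by omega⟩

/-- The next index. -/
def nxt {n : ℕ} (i : Fin (n + 2)) : Fin (n + 2) := ⟨min (i + 1) (n + 1), by omega⟩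

/-- The path has a corner at the `i`-th vertex. -/
def IsCorner {p q n : ℕ} (c : Fin (n + 2) → Fin (p + 1) × Fin (q + 1)) (i : Fin (n + 2)) : Prop :=
  0 < (i : ℕ) ∧ (i : ℕ) < n + 1 ∧ ((c (nxt i)).1 : ℕ) = (c (prv i)).1 + 1 ∧
    ((c (nxt i)).2 : ℕ) = (c (prv i)).2 + 1

theorem isCorner_iff {p q n : ℕ} (c : Shuffle p q (n + 1)) (i : Fin (n + 2)) :
    IsCorner c.1 i ↔ (¬ ∀ j, j ≠ i → (c.1 j).1 ≠ (c.1 i).1) ∧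
      ¬ ∀ j, j ≠ i → (c.1 j).2 ≠ (c.1 i).2 := by
  have hp : (prv i : ℕ) = i - 1 := rfl
  have hn : (nxt i : ℕ) = min ((i : ℕ) + 1) (n + 1) := rfl
  have r0 := c.rank i
  have r1 := c.rank (prv i)
  have r2 := c.rank (nxt i)
  have m1 := c.fst_mono (show prv i ≤ i by rw [Fin.le_def]; omega)
  have m2 := c.snd_mono (show prv i ≤ i by rw [Fin.le_def]; omega)
  have m3 := c.fst_mono (show i ≤ nxt i by rw [Fin.le_def]; omega)
  have m4 := c.snd_mono (show i ≤ nxt i by rw [Fin.le_def]; omega)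
  constructor
  · rintro ⟨h1, h2, h3, h4⟩
    have n1 : prv i ≠ i := by rw [Ne, Fin.ext_iff]; omega
    have n2 : nxt i ≠ i := by rw [Ne, Fin.ext_iff]; omega
    constructor
    · intro h
      have a := h _ n1
      have b := h _ n2
      rw [Ne, Fin.ext_iff] at a b
      omega
    · intro h
      have a := h _ n1
      have b := h _ n2
      rw [Ne, Fin.ext_iff] at a b
      omega
  · rintro ⟨h1, h2⟩
    push Not at h1 h2
    obtain ⟨j, hj, hj'⟩ := h1
    obtain ⟨l, hl, hl'⟩ := h2
    rw [Fin.ext_iff] at hj' hl'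
    rw [Ne, Fin.ext_iff] at hj hl
    have rj := c.rank j
    have rl := c.rank l
    have jb := j.2
    have lb := l.2
    rcases Nat.lt_or_ge j i with h3 | h3
    · have k1 := c.fst_mono (show j ≤ prv i by rw [Fin.le_def]; omega)
      rcases Nat.lt_or_ge l i with h4 | h4
      · have k2 := c.snd_mono (show l ≤ prv i by rw [Fin.le_def]; omega)
        omega
      · have k2 := c.snd_mono (show nxt i ≤ l by rw [Fin.le_def]; omega)
        refine ⟨by omega, by omega, by omega, by omega⟩
    · have k1 := c.fst_mono (show nxt i ≤ j by rw [Fin.le_def]; omega)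
      rcases Nat.lt_or_ge l i with h4 | h4
      · have k2 := c.snd_mono (show l ≤ prv i by rw [Fin.le_def]; omega)
        refine ⟨by omega, by omega, by omega, by omega⟩
      · have k2 := c.snd_mono (show nxt i ≤ l by rw [Fin.le_def]; omega)
        omega

/-- Replacing a corner by the opposite one. -/
def flipFun {p q n : ℕ} (c : Fin (n + 2) → Fin (p + 1) × Fin (q + 1)) (i : Fin (n + 2)) :
    Fin (n + 2) → Fin (p + 1) × Fin (q + 1) :=
  Function.update c i
    (if (c i).1 = (c (prv i)).1 then ((c (nxt i)).1, (c (prv i)).2)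
      else ((c (prv i)).1, (c (nxt i)).2))

theorem flipFun_strictMono {p q n : ℕ} (c : Shuffle p q (n + 1)) (i : Fin (n + 2))
    (h : IsCorner c.1 i) : StrictMono (flipFun c.1 i) := by
  have hp : (prv i : ℕ) = i - 1 := rfl
  have hn : (nxt i : ℕ) = min ((i : ℕ) + 1) (n + 1) := rfl
  obtain ⟨h1, h2, h3, h4⟩ := h
  intro a b hab
  rw [Prod.lt_iff]
  simp only [Fin.lt_def, Fin.le_def]
  have hv : ∀ v, flipFun c.1 i i = v →
      (((c.1 (prv i)).1 : ℕ) ≤ v.1 ∧ ((c.1 (prv i)).2 : ℕ) ≤ v.2 ∧ (v.1 : ℕ) ≤ (c.1 (nxt i)).1 ∧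
      (v.2 : ℕ) ≤ (c.1 (nxt i)).2 ∧ (v.1 : ℕ) + v.2 = (c.1 (prv i)).1 + (c.1 (prv i)).2 + 1) := by
    rintro v rfl
    rw [flipFun, Function.update_self]
    split_ifs <;> dsimp only <;> omega
  obtain ⟨v1, v2, v3, v4, v5⟩ := hv _ rfl
  by_cases ha : a = i
  · subst ha
    have hb : flipFun c.1 a b = c.1 b := Function.update_of_ne hab.ne' _ _
    rw [hb]
    have k1 := c.fst_mono (show nxt a ≤ b by rw [Fin.le_def]; omega)
    have k2 := c.snd_mono (show nxt a ≤ b by rw [Fin.le_def]; omega)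
    omega
  · have ha' : flipFun c.1 i a = c.1 a := Function.update_of_ne ha _ _
    rw [ha']
    by_cases hb : b = i
    · subst hb
      have k1 := c.fst_mono (show a ≤ prv b by rw [Fin.le_def]; omega)
      have k2 := c.snd_mono (show a ≤ prv b by rw [Fin.le_def]; omega)
      omega
    · have hb' : flipFun c.1 i b = c.1 b := Function.update_of_ne hb _ _
      rw [hb']
      have k0 := c.2.2 hab
      rw [Prod.lt_iff] at k0
      exact k0

theorem flipFun_corner {p q n : ℕ} (c : Shuffle p q (n + 1)) (i : Fin (n + 2))
    (h : IsCorner c.1 i) : flipFun c.1 i (prv i) = c.1 (prv i) ∧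
      flipFun c.1 i (nxt i) = c.1 (nxt i) ∧ flipFun c.1 i i ≠ c.1 i ∧
      IsCorner (flipFun c.1 i) i ∧ flipFun (flipFun c.1 i) i = c.1 := by
  have hp : (prv i : ℕ) = i - 1 := rfl
  have hn : (nxt i : ℕ) = min ((i : ℕ) + 1) (n + 1) := rfl
  obtain ⟨h1, h2, h3, h4⟩ := h
  have e1 : flipFun c.1 i (prv i) = c.1 (prv i) :=
    Function.update_of_ne (by rw [Ne, Fin.ext_iff]; omega) _ _
  have e2 : flipFun c.1 i (nxt i) = c.1 (nxt i) :=
    Function.update_of_ne (by rw [Ne, Fin.ext_iff]; omega) _ _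
  have r0 := c.rank i
  have r1 := c.rank (prv i)
  have r2 := c.rank (nxt i)
  have m1 := c.fst_mono (show prv i ≤ i by rw [Fin.le_def]; omega)
  have m2 := c.snd_mono (show prv i ≤ i by rw [Fin.le_def]; omega)
  refine ⟨e1, e2, ?_, ⟨h1, h2, by rw [e1, e2]; exact h3, by rw [e1, e2]; exact h4⟩, ?_⟩
  · rw [flipFun, Function.update_self]
    intro h
    split_ifs at h with h5
    · rw [Prod.ext_iff, Fin.ext_iff, Fin.ext_iff] at h
      rw [Fin.ext_iff] at h5
      dsimp only at h
      omega
    · exact h5 (congrArg Prod.fst h).symm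
  · conv_lhs => rw [flipFun]
    rw [e1, e2]
    have e3 : flipFun c.1 i i = (if (c.1 i).1 = (c.1 (prv i)).1
        then ((c.1 (nxt i)).1, (c.1 (prv i)).2) else ((c.1 (prv i)).1, (c.1 (nxt i)).2)) :=
      Function.update_self ..
    rw [e3, flipFun, Function.update_idem]
    conv_rhs => rw [← Function.update_eq_self i c.1]
    congr 1
    by_cases h5 : (c.1 i).1 = (c.1 (prv i)).1
    · have h6 : (c.1 (nxt i)).1 ≠ (c.1 (prv i)).1 := by rw [Ne, Fin.ext_iff]; omega
      rw [if_pos h5, if_neg h6]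
      rw [Fin.ext_iff] at h5
      refine Prod.ext (Fin.ext ?_) (Fin.ext ?_) <;> dsimp only <;> omega
    · rw [if_neg h5, if_pos rfl]
      rw [Fin.ext_iff] at h5
      refine Prod.ext (Fin.ext ?_) (Fin.ext ?_) <;> dsimp only <;> omega

theorem sum_faces [Module 𝕂 A] (p q n : ℕ) (F : Chain p q n → A) :
    ∑ i : Fin (n + 2), ∑ c : Shuffle p q (n + 1), F (c.chain.face i) =
      hSum p q n F + vSum p q n F := by
  classical
  rw [← Fintype.sum_prod_type', hSum, vSum, ← Finset.sum_add_distrib]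
  have h2 : ∀ a : A, a + a = 0 := fun a => by
    rw [← two_smul 𝕂 a, show (2 : 𝕂) = 0 from rfl, zero_smul]
  have hcor : ∑ x : Fin (n + 2) × Shuffle p q (n + 1),
      (if IsCorner x.2.1 x.1 then F (x.2.chain.face x.1) else 0) = 0 := by
    rw [← Finset.sum_filter]
    refine Finset.sum_involution
      (fun x hx => (x.1, ⟨flipFun x.2.1 x.1, x.2.2.1,
        flipFun_strictMono x.2 x.1 (Finset.mem_filter.1 hx).2⟩)) ?_ ?_ ?_ ?_
    · rintro ⟨i, c⟩ hx
      have : ∀ d : Shuffle p q (n + 1), (∀ j, j ≠ i → d.1 j = c.1 j) →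
          F (c.chain.face i) + F (d.chain.face i) = 0 := by
        intro d hd
        have : d.chain.face i = c.chain.face i := by
          refine OrderHom.ext _ _ (funext fun j => ?_)
          exact hd _ (Fin.succAbove_ne _ _)
        rw [this, h2]
      exact this _ (fun j hj => Function.update_of_ne hj _ _)
    · rintro ⟨i, c⟩ hx _ h
      exact (flipFun_corner c i (Finset.mem_filter.1 hx).2).2.2.1
        (congrFun (congrArg (fun x : Fin (n + 2) × Shuffle p q (n + 1) => x.2.1) h) i)
    · rintro ⟨i, c⟩ hx
      exact Finset.mem_filter.2 ⟨Finset.mem_univ _,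
        (flipFun_corner c i (Finset.mem_filter.1 hx).2).2.2.2.1⟩
    · rintro ⟨i, c⟩ hx
      exact Prod.ext rfl (Subtype.ext (flipFun_corner c i (Finset.mem_filter.1 hx).2).2.2.2.2)
  refine Eq.trans ?_ (add_zero _)
  refine Eq.trans ?_ (congrArg (_ + ·) hcor)
  rw [← Finset.sum_add_distrib]
  refine Finset.sum_congr rfl ?_
  rintro ⟨i, c⟩ -
  dsimp only
  have hc := isCorner_iff c i
  by_cases a : ∀ j, j ≠ i → (c.1 j).1 ≠ (c.1 i).1
  · rw [if_pos a, if_neg (show ¬ IsCorner c.1 i from fun h => (hc.1 h).1 a), if_neg, add_zero,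
      add_zero]
    intro b
    -- the vertex is adjacent to another one, and shares a coordinate with it
    have r0 := c.rank i
    rcases Nat.eq_zero_or_pos (i : ℕ) with h0 | h0
    · have hi1 : (⟨1, by omega⟩ : Fin (n + 2)) ≠ i := by rw [Ne, Fin.ext_iff]; simp [h0]
      have r1 := c.rank ⟨1, by omega⟩
      have a' := a _ hi1
      have b' := b _ hi1
      rw [Ne, Fin.ext_iff] at a' b'
      simp only at r1
      omega
    · have hp : (prv i : ℕ) = i - 1 := rfl
      have hi1 : prv i ≠ i := by rw [Ne, Fin.ext_iff]; omega
      have r1 := c.rank (prv i)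
      have a' := a _ hi1
      have b' := b _ hi1
      have m1 := c.fst_mono (show prv i ≤ i by rw [Fin.le_def]; omega)
      have m2 := c.snd_mono (show prv i ≤ i by rw [Fin.le_def]; omega)
      rw [Ne, Fin.ext_iff] at a' b'
      omega
  · rw [if_neg a, zero_add]
    by_cases b : ∀ j, j ≠ i → (c.1 j).2 ≠ (c.1 i).2
    · rw [if_pos b, if_neg (show ¬ IsCorner c.1 i from fun h => (hc.1 h).2 b), add_zero]
    · rw [if_neg b, if_pos (hc.2 ⟨a, b⟩), zero_add]

end Shuffles

section Chains

/-- The span of the degenerate `q`-simplices. -/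
noncomputable def degen (Z : SSet.{u}) (q : ℕ) : Submodule 𝕂 (Z _⦋q⦌ →₀ 𝕂) :=
  Submodule.span 𝕂 ((fun z => Finsupp.single z 1) '' Z.degenerate q)

/-- The normalized mod 2 chains `S_q(Z)` of a simplicial set in degree `q`: the quotient
of `𝕂 Z_q` by the images of the degeneracies. -/
def N (Z : SSet.{u}) (q : ℕ) : Type u := (Z _⦋q⦌ →₀ 𝕂) ⧸ degen Z q

noncomputable instance (Z : SSet.{u}) (q : ℕ) : AddCommGroup (N Z q) :=
  inferInstanceAs (AddCommGroup ((Z _⦋q⦌ →₀ 𝕂) ⧸ degen Z q))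

noncomputable instance (Z : SSet.{u}) (q : ℕ) : Module 𝕂 (N Z q) :=
  inferInstanceAs (Module 𝕂 ((Z _⦋q⦌ →₀ 𝕂) ⧸ degen Z q))

/-- The class of a simplex. -/
noncomputable def cl {Z : SSet.{u}} {q : ℕ} (z : Z _⦋q⦌) : N Z q :=
  Submodule.Quotient.mk (Finsupp.single z 1)

variable {Z Z' Z₁ Z₁' : SSet.{u}}

theorem cl_degenerate {q : ℕ} {z : Z _⦋q⦌} (h : z ∈ Z.degenerate q) : cl z = 0 :=
  (Submodule.Quotient.mk_eq_zero _).2 (Submodule.subset_span ⟨z, h, rfl⟩)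

/-- The linear map that is determined by its values on simplices. -/
noncomputable def lift {A : Type w} [AddCommGroup A] [Module 𝕂 A] {q : ℕ} (g : Z _⦋q⦌ → A)
    (hg : ∀ z ∈ Z.degenerate q, g z = 0) : N Z q →ₗ[𝕂] A :=
  (degen Z q).liftQ (Finsupp.linearCombination 𝕂 g) (by
    rw [degen, Submodule.span_le]
    rintro _ ⟨z, hz, rfl⟩
    change Finsupp.linearCombination 𝕂 g (Finsupp.single z 1) = 0
    rw [Finsupp.linearCombination_single, hg z hz, smul_zero])

theorem lift_cl {A : Type w} [AddCommGroup A] [Module 𝕂 A] {q : ℕ} (g : Z _⦋q⦌ → A)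
    (hg : ∀ z ∈ Z.degenerate q, g z = 0) (z : Z _⦋q⦌) : lift g hg (cl z) = g z := by
  change Finsupp.linearCombination 𝕂 g (Finsupp.single z 1) = _
  rw [Finsupp.linearCombination_single, one_smul]

theorem N_ext {A : Type w} [AddCommGroup A] [Module 𝕂 A] {q : ℕ} {f g : N Z q →ₗ[𝕂] A}
    (h : ∀ z, f (cl z) = g (cl z)) : f = g := by
  refine Submodule.linearMap_qext _ (Finsupp.lhom_ext' fun z => LinearMap.ext_ring ?_)
  exact h z

theorem add_self_eq_zero {A : Type w} [AddCommGroup A] [Module 𝕂 A] (a : A) : a + a = 0 := by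
  rw [← two_smul 𝕂 a, show (2 : 𝕂) = 0 from rfl, zero_smul]

theorem bdry_degenerate {q : ℕ} (z : Z _⦋q + 1⦌) (h : z ∈ Z.degenerate (q + 1)) :
    ∑ i : Fin (q + 2), cl (Z.δ i z) = 0 := by
  rw [SSet.degenerate_eq_iUnion_range_σ, Set.mem_iUnion] at h
  obtain ⟨j, y, rfl⟩ := h
  have hne : j.castSucc ≠ j.succ := j.castSucc_lt_succ.ne
  have : ∀ i : Fin (q + 2), i ∉ ({j.castSucc, j.succ} : Finset (Fin (q + 2))) →
      cl (Z.δ i (Z.σ j y)) = 0 := by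
    intro i hi
    simp only [Finset.mem_insert, Finset.mem_singleton, not_or] at hi
    obtain ⟨h1, h2⟩ := hi
    rw [Fin.ext_iff] at h1 h2
    simp only [Fin.val_castSucc, Fin.val_succ] at h1 h2
    apply cl_degenerate
    obtain _ | q := q
    · omega
    rcases Nat.lt_or_ge i j with h3 | h3
    · obtain ⟨i', rfl⟩ : ∃ i' : Fin (q + 2), i = i'.castSucc := ⟨⟨i, by omega⟩, rfl⟩
      obtain ⟨j', rfl⟩ : ∃ j' : Fin (q + 1), j = j'.succ :=
        ⟨⟨j - 1, by omega⟩, Fin.ext (by simp only [Fin.val_succ]; omega)⟩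
      rw [SSet.δ_comp_σ_of_le_apply (by
        rw [Fin.le_def]; simp only [Fin.val_castSucc, Fin.val_succ] at h3 ⊢; omega)]
      exact SSet.σ_mem_degenerate _ _ _
    · obtain ⟨i', rfl⟩ : ∃ i' : Fin (q + 2), i = i'.succ :=
        ⟨⟨i - 1, by omega⟩, Fin.ext (by simp only [Fin.val_succ]; omega)⟩
      simp only [Fin.val_succ] at h2 h3 h1
      obtain ⟨j', rfl⟩ : ∃ j' : Fin (q + 1), j = j'.castSucc := ⟨⟨j, by omega⟩, rfl⟩
      rw [SSet.δ_comp_σ_of_gt_apply (by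
        rw [Fin.lt_def]; simp only [Fin.val_castSucc] at h2 h3 h1 ⊢; omega)]
      exact SSet.σ_mem_degenerate _ _ _
  rw [← Finset.sum_subset (Finset.subset_univ {j.castSucc, j.succ}) (fun i _ hi => this i hi),
    Finset.sum_pair hne, SSet.δ_comp_σ_self_apply, SSet.δ_comp_σ_succ_apply, add_self_eq_zero]

/-- The boundary map `S_{q+1}(Z) → S_q(Z)`, the (alternating) sum of the face maps. -/
noncomputable def bdry (Z : SSet.{u}) (q : ℕ) : N Z (q + 1) →ₗ[𝕂] N Z q :=
  lift (fun z => ∑ i : Fin (q + 2), cl (Z.δ i z)) bdry_degenerate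

theorem bdry_cl {q : ℕ} (z : Z _⦋q + 1⦌) : bdry Z q (cl z) = ∑ i : Fin (q + 2), cl (Z.δ i z) :=
  lift_cl ..

theorem sum_sum_eq_zero {A : Type w} [AddCommGroup A] [Module 𝕂 A] {n : ℕ}
    (g : Fin (n + 2) → Fin (n + 3) → A)
    (h : ∀ i j : Fin (n + 2), i ≤ j → g i j.succ = g j i.castSucc) :
    ∑ i, ∑ j, g i j = 0 := by
  classical
  rw [← Fintype.sum_prod_type']
  have key : ∀ a : Fin (n + 2), ∀ b : Fin (n + 3), ∃ y : Fin (n + 2) × Fin (n + 3),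
      ((a : ℕ) < b → (y.1 : ℕ) = b - 1 ∧ (y.2 : ℕ) = a) ∧
      ((b : ℕ) ≤ a → (y.1 : ℕ) = b ∧ (y.2 : ℕ) = a + 1) := by
    intro a b
    rcases Nat.lt_or_ge a b with h1 | h1
    · exact ⟨(⟨b - 1, by omega⟩, ⟨a, by omega⟩), fun _ => ⟨rfl, rfl⟩, fun _ => by omega⟩
    · exact ⟨(⟨b, by omega⟩, ⟨a + 1, by omega⟩), fun _ => by omega, fun _ => ⟨rfl, rfl⟩⟩
  choose t ht ht' using key
  refine Finset.sum_involution (fun x _ => t x.1 x.2) ?_ ?_ (fun _ _ => Finset.mem_univ _) ?_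
  · rintro ⟨a, b⟩ -
    suffices g (t a b).1 (t a b).2 = g a b by
      dsimp only
      rw [this, add_self_eq_zero]
    have k1 := ht a b
    have k2 := ht' a b
    rcases Nat.lt_or_ge a b with h1 | h1
    · have h2 := k1 h1
      have e := h a ⟨b - 1, by omega⟩ (by rw [Fin.le_def]; change (a : ℕ) ≤ b - 1; omega)
      have e1 : (t a b).1 = ⟨b - 1, by omega⟩ := Fin.ext h2.1
      have e2 : (t a b).2 = a.castSucc := Fin.ext h2.2
      have e3 : (⟨b - 1, by omega⟩ : Fin (n + 2)).succ = b := Fin.ext (by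
        change (b : ℕ) - 1 + 1 = b; omega)
      rw [e1, e2, ← e, e3]
    · have h2 := k2 h1
      have e := h ⟨b, by omega⟩ a h1
      have e1 : (t a b).1 = ⟨b, by omega⟩ := Fin.ext h2.1
      have e2 : (t a b).2 = a.succ := Fin.ext h2.2
      rw [e1, e2, e]
      rfl
  · rintro ⟨a, b⟩ - - he
    have k1 := ht a b
    have k2 := ht' a b
    have he1 := congrArg (fun x => (x.1 : ℕ)) he
    have he2 := congrArg (fun x => (x.2 : ℕ)) he
    dsimp only at he1 he2
    omega
  · rintro ⟨a, b⟩ -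
    have k1 := ht a b
    have k2 := ht' a b
    have k3 := ht (t a b).1 (t a b).2
    have k4 := ht' (t a b).1 (t a b).2
    dsimp only
    refine Prod.ext (Fin.ext ?_) (Fin.ext ?_) <;> dsimp only <;> omega

theorem bdry_bdry (Z : SSet.{u}) (q : ℕ) (x : N Z (q + 2)) : bdry Z q (bdry Z (q + 1) x) = 0 := by
  suffices bdry Z q ∘ₗ bdry Z (q + 1) = 0 from LinearMap.congr_fun this x
  refine N_ext fun z => ?_
  rw [LinearMap.comp_apply, bdry_cl, map_sum, LinearMap.zero_apply]
  simp only [bdry_cl]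
  rw [Finset.sum_comm]
  refine sum_sum_eq_zero (fun i j => cl (Z.δ i (Z.δ j z))) fun i j h => ?_
  exact congrArg cl (ConcreteCategory.congr_hom (Z.δ_comp_δ h) z)

/-- The map on normalized chains induced by a map of spaces. -/
noncomputable def nmap (f : Z ⟶ Z') (q : ℕ) : N Z q →ₗ[𝕂] N Z' q :=
  lift (fun z => cl (f.app _ z)) (fun _ hz => cl_degenerate (SSet.degenerate_le_preimage f q hz))

theorem nmap_cl (f : Z ⟶ Z') (q : ℕ) (z : Z _⦋q⦌) : nmap f q (cl z) = cl (f.app _ z) := lift_cl ..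

theorem nmap_comp (f : Z ⟶ Z') (g : Z' ⟶ Z₁) (q : ℕ) (x : N Z q) :
    nmap g q (nmap f q x) = nmap (f ≫ g) q x := by
  suffices nmap g q ∘ₗ nmap f q = nmap (f ≫ g) q from LinearMap.congr_fun this x
  refine N_ext fun z => ?_
  rw [LinearMap.comp_apply, nmap_cl, nmap_cl, nmap_cl]; rfl

theorem nmap_bdry (f : Z ⟶ Z') (q : ℕ) (x : N Z (q + 1)) :
    nmap f q (bdry Z q x) = bdry Z' q (nmap f (q + 1) x) := by
  suffices nmap f q ∘ₗ bdry Z q = bdry Z' q ∘ₗ nmap f (q + 1) from LinearMap.congr_fun this x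
  refine N_ext fun z => ?_
  rw [LinearMap.comp_apply, LinearMap.comp_apply, nmap_cl, bdry_cl, bdry_cl, map_sum]
  refine Finset.sum_congr rfl fun i _ => ?_
  rw [nmap_cl]
  congr 1
  exact NatTrans.naturality_apply f (SimplexCategory.δ i).op z

/-- The first component of a simplex of `Δ^p × Δ^q`. -/
def Chain.fst {p q n : ℕ} (c : Chain p q n) : ⦋n⦌ ⟶ ⦋p⦌ :=
  SimplexCategory.mkHom (OrderHom.fst.comp c)

/-- The second component of a simplex of `Δ^p × Δ^q`. -/
def Chain.snd {p q n : ℕ} (c : Chain p q n) : ⦋n⦌ ⟶ ⦋q⦌ :=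
  SimplexCategory.mkHom (OrderHom.snd.comp c)

/-- The simplex of `Z × Z'` obtained by restricting a pair of simplices along
a simplex of `Δ^p × Δ^q`. -/
def pull {p q n : ℕ} (z : Z _⦋p⦌) (z' : Z' _⦋q⦌) (c : Chain p q n) : (Z ⊗ Z' : SSet.{u}) _⦋n⦌ :=
  (Z.map c.fst.op z, Z'.map c.snd.op z')

theorem pull_degenerate {p q n : ℕ} (z : Z _⦋p⦌) (z' : Z' _⦋q⦌) (c : Chain p q n)
    (h : p + q < n) : pull z z' c ∈ (Z ⊗ Z' : SSet.{u}).degenerate n := by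
  have h1 : SSet.prodStdSimplex.objEquiv.{u}.symm c ∈ (Δ[p] ⊗ Δ[q] : SSet.{u}).degenerate n := by
    rw [SSet.degenerate_eq_univ_of_hasDimensionLT _ (p + q + 1) n h]
    trivial
  exact SSet.degenerate_le_preimage (SSet.yonedaEquiv.symm z ⊗ₘ SSet.yonedaEquiv.symm z') n h1

theorem pull_face {p q n : ℕ} (z : Z _⦋p⦌) (z' : Z' _⦋q⦌) (c : Chain p q (n + 1))
    (i : Fin (n + 2)) : (Z ⊗ Z' : SSet.{u}).δ i (pull z z' c) = pull z z' (c.face i) := by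
  refine Prod.ext ?_ ?_
  · exact (Functor.map_comp_apply Z c.fst.op (SimplexCategory.δ i).op z).symm
  · exact (Functor.map_comp_apply Z' c.snd.op (SimplexCategory.δ i).op z').symm

theorem pull_map {p q p' q' n : ℕ} (z : Z _⦋p⦌) (z' : Z' _⦋q⦌) (f : ⦋p'⦌ ⟶ ⦋p⦌) (g : ⦋q'⦌ ⟶ ⦋q⦌)
    (c : Chain p' q' n) : pull (Z.map f.op z) (Z'.map g.op z') c =
      pull z z' ((f.toOrderHom.prodMap g.toOrderHom).comp c) := by
  refine Prod.ext ?_ ?_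
  · exact (Functor.map_comp_apply Z f.op c.fst.op z).symm
  · exact (Functor.map_comp_apply Z' g.op c.snd.op z').symm

theorem pull_col {p q n : ℕ} (z : Z _⦋p + 1⦌) (z' : Z' _⦋q⦌) (c : Chain p q n) (k : Fin (p + 2)) :
    pull (Z.δ k z) z' c = pull z z' (c.col k) := by
  have e : (c.col k).fst = c.fst ≫ SimplexCategory.δ k := rfl
  refine Prod.ext ?_ rfl
  change Z.map c.fst.op (Z.map (SimplexCategory.δ k).op z) = Z.map (c.col k).fst.op z
  rw [e, op_comp, Functor.map_comp_apply]

theorem pull_row {p q n : ℕ} (z : Z _⦋p⦌) (z' : Z' _⦋q + 1⦌) (c : Chain p q n) (k : Fin (q + 2)) :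
    pull z (Z'.δ k z') c = pull z z' (c.row k) := by
  have e : (c.row k).snd = c.snd ≫ SimplexCategory.δ k := rfl
  refine Prod.ext rfl ?_
  change Z'.map c.snd.op (Z'.map (SimplexCategory.δ k).op z') = Z'.map (c.row k).snd.op z'
  rw [e, op_comp, Functor.map_comp_apply]

theorem pull_left_degenerate {p q n : ℕ} (z : Z _⦋p⦌) (z' : Z' _⦋q⦌) (hz : z ∈ Z.degenerate p)
    (c : Shuffle p q n) : cl (pull z z' c.chain) = 0 := by
  obtain ⟨m, hm, f, y, rfl⟩ := hz
  have h := pull_map y z' f (𝟙 _) c.chain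
  rw [op_id, Z'.map_id] at h
  refine (congrArg cl h).trans (cl_degenerate (pull_degenerate _ _ _ ?_))
  have := c.2.1
  omega

theorem pull_right_degenerate {p q n : ℕ} (z : Z _⦋p⦌) (z' : Z' _⦋q⦌) (hz : z' ∈ Z'.degenerate q)
    (c : Shuffle p q n) : cl (pull z z' c.chain) = 0 := by
  obtain ⟨m, hm, f, y, rfl⟩ := hz
  have h := pull_map z y (𝟙 _) f c.chain
  rw [op_id, Z.map_id] at h
  refine (congrArg cl h).trans (cl_degenerate (pull_degenerate _ _ _ ?_))
  have := c.2.1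
  omega

/-- The shuffle map `∇ : S_p(Z) ⊗ S_q(Z') → S_n(Z × Z')`, where `n = p + q`. -/
noncomputable def shuffle (Z Z' : SSet.{u}) (p q n : ℕ) :
    N Z p →ₗ[𝕂] N Z' q →ₗ[𝕂] N (Z ⊗ Z') n :=
  lift (fun z => lift (fun z' => ∑ c : Shuffle p q n, cl (pull z z' c.chain))
      (fun z' hz' => Finset.sum_eq_zero fun c _ => pull_right_degenerate z z' hz' c))
    (fun z hz => N_ext fun z' => by
      rw [lift_cl, LinearMap.zero_apply]
      exact Finset.sum_eq_zero fun c _ => pull_left_degenerate z z' hz c)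

theorem shuffle_cl {p q n : ℕ} (z : Z _⦋p⦌) (z' : Z' _⦋q⦌) :
    shuffle Z Z' p q n (cl z) (cl z') = ∑ c : Shuffle p q n, cl (pull z z' c.chain) := by
  rw [shuffle, lift_cl, lift_cl]

theorem shuffle_eq_zero {p q n : ℕ} (h : p + q ≠ n) (x : N Z p) (y : N Z' q) :
    shuffle Z Z' p q n x y = 0 := by
  suffices shuffle Z Z' p q n = 0 by rw [this]; rfl
  refine N_ext fun z => N_ext fun z' => ?_
  rw [shuffle_cl]
  have : IsEmpty (Shuffle p q n) := ⟨fun c => h c.2.1⟩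
  exact Finset.sum_of_isEmpty _

/-- A bilinear identity may be checked on simplices. -/
theorem N_ext₂ {A : Type w} [AddCommGroup A] [Module 𝕂 A] {p q : ℕ}
    {f g : N Z p →ₗ[𝕂] N Z' q →ₗ[𝕂] A}
    (h : ∀ z z', f (cl z) (cl z') = g (cl z) (cl z')) : f = g :=
  N_ext fun z => N_ext fun z' => h z z'

theorem nmap_shuffle (f : Z ⟶ Z₁) (g : Z' ⟶ Z₁') {p q n : ℕ} (x : N Z p) (y : N Z' q) :
    nmap (f ⊗ₘ g) n (shuffle Z Z' p q n x y) = shuffle Z₁ Z₁' p q n (nmap f p x) (nmap g q y) := by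
  suffices (shuffle Z Z' p q n).compr₂ (nmap (f ⊗ₘ g) n) =
      (shuffle Z₁ Z₁' p q n).compl₁₂ (nmap f p) (nmap g q) from
    LinearMap.congr_fun₂ this x y
  refine N_ext₂ fun z z' => ?_
  rw [LinearMap.compr₂_apply, LinearMap.compl₁₂_apply, shuffle_cl, nmap_cl, nmap_cl, shuffle_cl,
    map_sum]
  refine Finset.sum_congr rfl fun c _ => ?_
  rw [nmap_cl]
  refine congrArg cl (Prod.ext ?_ ?_)
  · exact NatTrans.naturality_apply f c.chain.fst.op z
  · exact NatTrans.naturality_apply g c.chain.snd.op z'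

theorem bdry_shuffle_cl {p q n : ℕ} (z : Z _⦋p⦌) (z' : Z' _⦋q⦌) :
    bdry (Z ⊗ Z') n (shuffle Z Z' p q (n + 1) (cl z) (cl z')) =
      hSum p q n (fun c => cl (pull z z' c)) + vSum p q n (fun c => cl (pull z z' c)) := by
  rw [shuffle_cl, map_sum, ← sum_faces, Finset.sum_comm]
  refine Finset.sum_congr rfl fun c _ => ?_
  rw [bdry_cl]
  exact Finset.sum_congr rfl fun i _ => congrArg cl (pull_face z z' c.chain i)

theorem hSum_pull {p q n : ℕ} (z : Z _⦋p + 1⦌) (z' : Z' _⦋q⦌) :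
    hSum (p + 1) q n (fun c => cl (pull z z' c)) =
      shuffle Z Z' p q n (bdry Z p (cl z)) (cl z') := by
  rw [hSum_succ, bdry_cl, map_sum, LinearMap.sum_apply]
  refine Finset.sum_congr rfl fun k _ => ?_
  rw [shuffle_cl]
  exact Finset.sum_congr rfl fun c _ => congrArg cl (pull_col z z' c.chain k).symm

theorem vSum_zero {A : Type w} [AddCommGroup A] (p n : ℕ) (F : Chain p 0 n → A) :
    vSum p 0 n F = 0 := by
  rw [vSum_eq, hSum_zero]

theorem vSum_pull {p q n : ℕ} (z : Z _⦋p⦌) (z' : Z' _⦋q + 1⦌) :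
    vSum p (q + 1) n (fun c => cl (pull z z' c)) =
      shuffle Z Z' p q n (cl z) (bdry Z' q (cl z')) := by
  rw [vSum_eq, hSum_succ, bdry_cl, map_sum]
  refine Finset.sum_congr rfl fun k _ => ?_
  rw [shuffle_cl]
  refine Fintype.sum_equiv (⟨Shuffle.swap, Shuffle.swap, fun _ => rfl, fun _ => rfl⟩ :
      Shuffle q p n ≃ Shuffle p q n) _ _ (fun c => ?_)
  exact congrArg cl (pull_row z z' c.swap.chain k).symm

/-- The part of the boundary of a product that is due to the first factor. -/
noncomputable def bdryL (Z Z' : SSet.{u}) : ∀ p q n : ℕ, N Z p →ₗ[𝕂] N Z' q →ₗ[𝕂] N (Z ⊗ Z') n :=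
  fun p q n => match p with
  | 0 => 0
  | p + 1 => (shuffle Z Z' p q n).comp (bdry Z p)

/-- The part of the boundary of a product that is due to the second factor. -/
noncomputable def bdryR (Z Z' : SSet.{u}) : ∀ p q n : ℕ, N Z p →ₗ[𝕂] N Z' q →ₗ[𝕂] N (Z ⊗ Z') n :=
  fun p q n => match q with
  | 0 => 0
  | q + 1 => (shuffle Z Z' p q n).compl₂ (bdry Z' q)

theorem bdry_shuffle (p q n : ℕ) (x : N Z p) (y : N Z' q) :
    bdry (Z ⊗ Z') n (shuffle Z Z' p q (n + 1) x y) =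
      bdryL Z Z' p q n x y + bdryR Z Z' p q n x y := by
  suffices (shuffle Z Z' p q (n + 1)).compr₂ (bdry (Z ⊗ Z') n) =
      bdryL Z Z' p q n + bdryR Z Z' p q n from LinearMap.congr_fun₂ this x y
  refine N_ext₂ fun z z' => ?_
  rw [LinearMap.compr₂_apply, bdry_shuffle_cl, LinearMap.add_apply, LinearMap.add_apply]
  congr 1
  · obtain _ | p := p
    · rw [hSum_zero]; rfl
    · rw [hSum_pull]; rfl
  · obtain _ | q := q
    · rw [vSum_zero]; rfl
    · rw [vSum_pull]; rfl

/-- The module of all (normalized, mod 2) chains of a space. -/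
abbrev Ch (Z : SSet.{u}) : Type u := ∀ q, N Z q

/-- The boundary map. -/
noncomputable def chBdry (Z : SSet.{u}) : Ch Z →ₗ[𝕂] Ch Z :=
  LinearMap.pi fun q => bdry Z q ∘ₗ LinearMap.proj (q + 1)

/-- The induced map. -/
noncomputable def chMap (f : Z ⟶ Z') : Ch Z →ₗ[𝕂] Ch Z' :=
  LinearMap.pi fun q => nmap f q ∘ₗ LinearMap.proj q

/-- The shuffle map on all chains. -/
noncomputable def chShuffle (Z Z' : SSet.{u}) : Ch Z →ₗ[𝕂] Ch Z' →ₗ[𝕂] Ch (Z ⊗ Z') :=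
  LinearMap.mk₂ 𝕂
    (fun x y n => ∑ a ∈ Finset.HasAntidiagonal.antidiagonal n, shuffle Z Z' a.1 a.2 n (x a.1) (y a.2))
    (fun _ _ _ => by
      funext n
      simp only [Pi.add_apply, map_add, LinearMap.add_apply, Finset.sum_add_distrib])
    (fun _ _ _ => by
      funext n
      simp only [Pi.smul_apply, map_smul, LinearMap.smul_apply, Finset.smul_sum])
    (fun _ _ _ => by
      funext n
      simp only [Pi.add_apply, map_add, Finset.sum_add_distrib])
    (fun _ _ _ => by
      funext n
      simp only [Pi.smul_apply, map_smul, Finset.smul_sum])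

theorem chShuffle_apply (x : Ch Z) (y : Ch Z') (n : ℕ) : chShuffle Z Z' x y n =
    ∑ a ∈ Finset.HasAntidiagonal.antidiagonal n, shuffle Z Z' a.1 a.2 n (x a.1) (y a.2) := rfl

theorem chBdry_chShuffle (x : Ch Z) (y : Ch Z') : chBdry _ (chShuffle Z Z' x y) =
    chShuffle Z Z' (chBdry Z x) y + chShuffle Z Z' x (chBdry Z' y) := by
  funext n
  change bdry _ n (chShuffle Z Z' x y (n + 1)) = chShuffle Z Z' (chBdry Z x) y n +
    chShuffle Z Z' x (chBdry Z' y) n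
  simp only [chShuffle_apply, map_sum, bdry_shuffle, Finset.sum_add_distrib]
  congr 1
  · rw [Finset.Nat.sum_antidiagonal_succ]
    exact zero_add _
  · rw [Finset.Nat.sum_antidiagonal_succ']
    exact zero_add _

theorem chMap_chShuffle (f : Z ⟶ Z₁) (g : Z' ⟶ Z₁') (x : Ch Z) (y : Ch Z') :
    chMap (f ⊗ₘ g) (chShuffle Z Z' x y) = chShuffle Z₁ Z₁' (chMap f x) (chMap g y) := by
  funext n
  change nmap _ n (chShuffle Z Z' x y n) = _
  rw [chShuffle_apply, chShuffle_apply, map_sum]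
  exact Finset.sum_congr rfl fun a _ => nmap_shuffle f g _ _

theorem chMap_comp (f : Z ⟶ Z') (g : Z' ⟶ Z₁) (x : Ch Z) :
    chMap g (chMap f x) = chMap (f ≫ g) x := funext fun q => nmap_comp f g q (x q)

theorem chMap_chBdry (f : Z ⟶ Z') (x : Ch Z) : chMap f (chBdry Z x) = chBdry Z' (chMap f x) :=
  funext fun q => nmap_bdry f q (x (q + 1))

/-- The chains that are concentrated in degree `n`. -/
def chDeg (Z : SSet.{u}) (n : ℤ) : Submodule 𝕂 (Ch Z) where
  carrier := {x | ∀ q : ℕ, (q : ℤ) ≠ n → x q = 0}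
  add_mem' hx hy q hq := by rw [Pi.add_apply, hx q hq, hy q hq, add_zero]
  zero_mem' _ _ := rfl
  smul_mem' a x hx q hq := by rw [Pi.smul_apply, hx q hq, smul_zero]

theorem chBdry_deg {n : ℤ} {x : Ch Z} (hx : x ∈ chDeg Z n) : chBdry Z x ∈ chDeg Z (n - 1) := by
  intro q hq
  change bdry Z q (x (q + 1)) = 0
  rw [hx (q + 1) (by push_cast; omega), map_zero]

theorem chMap_deg (f : Z ⟶ Z') {n : ℤ} {x : Ch Z} (hx : x ∈ chDeg Z n) :
    chMap f x ∈ chDeg Z' n := by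
  intro q hq
  change nmap f q (x q) = 0
  rw [hx q hq, map_zero]

theorem chShuffle_deg {m n : ℤ} {x : Ch Z} {y : Ch Z'} (hx : x ∈ chDeg Z m) (hy : y ∈ chDeg Z' n) :
    chShuffle Z Z' x y ∈ chDeg (Z ⊗ Z') (m + n) := by
  intro q hq
  rw [chShuffle_apply]
  refine Finset.sum_eq_zero fun a ha => ?_
  rw [Finset.HasAntidiagonal.mem_antidiagonal] at ha
  by_cases h : (a.1 : ℤ) = m
  · rw [hy a.2 (by omega), map_zero]
  · rw [hx a.1 h, map_zero, LinearMap.zero_apply]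

/-- The normalized mod 2 chain complex `S_*(Z)`. -/
noncomputable def S (Z : SSet.{u}) : Cpx.{u} where
  M := Ch Z
  grp := inferInstanceAs (AddCommGroup (Ch Z))
  mod := inferInstanceAs (Module 𝕂 (Ch Z))
  deg := chDeg Z
  d := chBdry Z
  d_deg _ _ hx := chBdry_deg hx
  d_d x := funext fun q => bdry_bdry Z q (x (q + 2))

/-- The chain map induced by a map of spaces. -/
noncomputable def S.map (f : Z ⟶ Z') : Cpx.Hom (S Z) (S Z') where
  f := chMap f
  map_deg _ _ hx := chMap_deg f hx
  comm _ x _ := chMap_chBdry f x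

/-- The shuffle map `∇ : S_*(Z) ⊗ S_*(Z') → S_*(Z × Z')`. -/
noncomputable def S.shuffle (Z Z' : SSet.{u}) : Cpx.Pairing (S Z) (S Z') (S (Z ⊗ Z')) where
  f := chShuffle Z Z'
  map_deg _ _ _ hx _ hy := chShuffle_deg hx hy
  leibniz x y := chBdry_chShuffle x y

end Chains

/-- Cosimplicial spaces, i.e. cosimplicial objects in the category of simplicial sets. -/
abbrev CosSp : Type (u + 1) := SimplexCategory ⥤ SSet.{u}

section Cosimplicial

variable (X Y : CosSp.{u})

/-- The ambient module: all families `(x_p)_p` of chains `x_p` of the spaces `X^p`. -/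
abbrev CCh : Type u := ∀ p : ℕ, Ch (X.obj ⦋p⦌)

/-- The sum of the cofaces `X^p → X^{p+1}`. -/
noncomputable def cobdry (p : ℕ) : Ch (X.obj ⦋p⦌) →ₗ[𝕂] Ch (X.obj ⦋p + 1⦌) :=
  ∑ i : Fin (p + 2), chMap (X.map (SimplexCategory.δ i))

/-- The horizontal differential. -/
noncomputable def hBdry : CCh X →ₗ[𝕂] CCh X :=
  LinearMap.pi fun p => match p with
    | 0 => 0
    | p + 1 => cobdry X p ∘ₗ LinearMap.proj p

/-- The vertical differential. -/
noncomputable def vBdry : CCh X →ₗ[𝕂] CCh X :=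
  LinearMap.pi fun p => chBdry (X.obj ⦋p⦌) ∘ₗ LinearMap.proj p

/-- The families that are conormalized, i.e. that are annihilated by all codegeneracies. -/
def conorm : Submodule 𝕂 (CCh X) where
  carrier := {x | ∀ (p : ℕ) (i : Fin (p + 1)), chMap (X.map (SimplexCategory.σ i)) (x (p + 1)) = 0}
  add_mem' hx hy p i := by rw [Pi.add_apply, map_add, hx, hy, add_zero]
  zero_mem' p i := by rw [Pi.zero_apply, map_zero]
  smul_mem' a x hx p i := by rw [Pi.smul_apply, map_smul, hx, smul_zero]

/-- The families `(x_p)` such that `x_p` has degree `n + p`. -/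
def totDeg (n : ℤ) : Submodule 𝕂 (CCh X) where
  carrier := {x | ∀ p : ℕ, x p ∈ chDeg (X.obj ⦋p⦌) (n + p)}
  add_mem' hx hy p := add_mem (hx p) (hy p)
  zero_mem' _ := zero_mem _
  smul_mem' a _ hx p := Submodule.smul_mem _ a (hx p)

/-- The families with `x_p = 0` for `p < s`. -/
def colFil (s : ℤ) : Submodule 𝕂 (CCh X) where
  carrier := {x | ∀ p : ℕ, (p : ℤ) < s → x p = 0}
  add_mem' hx hy p hp := by rw [Pi.add_apply, hx p hp, hy p hp, add_zero]
  zero_mem' _ _ := rfl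
  smul_mem' a x hx p hp := by rw [Pi.smul_apply, hx p hp, smul_zero]

variable {X Y}

theorem cobdry_apply (p : ℕ) (x : Ch (X.obj ⦋p⦌)) :
    cobdry X p x = ∑ i : Fin (p + 2), chMap (X.map (SimplexCategory.δ i)) x := by
  rw [cobdry, LinearMap.sum_apply]

theorem chMap_id {Z : SSet.{u}} (x : Ch Z) : chMap (𝟙 Z) x = x := by
  funext q
  change nmap (𝟙 Z) q (x q) = _
  suffices nmap (𝟙 Z) q = LinearMap.id by rw [this]; rfl
  exact N_ext fun z => nmap_cl ..

theorem chMap_X_comp {a b c : SimplexCategory} (f : a ⟶ b) (g : b ⟶ c) (x : Ch (X.obj a)) :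
    chMap (X.map g) (chMap (X.map f) x) = chMap (X.map (f ≫ g)) x := by
  rw [chMap_comp, X.map_comp]

theorem hBdry_hBdry (x : CCh X) : hBdry X (hBdry X x) = 0 := by
  funext p
  obtain _ | _ | p := p
  · rfl
  · exact map_zero (cobdry X 0)
  · change cobdry X (p + 1) (cobdry X p (x p)) = 0
    simp only [cobdry_apply, map_sum, chMap_X_comp]
    exact sum_sum_eq_zero (fun i j => chMap (X.map (SimplexCategory.δ i ≫ SimplexCategory.δ j)) (x p)) fun i j h =>
      congrArg (fun f => chMap (X.map f) (x p)) (SimplexCategory.δ_comp_δ h)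

theorem vBdry_vBdry (x : CCh X) : vBdry X (vBdry X x) = 0 :=
  funext fun p => (S (X.obj ⦋p⦌)).d_d (x p)

theorem vBdry_hBdry (x : CCh X) : vBdry X (hBdry X x) = hBdry X (vBdry X x) := by
  funext p
  obtain _ | p := p
  · exact map_zero (chBdry _)
  · change chBdry _ (cobdry X p (x p)) = cobdry X p (chBdry _ (x p))
    simp only [cobdry_apply, map_sum, chMap_chBdry]

theorem hBdry_conorm {x : CCh X} (hx : x ∈ conorm X) : hBdry X x ∈ conorm X := by
  intro p j
  change chMap (X.map (SimplexCategory.σ j)) (cobdry X p (x p)) = 0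
  rw [cobdry_apply, map_sum]
  simp only [chMap_X_comp]
  have hne : j.castSucc ≠ j.succ := j.castSucc_lt_succ.ne
  have : ∀ i : Fin (p + 2), i ∉ ({j.castSucc, j.succ} : Finset (Fin (p + 2))) →
      chMap (X.map (SimplexCategory.δ i ≫ SimplexCategory.σ j)) (x p) = 0 := by
    intro i hi
    simp only [Finset.mem_insert, Finset.mem_singleton, not_or] at hi
    obtain ⟨h1, h2⟩ := hi
    rw [Fin.ext_iff] at h1 h2
    simp only [Fin.val_castSucc, Fin.val_succ] at h1 h2
    obtain _ | p := p
    · omega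
    rcases Nat.lt_or_ge i j with h3 | h3
    · obtain ⟨i', rfl⟩ : ∃ i' : Fin (p + 2), i = i'.castSucc := ⟨⟨i, by omega⟩, rfl⟩
      obtain ⟨j', rfl⟩ : ∃ j' : Fin (p + 1), j = j'.succ :=
        ⟨⟨j - 1, by omega⟩, Fin.ext (by simp only [Fin.val_succ]; omega)⟩
      rw [SimplexCategory.δ_comp_σ_of_le (by
        rw [Fin.le_def]; simp only [Fin.val_castSucc, Fin.val_succ] at h3 ⊢; omega),
        ← chMap_X_comp, hx, map_zero]
    · obtain ⟨i', rfl⟩ : ∃ i' : Fin (p + 2), i = i'.succ :=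
        ⟨⟨i - 1, by omega⟩, Fin.ext (by simp only [Fin.val_succ]; omega)⟩
      simp only [Fin.val_succ] at h2 h3 h1
      obtain ⟨j', rfl⟩ : ∃ j' : Fin (p + 1), j = j'.castSucc := ⟨⟨j, by omega⟩, rfl⟩
      rw [SimplexCategory.δ_comp_σ_of_gt (by
        rw [Fin.lt_def]; simp only [Fin.val_castSucc] at h2 h3 h1 ⊢; omega),
        ← chMap_X_comp, hx, map_zero]
  rw [← Finset.sum_subset (Finset.subset_univ {j.castSucc, j.succ}) (fun i _ hi => this i hi),
    Finset.sum_pair hne, SimplexCategory.δ_comp_σ_self, SimplexCategory.δ_comp_σ_succ, X.map_id, chMap_id]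
  exact add_self_eq_zero _

theorem vBdry_conorm {x : CCh X} (hx : x ∈ conorm X) : vBdry X x ∈ conorm X := by
  intro p j
  change chMap (X.map (SimplexCategory.σ j)) (chBdry _ (x (p + 1))) = 0
  rw [chMap_chBdry, hx, map_zero]

theorem hBdry_deg {n : ℤ} {x : CCh X} (hx : x ∈ totDeg X n) : hBdry X x ∈ totDeg X (n - 1) := by
  intro p
  obtain _ | p := p
  · exact zero_mem _
  · change cobdry X p (x p) ∈ _
    rw [cobdry_apply]
    refine sum_mem fun i _ => ?_
    rw [show n - 1 + ((p + 1 : ℕ) : ℤ) = n + p by push_cast; ring]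
    exact chMap_deg _ (hx p)

theorem vBdry_deg {n : ℤ} {x : CCh X} (hx : x ∈ totDeg X n) : vBdry X x ∈ totDeg X (n - 1) := by
  intro p
  have := chBdry_deg (hx p)
  rwa [add_sub_right_comm] at this

variable (X Y) in
/-- The filtered complex `T C S_*(X)` of a cosimplicial space `X`. The chains of degree `n` are
the elements of `∏_p C^p S_{n+p}(X)`, where `C^p S_q(X)` is the space of all `x` in `S_q(X^p)` that
are annihilated by the codegeneracies. The differential is the sum of the horizontal differential
(the alternating sum of the cofaces) and the vertical one (the boundary of `S_*`), and
`F^{-s} = ∏_{p ≥ s}`. -/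
noncomputable def T : FCpx.{u} where
  M := CCh X
  grp := inferInstanceAs (AddCommGroup (CCh X))
  mod := inferInstanceAs (Module 𝕂 (CCh X))
  deg n := conorm X ⊓ totDeg X n
  d := hBdry X + vBdry X
  d_deg n x hx :=
    ⟨add_mem (hBdry_conorm hx.1) (vBdry_conorm hx.1), add_mem (hBdry_deg hx.2) (vBdry_deg hx.2)⟩
  d_d x := by
    simp only [LinearMap.add_apply, map_add, hBdry_hBdry, vBdry_vBdry, vBdry_hBdry, zero_add,
      add_zero]
    exact add_self_eq_zero (A := CCh X) _
  fil := colFil X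
  exhaustive x := ⟨0, fun p hp => by omega⟩
  fil_anti s t h x hx p hp := hx p (by omega)
  d_fil s x hx p hp := by
    change hBdry X x p + vBdry X x p = 0
    have h2 : vBdry X x p = 0 := by
      change chBdry _ (x p) = 0
      rw [hx p hp, map_zero]
    have h1 : hBdry X x p = 0 := by
      obtain _ | p := p
      · rfl
      · change cobdry X p (x p) = 0
        rw [hx p (by push_cast at hp; omega), map_zero]
    rw [h1, h2, add_zero]

/-- The filtered chain map induced by a map of cosimplicial spaces. -/
noncomputable def T.map (g : X ⟶ Y) : FCpx.Hom (T X) (T Y) where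
  f := (LinearMap.pi fun p => chMap (g.app ⦋p⦌) ∘ₗ LinearMap.proj p : CCh X →ₗ[𝕂] CCh Y)
  map_deg n x hx := by
    refine ⟨fun p i => ?_, fun p => chMap_deg _ (hx.2 p)⟩
    change chMap (Y.map (SimplexCategory.σ i)) (chMap (g.app ⦋p + 1⦌) (x (p + 1))) = 0
    have e : g.app ⦋p + 1⦌ ≫ Y.map (SimplexCategory.σ i) =
        X.map (SimplexCategory.σ i) ≫ g.app ⦋p⦌ := (g.naturality _).symm
    rw [chMap_comp, e, ← chMap_comp, hx.1, map_zero]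
  comm _ x _ := by
    funext p
    change chMap (g.app ⦋p⦌) (hBdry X x p + chBdry _ (x p)) = _ + chBdry _ (chMap _ (x p))
    rw [map_add, chMap_chBdry]
    congr 1
    obtain _ | p := p
    · exact map_zero _
    · change chMap (g.app ⦋p + 1⦌) (cobdry X p (x p)) = cobdry Y p (chMap (g.app ⦋p⦌) (x p))
      simp only [cobdry_apply, map_sum, chMap_comp]
      exact Finset.sum_congr rfl fun i _ => congrArg (fun f => chMap f (x p)) (g.naturality _)
  map_fil s x hx p hp := by
    change chMap (g.app ⦋p⦌) (x p) = 0
    rw [hx p hp, map_zero]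

/-- The inclusion `[p] → [P]` of the first `p + 1` elements, for `p ≤ P`. For `P = p + q` this is
the composite of cofaces `d^{p+q} ⋯ d^{p+1}`. -/
def front (p P : ℕ) : ⦋p⦌ ⟶ ⦋P⦌ :=
  SimplexCategory.mkHom ⟨fun i => ⟨min (i : ℕ) P, by omega⟩, fun i j h => by
    rw [Fin.le_def] at h ⊢; dsimp only; omega⟩

/-- The inclusion `[q] → [P]` of the last `q + 1` elements, for `q ≤ P`. For `P = p + q` this is
the composite of cofaces `d^{p-1} ⋯ d^0`. -/
def back (q P : ℕ) : ⦋q⦌ ⟶ ⦋P⦌ :=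
  SimplexCategory.mkHom ⟨fun i => ⟨P - (q - i), by omega⟩, fun i j h => by
    rw [Fin.le_def] at h ⊢; dsimp only; omega⟩

/-- The coface maps, indexed by natural numbers. -/
def dN (p i : ℕ) : ⦋p⦌ ⟶ ⦋p + 1⦌ :=
  SimplexCategory.mkHom ⟨fun j => ⟨if (j : ℕ) < i then j else j + 1, by split_ifs <;> omega⟩,
    fun j k h => by
      rw [Fin.le_def] at h ⊢; dsimp only; split_ifs <;> omega⟩

theorem hom_ext' {m n : ℕ} {f g : ⦋m⦌ ⟶ ⦋n⦌}
    (h : ∀ i : Fin (m + 1), ((f.toOrderHom i : Fin (n + 1)) : ℕ) = (g.toOrderHom i : Fin (n + 1))) :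
    f = g :=
  SimplexCategory.Hom.ext _ _ (OrderHom.ext _ _ (funext fun i => Fin.ext (h i)))

theorem comp_val {l m n : ℕ} (f : ⦋l⦌ ⟶ ⦋m⦌) (g : ⦋m⦌ ⟶ ⦋n⦌) (i : Fin (l + 1)) :
    ((f ≫ g).toOrderHom i : Fin (n + 1)) = g.toOrderHom (f.toOrderHom i) := rfl

theorem front_val (p P : ℕ) (i : Fin (p + 1)) :
    (((front p P).toOrderHom i : Fin (P + 1)) : ℕ) = min (i : ℕ) P := rfl

theorem back_val (p P : ℕ) (i : Fin (p + 1)) :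
    (((back p P).toOrderHom i : Fin (P + 1)) : ℕ) = P - (p - i) := rfl

theorem dN_val (p k : ℕ) (i : Fin (p + 1)) :
    (((dN p k).toOrderHom i : Fin (p + 2)) : ℕ) = if (i : ℕ) < k then (i : ℕ) else i + 1 := rfl

theorem σ_val (p : ℕ) (k i) :
    (((SimplexCategory.σ (n := p) k).toOrderHom i : Fin (p + 1)) : ℕ) =
      if (i : ℕ) ≤ k then (i : ℕ) else i - 1 := by
  change ((Fin.predAbove k i : Fin (p + 1)) : ℕ) = _
  rw [Fin.predAbove]
  split_ifs with h1 h2 h2 <;> rw [Fin.lt_def] at h1 <;> simp at h1 ⊢ <;> omega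

theorem δ_eq (p : ℕ) (i : Fin (p + 2)) : SimplexCategory.δ i = dN p i := by
  refine hom_ext' fun j => ?_
  rw [dN_val]
  change ((i.succAbove j : Fin (p + 2)) : ℕ) = _
  rw [Fin.succAbove]
  split_ifs with h1 h2 h2 <;> rw [Fin.lt_def] at h1 <;> simp at h1 ⊢ <;> omega

variable (X Y) in
/-- The shuffle map in cosimplicial degree `P`. -/
noncomputable def cShuffle (P : SimplexCategory) :
    Ch (X.obj P) →ₗ[𝕂] Ch (Y.obj P) →ₗ[𝕂] Ch ((X ⊗ Y).obj P) :=
  chShuffle (X.obj P) (Y.obj P)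

variable (X Y) in
/-- The composite of the Alexander-Whitney map `CS_*(X) ⊗ CS_*(Y) → C(S_*(X) ⊗ S_*(Y))` and of the
shuffle map `C(S_*(X) ⊗ S_*(Y)) → C S_*(X × Y)`, on product total complexes. -/
noncomputable def tShuffle : CCh X →ₗ[𝕂] CCh Y →ₗ[𝕂] CCh (X ⊗ Y) :=
  LinearMap.mk₂ 𝕂
    (fun x y P => ∑ a ∈ Finset.HasAntidiagonal.antidiagonal P,
      cShuffle X Y ⦋P⦌ (chMap (X.map (front a.1 P)) (x a.1))
        (chMap (Y.map (back a.2 P)) (y a.2)))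
    (fun _ _ _ => by
      funext n
      simp only [Pi.add_apply, map_add, LinearMap.add_apply, Finset.sum_add_distrib])
    (fun _ _ _ => by
      funext n
      simp only [Pi.smul_apply, map_smul, LinearMap.smul_apply, ← Finset.smul_sum])
    (fun _ _ _ => by
      funext n
      simp only [Pi.add_apply, map_add, Finset.sum_add_distrib])
    (fun _ _ _ => by
      funext n
      simp only [Pi.smul_apply, map_smul, ← Finset.smul_sum])

theorem tShuffle_apply (x : CCh X) (y : CCh Y) (P : ℕ) : tShuffle X Y x y P =
    ∑ a ∈ Finset.HasAntidiagonal.antidiagonal P,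
      cShuffle X Y ⦋P⦌ (chMap (X.map (front a.1 P)) (x a.1))
        (chMap (Y.map (back a.2 P)) (y a.2)) := rfl

theorem chMap_tensor {a b : SimplexCategory} (f : a ⟶ b) (x : Ch (X.obj a)) (y : Ch (Y.obj a)) :
    chMap ((X ⊗ Y).map f) (cShuffle X Y a x y) =
      cShuffle X Y b (chMap (X.map f) x) (chMap (Y.map f) y) :=
  chMap_chShuffle (X.map f) (Y.map f) x y

theorem chBdry_cShuffle (a : SimplexCategory) (x : Ch (X.obj a)) (y : Ch (Y.obj a)) :
    chBdry ((X ⊗ Y).obj a) (cShuffle X Y a x y) =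
      cShuffle X Y a (chBdry _ x) y + cShuffle X Y a x (chBdry _ y) :=
  chBdry_chShuffle x y

theorem vBdry_tShuffle (x : CCh X) (y : CCh Y) : vBdry (X ⊗ Y) (tShuffle X Y x y) =
    tShuffle X Y (vBdry X x) y + tShuffle X Y x (vBdry Y y) := by
  funext P
  change chBdry ((X ⊗ Y).obj ⦋P⦌) (tShuffle X Y x y P) =
    tShuffle X Y (vBdry X x) y P + tShuffle X Y x (vBdry Y y) P
  rw [tShuffle_apply, tShuffle_apply, tShuffle_apply, map_sum, ← Finset.sum_add_distrib]
  refine Finset.sum_congr rfl fun a _ => ?_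
  rw [chBdry_cShuffle, ← chMap_chBdry, ← chMap_chBdry]
  rfl

theorem cobdry_apply' (p : ℕ) (x : Ch (X.obj ⦋p⦌)) :
    cobdry X p x = ∑ i ∈ Finset.range (p + 2), chMap (X.map (dN p i)) x := by
  rw [cobdry_apply, ← Fin.sum_univ_eq_sum_range (fun i => chMap (X.map (dN p i)) x)]
  refine Finset.sum_congr rfl fun i _ => ?_
  rw [← δ_eq]

theorem hBdry_tShuffle_aux {p p' P : ℕ} (h : p + p' = P) (x : Ch (X.obj ⦋p⦌))
    (y : Ch (Y.obj ⦋p'⦌)) :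
    cobdry (X ⊗ Y) P (cShuffle X Y ⦋P⦌ (chMap (X.map (front p P)) x)
        (chMap (Y.map (back p' P)) y)) =
      cShuffle X Y ⦋P + 1⦌ (chMap (X.map (front (p + 1) (P + 1)))
        (cobdry X p x)) (chMap (Y.map (back p' (P + 1))) y) +
      cShuffle X Y ⦋P + 1⦌ (chMap (X.map (front p (P + 1))) x)
        (chMap (Y.map (back (p' + 1) (P + 1))) (cobdry Y p' y)) := by
  rw [cobdry_apply', cobdry_apply', cobdry_apply']
  simp only [map_sum, LinearMap.sum_apply, chMap_tensor, chMap_X_comp]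
  rw [show P + 2 = (p + 1) + (p' + 1) by omega, Finset.sum_range_add, Finset.sum_range_succ _ (p + 1),
    Finset.sum_range_succ' _ (p' + 1)]
  have e1 : dN p (p + 1) ≫ front (p + 1) (P + 1) = front p (P + 1) := hom_ext' fun i => by
    rw [comp_val, front_val, dN_val, front_val]; split_ifs <;> omega
  have e2 : dN p' 0 ≫ back (p' + 1) (P + 1) = back p' (P + 1) := hom_ext' fun i => by
    rw [comp_val, back_val, dN_val, back_val]; split_ifs <;> omega
  rw [e1, e2]
  have e3 : ∀ i ∈ Finset.range (p + 1), front p P ≫ dN P i = dN p i ≫ front (p + 1) (P + 1) ∧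
      back p' P ≫ dN P i = back p' (P + 1) := fun i hi => by
    rw [Finset.mem_range] at hi
    refine ⟨hom_ext' fun j => ?_, hom_ext' fun j => ?_⟩
    · rw [comp_val, comp_val, front_val, dN_val, dN_val, front_val]; split_ifs <;> omega
    · rw [comp_val, back_val, dN_val, back_val]; split_ifs <;> omega
  have e4 : ∀ i ∈ Finset.range (p' + 1), front p P ≫ dN P (p + 1 + i) = front p (P + 1) ∧
      back p' P ≫ dN P (p + 1 + i) = dN p' (i + 1) ≫ back (p' + 1) (P + 1) := fun i hi => by
    rw [Finset.mem_range] at hi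
    refine ⟨hom_ext' fun j => ?_, hom_ext' fun j => ?_⟩
    · rw [comp_val, front_val, dN_val, front_val]; split_ifs <;> omega
    · rw [comp_val, comp_val, back_val, dN_val, dN_val, back_val]; split_ifs <;> omega
  rw [Finset.sum_congr rfl fun i hi => by rw [(e3 i hi).1, (e3 i hi).2],
    Finset.sum_congr (s₁ := Finset.range (p' + 1)) rfl fun i hi => by
      rw [(e4 i hi).1, (e4 i hi).2]]
  have : ∀ a b c : Ch (X.obj ⦋P + 1⦌ ⊗ Y.obj ⦋P + 1⦌), a + b = a + c + (b + c) := fun a b c => by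
    rw [add_add_add_comm, add_self_eq_zero c, add_zero]
  exact this _ _ _

theorem hBdry_tShuffle (x : CCh X) (y : CCh Y) : hBdry (X ⊗ Y) (tShuffle X Y x y) =
    tShuffle X Y (hBdry X x) y + tShuffle X Y x (hBdry Y y) := by
  funext P
  change _ = tShuffle X Y (hBdry X x) y P + tShuffle X Y x (hBdry Y y) P
  have h0 : hBdry X x 0 = 0 := rfl
  have h0' : hBdry Y y 0 = 0 := rfl
  obtain _ | P := P
  · have e : hBdry (X ⊗ Y) (tShuffle X Y x y) 0 = 0 := rfl
    rw [tShuffle_apply, tShuffle_apply, Finset.HasAntidiagonal.antidiagonal_zero, Finset.sum_singleton,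
      Finset.sum_singleton, h0, h0', e, map_zero, map_zero, map_zero, map_zero,
      LinearMap.zero_apply, add_zero]
  · change cobdry (X ⊗ Y) P (tShuffle X Y x y P) = _
    rw [tShuffle_apply, tShuffle_apply, tShuffle_apply, Finset.Nat.sum_antidiagonal_succ,
      Finset.Nat.sum_antidiagonal_succ', h0, h0', map_zero, map_zero, map_zero, map_zero,
      LinearMap.zero_apply, zero_add, zero_add, ← Finset.sum_add_distrib, map_sum]
    refine Finset.sum_congr rfl fun a ha => ?_
    rw [Finset.HasAntidiagonal.mem_antidiagonal] at ha
    exact hBdry_tShuffle_aux ha _ _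

theorem tShuffle_conorm {x : CCh X} {y : CCh Y} (hx : x ∈ conorm X) (hy : y ∈ conorm Y) :
    tShuffle X Y x y ∈ conorm (X ⊗ Y) := by
  intro P j
  rw [tShuffle_apply, map_sum]
  refine Finset.sum_eq_zero fun ⟨p, q⟩ ha => ?_
  rw [Finset.HasAntidiagonal.mem_antidiagonal] at ha
  dsimp only at ha ⊢
  rw [chMap_tensor, chMap_X_comp, chMap_X_comp]
  by_cases h : (j : ℕ) < p
  · obtain _ | p := p
    · omega
    have e : front (p + 1) (P + 1) ≫ SimplexCategory.σ j =
        SimplexCategory.σ ⟨j, h⟩ ≫ front p P := hom_ext' fun i => by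
      rw [comp_val, comp_val, σ_val, front_val, front_val, σ_val]; dsimp only
      split_ifs <;> omega
    rw [e, ← chMap_X_comp, hx, map_zero, map_zero, LinearMap.zero_apply]
  · obtain _ | q := q
    · have := j.2; omega
    have e : back (q + 1) (P + 1) ≫ SimplexCategory.σ j =
        SimplexCategory.σ ⟨j - p, by have := j.2; omega⟩ ≫ back q P := hom_ext' fun i => by
      rw [comp_val, comp_val, σ_val, back_val, back_val, σ_val]; dsimp only
      have := j.2
      split_ifs <;> omega
    rw [e, ← chMap_X_comp (X := Y), hy, map_zero, map_zero]

theorem tShuffle_leibniz (x : CCh X) (y : CCh Y) :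
    (hBdry (X ⊗ Y) + vBdry (X ⊗ Y)) (tShuffle X Y x y) =
      tShuffle X Y ((hBdry X + vBdry X) x) y + tShuffle X Y x ((hBdry Y + vBdry Y) y) := by
  rw [LinearMap.add_apply, LinearMap.add_apply, LinearMap.add_apply, hBdry_tShuffle,
    vBdry_tShuffle, map_add, map_add, LinearMap.add_apply, add_add_add_comm]

theorem tShuffle_fil {s t : ℤ} {x : CCh X} {y : CCh Y} (hx : x ∈ colFil X s) (hy : y ∈ colFil Y t) :
    tShuffle X Y x y ∈ colFil (X ⊗ Y) (s + t) := by
  intro P hP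
  rw [tShuffle_apply]
  refine Finset.sum_eq_zero fun a ha => ?_
  rw [Finset.HasAntidiagonal.mem_antidiagonal] at ha
  by_cases h : (a.1 : ℤ) < s
  · rw [hx a.1 h, map_zero, map_zero, LinearMap.zero_apply]
  · rw [hy a.2 (by omega), map_zero, map_zero]

theorem tShuffle_deg {m n : ℤ} {x : CCh X} {y : CCh Y} (hx : x ∈ totDeg X m)
    (hy : y ∈ totDeg Y n) : tShuffle X Y x y ∈ totDeg (X ⊗ Y) (m + n) := by
  intro P
  rw [tShuffle_apply]
  refine sum_mem fun a ha => ?_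
  rw [Finset.HasAntidiagonal.mem_antidiagonal] at ha
  have := chShuffle_deg (chMap_deg (X.map (front a.1 P)) (hx a.1))
    (chMap_deg (Y.map (back a.2 P)) (hy a.2))
  rw [show m + a.1 + (n + a.2) = m + n + (P : ℤ) by rw [← ha]; push_cast; ring] at this
  exact this

variable (X Y) in
/-- The external product on the filtered complexes of cosimplicial spaces. -/
noncomputable def T.shuffle : FCpx.Pairing (T X) (T Y) (T (X ⊗ Y)) where
  f := tShuffle X Y
  map_deg _ _ _ hx _ hy := ⟨tShuffle_conorm hx.1 hy.1, tShuffle_deg hx.2 hy.2⟩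
  leibniz := tShuffle_leibniz
  map_fil _ _ _ hx _ hy := tShuffle_fil hx hy

end Cosimplicial

section Totalization

/-- The functor that sends `[q]` to the cosimplicial space `Δ^• × Δ^q`. -/
def cyl : SimplexCategory ⥤ CosSp.{u} :=
  SSet.stdSimplex.{u} ⋙ tensoringRight SSet.{u} ⋙
    (Functor.whiskeringLeft SimplexCategory SSet.{u} SSet.{u}).obj SSet.stdSimplex

/-- The totalization of a cosimplicial space `X`: its `q`-simplices are the cosimplicial maps
`Δ^• × Δ^q → X`. -/
def Tot (X : CosSp.{u}) : SSet.{u} := cyl.op ⋙ yoneda.obj X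

variable {X Y : CosSp.{u}}

/-- The map of totalizations induced by a map of cosimplicial spaces. -/
def Tot.map (g : X ⟶ Y) : Tot X ⟶ Tot Y := Functor.whiskerLeft cyl.op (yoneda.map g)

/-- The map of cosimplicial spaces into a product with given components. -/
def pairing {W : CosSp.{u}} (f : W ⟶ X) (g : W ⟶ Y) : W ⟶ X ⊗ Y :=
  CartesianMonoidalCategory.lift f g

theorem comp_pairing {V W : CosSp.{u}} (h : V ⟶ W) (f : W ⟶ X) (g : W ⟶ Y) :
    h ≫ pairing f g = pairing (h ≫ f) (h ≫ g) :=
  CartesianMonoidalCategory.comp_lift h f g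

variable (X Y) in
/-- The canonical map `Tot X × Tot Y → Tot (X × Y)`, which sends a pair of maps
`f : Δ^• × Δ^q → X` and `g : Δ^• × Δ^q → Y` to `(f, g) : Δ^• × Δ^q → X × Y`. -/
def totProd : Tot X ⊗ Tot Y ⟶ Tot (X ⊗ Y) where
  app _ := ↾ fun a => pairing (X := X) (Y := Y) a.1 a.2
  naturality q _ θ := by
    ext a
    exact (comp_pairing (cyl.map θ.unop) (a.1 : cyl.obj q.unop ⟶ X)
      (a.2 : cyl.obj q.unop ⟶ Y)).symm

/-- The homology `H_n(Tot X)` of the totalization. -/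
abbrev HTot (X : CosSp.{u}) (n : ℤ) : Type u := (S (Tot X)).H n

variable (X Y) in
/-- The external product `H_m(Tot X) ⊗ H_n(Tot Y) → H_{m+n}(Tot (X × Y))`, the composite of
the shuffle product and of the map induced by `Tot X × Tot Y → Tot (X × Y)`. -/
noncomputable def cross (m n : ℤ) : HTot X m →ₗ[𝕂] HTot Y n →ₗ[𝕂] HTot (X ⊗ Y) (m + n) :=
  ((S.shuffle (Tot X) (Tot Y)).H m n).compr₂ ((S.map (totProd X Y)).H (m + n))

/-- The class of the top dimensional simplex of `Δ^k`. -/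
noncomputable def top (k : ℕ) : N (Δ[k] : SSet.{u}) k :=
  cl (SSet.stdSimplex.objEquiv.symm (𝟙 ⦋k⦌))

/-- The shuffle product in `S_m(Δ^k × Δ^q)`, where `m = k + q`, of the top dimensional simplices
of `Δ^k` and `Δ^q`. -/
noncomputable def wedge (k q m : ℕ) : N ((cyl.{u}.obj ⦋q⦌).obj ⦋k⦌) m :=
  shuffle Δ[k] Δ[q] k q m (top k) (top q)

theorem wedge_eq_zero {k q m : ℕ} (h : k + q ≠ m) : wedge.{u} k q m = 0 := shuffle_eq_zero h _ _

theorem nmap_top {k k' : ℕ} (θ : ⦋k⦌ ⟶ ⦋k'⦌) :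
    nmap (SSet.stdSimplex.{u}.map θ) k (top k) = cl (SSet.stdSimplex.objEquiv.symm θ) := by
  rw [top, nmap_cl]
  refine congrArg cl ?_
  apply SSet.stdSimplex.objEquiv.injective
  change 𝟙 _ ≫ θ = θ
  rw [Category.id_comp]

theorem nmap_top_eq_zero {k k' : ℕ} (θ : ⦋k⦌ ⟶ ⦋k'⦌) (h : k' < k) :
    nmap (SSet.stdSimplex.{u}.map θ) k (top k) = 0 := by
  rw [nmap_top]
  apply cl_degenerate
  rw [SSet.degenerate_eq_univ_of_hasDimensionLT _ (k' + 1) k (by omega)]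
  trivial

theorem bdry_top (k : ℕ) : bdry (Δ[k + 1] : SSet.{u}) k (top (k + 1)) =
    ∑ i : Fin (k + 2), nmap (SSet.stdSimplex.{u}.map (SimplexCategory.δ i)) k (top k) := by
  rw [top, bdry_cl]
  refine Finset.sum_congr rfl fun i _ => ?_
  rw [nmap_top]
  refine congrArg cl ?_
  apply SSet.stdSimplex.objEquiv.injective
  change SimplexCategory.δ i ≫ 𝟙 _ = SimplexCategory.δ i
  rw [Category.comp_id]

theorem nmap_id {Z : SSet.{u}} {q : ℕ} (x : N Z q) : nmap (𝟙 Z) q x = x := by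
  suffices nmap (𝟙 Z) q = LinearMap.id by rw [this]; rfl
  exact N_ext fun z => nmap_cl ..

theorem nmap_left {k k' q m : ℕ} (θ : ⦋k⦌ ⟶ ⦋k'⦌) :
    nmap ((cyl.{u}.obj ⦋q⦌).map θ) m (wedge k q m) =
      shuffle Δ[k'] Δ[q] k q m (nmap (SSet.stdSimplex.map θ) k (top k)) (top q) := by
  have := nmap_shuffle (SSet.stdSimplex.{u}.map θ) (𝟙 Δ[q]) (n := m) (top k) (top q)
  rw [nmap_id] at this
  exact this

theorem nmap_right {k q q' m : ℕ} (θ : ⦋q⦌ ⟶ ⦋q'⦌) :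
    nmap ((cyl.{u}.map θ).app ⦋k⦌) m (wedge k q m) =
      shuffle Δ[k] Δ[q'] k q m (top k) (nmap (SSet.stdSimplex.map θ) q (top q)) := by
  have := nmap_shuffle (𝟙 Δ[k]) (SSet.stdSimplex.{u}.map θ) (n := m) (top k) (top q)
  rw [nmap_id] at this
  exact this

/-- A simplex of `Tot X`, as a map of cosimplicial spaces. -/
def toHom {q : ℕ} (f : (Tot X) _⦋q⦌) : cyl.obj ⦋q⦌ ⟶ X := f

theorem toHom_map {q q' : ℕ} (θ : ⦋q⦌ ⟶ ⦋q'⦌) (f : (Tot X) _⦋q'⦌) :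
    toHom ((Tot X).map θ.op f) = cyl.map θ ≫ toHom f := rfl

theorem nmap_toHom_map {k q q' m : ℕ} (θ : ⦋q⦌ ⟶ ⦋q'⦌) (f : (Tot X) _⦋q'⦌) :
    nmap ((toHom ((Tot X).map θ.op f)).app ⦋k⦌) m (wedge k q m) =
      nmap ((toHom f).app ⦋k⦌) m (shuffle Δ[k] Δ[q'] k q m (top k)
        (nmap (SSet.stdSimplex.map θ) q (top q))) := by
  rw [← nmap_right, toHom_map, NatTrans.comp_app, nmap_comp]

theorem nmap_naturality {k k' q m : ℕ} (θ : ⦋k⦌ ⟶ ⦋k'⦌) (f : (Tot X) _⦋q⦌) :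
    nmap (X.map θ) m (nmap ((toHom f).app ⦋k⦌) m (wedge k q m)) =
      nmap ((toHom f).app ⦋k'⦌) m (shuffle Δ[k'] Δ[q] k q m
        (nmap (SSet.stdSimplex.map θ) k (top k)) (top q)) := by
  rw [← nmap_left, nmap_comp, nmap_comp, (toHom f).naturality]

variable (X) in
/-- The map `S_q(Tot X) → S_m(X^k)`, where `m = k + q`, that sends `f : Δ^• × Δ^q → X` to the image
under `f^k : Δ^k × Δ^q → X^k` of the product of the top dimensional simplices. -/
noncomputable def phi (k q m : ℕ) : N (Tot X) q →ₗ[𝕂] N (X.obj ⦋k⦌) m :=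
  lift (fun f => nmap ((toHom f).app ⦋k⦌) m (wedge k q m)) (by
    rintro _ ⟨q', hq, θ, f, rfl⟩
    rw [nmap_toHom_map, nmap_top_eq_zero θ hq, map_zero]
    exact map_zero _)

theorem phi_cl {k q m : ℕ} (f : (Tot X) _⦋q⦌) :
    phi X k q m (cl f) = nmap ((toHom f).app ⦋k⦌) m (wedge k q m) := lift_cl ..

theorem phi_eq_zero {k q m : ℕ} (h : k + q ≠ m) (x : N (Tot X) q) : phi X k q m x = 0 := by
  suffices phi X k q m = 0 by rw [this]; rfl
  refine N_ext fun f => ?_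
  rw [phi_cl, wedge_eq_zero h, map_zero]; rfl

theorem nmap_phi_eq_zero {k k' q m : ℕ} (θ : ⦋k⦌ ⟶ ⦋k'⦌) (h : k' < k) (x : N (Tot X) q) :
    nmap (X.map θ) m (phi X k q m x) = 0 := by
  suffices nmap (X.map θ) m ∘ₗ phi X k q m = 0 from LinearMap.congr_fun this x
  refine N_ext fun f => ?_
  rw [LinearMap.comp_apply, phi_cl, nmap_naturality, nmap_top_eq_zero θ h, map_zero,
    LinearMap.zero_apply]
  exact map_zero _

variable (X) in
/-- The horizontal part of the boundary. -/
noncomputable def phiL : ∀ k q m : ℕ, N (Tot X) q →ₗ[𝕂] N (X.obj ⦋k⦌) m := fun k q m =>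
  match k with
  | 0 => 0
  | k + 1 => ∑ i : Fin (k + 2), nmap (X.map (SimplexCategory.δ i)) m ∘ₗ phi X k q m

variable (X) in
/-- The vertical part of the boundary. -/
noncomputable def phiR : ∀ k q m : ℕ, N (Tot X) q →ₗ[𝕂] N (X.obj ⦋k⦌) m := fun k q m =>
  match q with
  | 0 => 0
  | q + 1 => phi X k q m ∘ₗ bdry (Tot X) q

theorem nmap_bdryL (k q m : ℕ) (f : (Tot X) _⦋q⦌) : nmap ((toHom f).app ⦋k⦌) m
    (bdryL Δ[k] Δ[q] k q m (top k) (top q)) = phiL X k q m (cl f) := by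
  obtain _ | k := k
  · exact map_zero _
  · change nmap ((toHom f).app ⦋k + 1⦌) m
      (shuffle Δ[k + 1] Δ[q] k q m (bdry Δ[k + 1] k (top (k + 1))) (top q)) =
      (∑ i : Fin (k + 2), nmap (X.map (SimplexCategory.δ i)) m ∘ₗ phi X k q m) (cl f)
    rw [LinearMap.sum_apply, bdry_top, map_sum, LinearMap.sum_apply]
    refine (map_sum _ _ _).trans ?_
    refine Finset.sum_congr rfl fun i _ => ?_
    rw [LinearMap.comp_apply, phi_cl, nmap_naturality]

theorem nmap_bdryR (k q m : ℕ) (f : (Tot X) _⦋q⦌) : nmap ((toHom f).app ⦋k⦌) m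
    (bdryR Δ[k] Δ[q] k q m (top k) (top q)) = phiR X k q m (cl f) := by
  obtain _ | q := q
  · exact map_zero _
  · change nmap ((toHom f).app ⦋k⦌) m
      (shuffle Δ[k] Δ[q + 1] k q m (top k) (bdry Δ[q + 1] q (top (q + 1)))) =
      phi X k q m (bdry (Tot X) q (cl f))
    rw [bdry_cl, map_sum, bdry_top, map_sum]
    refine (map_sum _ _ _).trans ?_
    refine Finset.sum_congr rfl fun i _ => ?_
    rw [phi_cl, ← nmap_toHom_map]
    rfl

theorem bdry_phi (k q m : ℕ) (x : N (Tot X) q) :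
    bdry (X.obj ⦋k⦌) m (phi X k q (m + 1) x) = phiL X k q m x + phiR X k q m x := by
  suffices bdry (X.obj ⦋k⦌) m ∘ₗ phi X k q (m + 1) = phiL X k q m + phiR X k q m from
    LinearMap.congr_fun this x
  refine N_ext fun f => ?_
  rw [LinearMap.comp_apply, phi_cl, ← nmap_bdry, LinearMap.add_apply, ← nmap_bdryL, ← nmap_bdryR]
  exact (congrArg _ (bdry_shuffle k q m (top k) (top q))).trans (map_add _ _ _)

variable (X) in
/-- The map `S_*(Tot X) → ∏_k S_*(X^k)` that sends `f : Δ^• × Δ^q → X` to the family of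
the `f_*(ι_k ∧ ι_q)`, for `k ≥ 0`. -/
noncomputable def phiCh : Ch (Tot X) →ₗ[𝕂] CCh X :=
  LinearMap.pi fun k => LinearMap.pi fun m =>
    ∑ q ∈ Finset.range (m + 1), phi X k q m ∘ₗ LinearMap.proj q

theorem phiCh_apply (x : Ch (Tot X)) (k m : ℕ) :
    phiCh X x k m = ∑ q ∈ Finset.range (m + 1), phi X k q m (x q) := by
  change (∑ q ∈ Finset.range (m + 1), phi X k q m ∘ₗ LinearMap.proj q :
    Ch (Tot X) →ₗ[𝕂] N (X.obj ⦋k⦌) m) x = _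
  rw [LinearMap.sum_apply]
  rfl

theorem phiL_sum (x : Ch (Tot X)) (k m : ℕ) :
    ∑ q ∈ Finset.range (m + 2), phiL X k q m (x q) = hBdry X (phiCh X x) k m := by
  obtain _ | k := k
  · exact Finset.sum_eq_zero fun _ _ => rfl
  · have e : ∀ q, phiL X (k + 1) q m (x q) =
        ∑ i : Fin (k + 2), nmap (X.map (SimplexCategory.δ i)) m (phi X k q m (x q)) := fun q => by
      change (∑ i : Fin (k + 2), nmap (X.map (SimplexCategory.δ i)) m ∘ₗ phi X k q m) (x q) = _
      rw [LinearMap.sum_apply]; rfl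
    change _ = cobdry X k (phiCh X x k) m
    rw [cobdry_apply, Finset.sum_apply, Finset.sum_congr rfl fun q _ => e q, Finset.sum_comm]
    refine Finset.sum_congr rfl fun i _ => ?_
    change _ = nmap _ m (phiCh X x k m)
    rw [phiCh_apply, map_sum, Finset.sum_range_succ, phi_eq_zero (by omega), map_zero, add_zero]

theorem phiR_sum (x : Ch (Tot X)) (k m : ℕ) :
    ∑ q ∈ Finset.range (m + 2), phiR X k q m (x q) = phiCh X (chBdry _ x) k m := by
  rw [Finset.sum_range_succ', phiCh_apply]
  exact add_zero _

theorem phiCh_comm (x : Ch (Tot X)) :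
    phiCh X (chBdry _ x) = (hBdry X + vBdry X) (phiCh X x) := by
  funext k m
  change _ = hBdry X (phiCh X x) k m + bdry (X.obj ⦋k⦌) m (phiCh X x k (m + 1))
  rw [phiCh_apply x k (m + 1), map_sum]
  simp only [bdry_phi]
  rw [Finset.sum_add_distrib, phiL_sum, phiR_sum, ← add_assoc, add_self_eq_zero, zero_add]

theorem phiCh_conorm (x : Ch (Tot X)) : phiCh X x ∈ conorm X := by
  intro k i
  funext m
  change nmap _ m (phiCh X x (k + 1) m) = 0
  rw [phiCh_apply, map_sum]
  exact Finset.sum_eq_zero fun q _ => nmap_phi_eq_zero _ (Nat.lt_succ_self k) _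

theorem phiCh_deg {n : ℤ} {x : Ch (Tot X)} (hx : x ∈ chDeg (Tot X) n) :
    phiCh X x ∈ totDeg X n := by
  intro k m hm
  rw [phiCh_apply]
  refine Finset.sum_eq_zero fun q _ => ?_
  by_cases h : (q : ℤ) = n
  · exact phi_eq_zero (by omega) _
  · rw [hx q h, map_zero]

variable (X) in
/-- The chain map `S_*(Tot X) → T C S_*(X)`, `f ↦ ∏_k f_*(ι_k ∧ ι_q)`. -/
noncomputable def φ : Cpx.Hom (S (Tot X)) (T X).toCpx where
  f := phiCh X
  map_deg _ x hx := ⟨phiCh_conorm x, phiCh_deg hx⟩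
  comm _ x _ := phiCh_comm x

variable (X) in
/-- The filtration `F^{-s} H_n(Tot X)`, the kernel of the composite
`H_n(Tot X) → H_n(TCS_*(X)) → H_n(TCS_*(X) / F^{-s})`. -/
noncomputable def filTot (n s : ℤ) : Submodule 𝕂 (HTot X n) :=
  LinearMap.ker (((T X).proj s).H n ∘ₗ (φ X).H n)

variable (X) in
/-- The abutment map `F^{-s} H_n(Tot X) / F^{-s-1} H_n(Tot X) → E^∞_{-s,s+n}(S_*(X))`. -/
noncomputable def ι (s n : ℤ) :
    SubQ (filTot X n s) (filTot X n (s + 1)) →ₗ[𝕂] (T X).Einf s n :=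
  (T X).abut s n ∘ₗ SubQ.map ((φ X).H n) (fun _ hx => hx) (fun _ _ hx => hx)

end Totalization

section HomotopyOrbits

/-- The space `Eπ` for the group `π` with two elements: `(Eπ)_q = π^{q+1}`. -/
def Eπ : SSet.{u} where
  obj q := ULift (Fin (q.unop.len + 1) → Multiplicative (ZMod 2))
  map θ := ↾ fun e => ⟨fun j => e.down (θ.unop.toOrderHom j)⟩

/-- The nontrivial element `σ` of the group `π`. -/
def σ : Multiplicative (ZMod 2) := Multiplicative.ofAdd 1

/-- The action of `σ` on `Eπ × Z × Z`, by `(e, x, y) ↦ (σe, y, x)`. -/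
def twist (Z : SSet.{u}) (q : SimplexCategoryᵒᵖ) (a : Eπ.obj q × Z.obj q × Z.obj q) :
    Eπ.obj q × Z.obj q × Z.obj q :=
  (⟨fun j => σ * a.1.down j⟩, a.2.2, a.2.1)

/-- The space `Eπ ×_π (Z × Z)`: the quotient of `Eπ × Z × Z` by the action of `π`. -/
def hOrb : SSet.{u} ⥤ SSet.{u} where
  obj Z :=
    { obj q := Quot fun a b => b = twist Z q a
      map θ := ↾ Quot.map (fun a => (Eπ.map θ a.1, Z.map θ a.2.1, Z.map θ a.2.2))
        (by rintro a _ rfl; rfl)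
      map_id q := by
        ext a
        induction a using Quot.inductionOn with
        | _ a => exact congrArg (Quot.mk _) (by simp)
      map_comp f g := by
        ext a
        induction a using Quot.inductionOn with
        | _ a => exact congrArg (Quot.mk _) (by simp) }
  map {Z Z'} f :=
    { app q := ↾ Quot.map (fun a => (a.1, f.app q a.2.1, f.app q a.2.2))
        (by rintro a _ rfl; rfl)
      naturality q q' θ := by
        ext a
        induction a using Quot.inductionOn with
        | _ a => exact congrArg (Quot.mk _) (by simp) }
  map_id Z := by
    ext q a
    induction a using Quot.inductionOn with
    | _ a => rfl
  map_comp f g := by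
    ext q a
    induction a using Quot.inductionOn with
    | _ a => rfl

/-- The map `Z × Z → Eπ ×_π (Z × Z)`, `(x, y) ↦ [(1, …, 1), x, y]`. -/
def ξ (Z : SSet.{u}) : Z ⊗ Z ⟶ hOrb.obj Z where
  app _ := ↾ fun a => Quot.mk _ (⟨fun _ => 1⟩, a.1, a.2)

/-- The map of cosimplicial spaces `X × X → Eπ ×_π (X × X)`. -/
def κ (X : CosSp.{u}) : X ⊗ X ⟶ X ⋙ hOrb where
  app p := ξ (X.obj p)

end HomotopyOrbits

end CosimplicialSS

open CosimplicialSS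

/-!
The abutment map `ι` is the composite of the map induced by `φ : S_*(Tot X) → TCS_*(X)` and of the
abutment map of the filtered complex `TCS_*(X)`. The latter is natural for filtered chain maps and
for filtered bilinear chain maps (`FCpx.Hom.abut_grMap`, `FCpx.Pairing.abut_grMap₂`), so that
the theorem reduces to two facts in homology: `φ` is natural in `X` (`φ_map`), which yields the lower
square, and `φ` takes the external product of `H_*(Tot X)` and `H_*(Tot Y)` to that of
`H_*(TCS_*(X))` and `H_*(TCS_*(Y))` (`φ_cross`), which yields the upper one.

For the second fact, evaluation is a map `Δ^k × Tot X → X^k`, and the component of `φ(x)` in `X^k`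
is the image of `ι_k ∧ x`, where `ι_k` is the top dimensional simplex of `Δ^k` (`phiCh_eq`). In
the same way, a family `w` of chains of the spaces `Δ^k × Δ^k` and a chain `z` of `Tot X × Tot Y`
give the family `evCh X Y w z` of the images of `w_k ∧ z` in the `X^k × Y^k`, and this is compatible
with the differentials. Let `z = ∇(x ⊗ y)`. For the family `w` of the diagonals of the `ι_k`,
one obtains `φ(x × y)` (`evCh_diagΔ`). For the external square `w` of the family `(ι_k)`, one obtains
`φ(x) · φ(y)` by the interchange law for shuffles (`chMap_mid_chShuffle`, `evCh_tShuffle`). These two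
families are cycles of degree `0` of `TCS_*(Δ^• × Δ^•)` which agree in cosimplicial degree `0`, and
therefore they are homologous: adding `(0, 0)` as a first vertex contracts the chains
of `Δ^k × Δ^k`, and it commutes with the codegeneracies, hence a chain with the required boundary can
be constructed by induction on the cosimplicial degree (`d_coneFix`).
-/

namespace CosimplicialSS

/-! ### Naturality of the abutment map of a filtered complex -/

namespace FCpx

theorem abut_cycleToGr (C : FCpx.{u}) (s n : ℤ) (x : ↥(C.cycles n ⊓ C.fil s)) :
    C.abut s n (C.cycleToGr s n x) = C.cycleToEinf s n x := by
  have h : ((C.cycleToGr s n).quotKerEquivOfSurjective (C.cycleToGr_surjective s n)).symm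
      (C.cycleToGr s n x) = Submodule.Quotient.mk x := by
    rw [LinearEquiv.symm_apply_eq]; rfl
  change (LinearMap.ker (C.cycleToGr s n)).liftQ _ (C.ker_cycleToGr_le s n)
    (((C.cycleToGr s n).quotKerEquivOfSurjective (C.cycleToGr_surjective s n)).symm
      (C.cycleToGr s n x)) = _
  rw [h]; rfl

theorem Hom.map_filH {C D : FCpx.{u}} (g : Hom C D) {n s : ℤ} {c : C.toCpx.H n}
    (hc : c ∈ C.filH n s) : g.toHom.H n c ∈ D.filH n s := by
  obtain ⟨x, rfl⟩ := Submodule.Quotient.mk_surjective _ c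
  obtain ⟨w, hw, h⟩ := (C.mk_mem_filH_iff s n x).1 hc
  refine (D.mk_mem_filH_iff s n ⟨g.f x.1, _⟩).2 ⟨g.f w, g.map_deg _ _ hw, ?_⟩
  rw [← g.comm _ _ hw, ← map_sub]
  exact g.map_fil _ _ h

/-- The abutment map is natural for filtered chain maps. -/
theorem Hom.abut_grMap {C D : FCpx.{u}} (g : Hom C D) (s n : ℤ)
    (a : SubQ (C.filH n s) (C.filH n (s + 1))) :
    D.abut s n (grMap (F := C.filH n) (F' := D.filH n) (g.toHom.H n)
      (fun _ _ => g.map_filH) s a) = g.Einf s n (C.abut s n a) := by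
  obtain ⟨x, rfl⟩ := C.cycleToGr_surjective s n a
  have hx : g.f x.1 ∈ D.cycles n ⊓ D.fil s :=
    ⟨⟨g.map_deg _ _ x.2.1.1, by
      have h : C.d x.1 = 0 := x.2.1.2
      change D.d (g.f x.1) = 0
      rw [← g.comm _ _ x.2.1.1, h, map_zero]⟩, g.map_fil _ _ x.2.2⟩
  rw [abut_cycleToGr]
  exact D.abut_cycleToGr s n ⟨g.f x.1, hx⟩

theorem Pairing.map_filH {C D E : FCpx.{u}} (g : Pairing C D E) {m n s t : ℤ}
    {a : C.toCpx.H m} {b : D.toCpx.H n} (ha : a ∈ C.filH m s) (hb : b ∈ D.filH n t) :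
    g.toPairing.H m n a b ∈ E.filH (m + n) (s + t) := by
  obtain ⟨x, rfl⟩ := Submodule.Quotient.mk_surjective _ a
  obtain ⟨y, rfl⟩ := Submodule.Quotient.mk_surjective _ b
  obtain ⟨v, hv, hv'⟩ := (C.mk_mem_filH_iff s m x).1 ha
  obtain ⟨w, hw, hw'⟩ := (D.mk_mem_filH_iff t n y).1 hb
  have hx : C.d x.1 = 0 := x.2.2
  have hy : D.d y.1 = 0 := y.2.2
  -- the boundary is chosen such that the difference is `(x - d v) · (y - d w)`
  refine (E.mk_mem_filH_iff (s + t) (m + n) ⟨g.f x.1 y.1, _⟩).2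
    ⟨g.f v y.1 + g.f (x.1 - C.d v) w, ?_, ?_⟩
  · refine add_mem ?_ ?_
    · have := g.map_deg _ _ _ hv _ y.2.1
      rwa [add_right_comm] at this
    · have hd := C.d_deg _ _ hv
      rw [add_sub_cancel_right] at hd
      have := g.map_deg _ _ _ (sub_mem x.2.1 hd) _ hw
      rwa [← add_assoc] at this
  · have := g.map_fil _ _ _ hv' _ hw'
    convert this using 1
    rw [map_add, g.leibniz, g.leibniz, hy, map_sub C.d, hx, C.d_d]
    simp only [map_sub, map_zero, LinearMap.sub_apply, LinearMap.zero_apply, sub_zero]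
    abel

/-- The abutment map is natural for filtered bilinear chain maps. -/
theorem Pairing.abut_grMap₂ {C D E : FCpx.{u}} (g : Pairing C D E) (s t m n : ℤ)
    (a : SubQ (C.filH m s) (C.filH m (s + 1))) (b : SubQ (D.filH n t) (D.filH n (t + 1))) :
    E.abut (s + t) (m + n) (grMap₂ (F := C.filH m) (F' := D.filH n) (F'' := E.filH (m + n))
      (g.toPairing.H m n) (fun _ _ _ ha _ hb => g.map_filH ha hb) s t a b) =
      g.Einf s t m n (C.abut s m a) (D.abut t n b) := by
  obtain ⟨x, rfl⟩ := C.cycleToGr_surjective s m a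
  obtain ⟨y, rfl⟩ := D.cycleToGr_surjective t n b
  have hx : C.d x.1 = 0 := x.2.1.2
  have hy : D.d y.1 = 0 := y.2.1.2
  have hxy : g.f x.1 y.1 ∈ E.cycles (m + n) ⊓ E.fil (s + t) :=
    ⟨⟨g.map_deg _ _ _ x.2.1.1 _ y.2.1.1, by
      change E.d (g.f x.1 y.1) = 0
      rw [g.leibniz, hx, hy]; simp⟩, g.map_fil _ _ _ x.2.2 _ y.2.2⟩
  rw [abut_cycleToGr, abut_cycleToGr]
  exact E.abut_cycleToGr (s + t) (m + n) ⟨g.f x.1 y.1, hxy⟩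

end FCpx

/-! ### The interchange law for the shuffle map -/

namespace Shuffle

variable {p q n : ℕ}

/-- The first coordinate of a shuffle attains all values: it increases by steps of size one. -/
theorem exists_fst_eq (c : Shuffle p q n) (i : Fin (p + 1)) : ∃ j, (c.1 j).1 = i := by
  have hpq := c.2.1
  have hex : ∃ m : ℕ, ∃ h : m < n + 1, (i : ℕ) ≤ (c.1 ⟨m, h⟩).1 := by
    refine ⟨n, n.lt_succ_self, ?_⟩
    have h1 := c.rank ⟨n, n.lt_succ_self⟩
    dsimp only at h1
    omega
  obtain ⟨hj, hij⟩ := Nat.find_spec hex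
  refine ⟨⟨Nat.find hex, hj⟩, Fin.ext (le_antisymm ?_ hij)⟩
  have r1 := c.rank ⟨Nat.find hex, hj⟩
  dsimp only at r1
  rcases Nat.eq_zero_or_pos (Nat.find hex) with h0 | h0
  · omega
  · have h1 := Nat.find_min hex (m := Nat.find hex - 1) (by omega)
    have hlt : Nat.find hex - 1 < n + 1 := by omega
    have h2 : ¬ (i : ℕ) ≤ (c.1 ⟨Nat.find hex - 1, hlt⟩).1 := fun h => h1 ⟨hlt, h⟩
    have r2 := c.rank ⟨Nat.find hex - 1, hlt⟩
    have h3 := c.snd_mono (show (⟨Nat.find hex - 1, hlt⟩ : Fin (n + 1)) ≤ ⟨Nat.find hex, hj⟩ from by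
      rw [Fin.le_def]; exact Nat.sub_le _ _)
    dsimp only at r2
    omega

theorem exists_snd_eq (c : Shuffle p q n) (i : Fin (q + 1)) : ∃ j, (c.1 j).2 = i :=
  c.swap.exists_fst_eq i

end Shuffle

/-- The maximal chains in `([p] × [q]) × ([r] × [s])`, where `p + q + r + s = n`. -/
abbrev Shuffle₄ (p q r s n : ℕ) : Type :=
  {c : Fin (n + 1) → (Fin (p + 1) × Fin (q + 1)) × (Fin (r + 1) × Fin (s + 1)) //
    p + q + (r + s) = n ∧ StrictMono c}

namespace Shuffle₄

variable {p q r s m l n : ℕ}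

noncomputable instance : Fintype (Shuffle₄ p q r s n) := Fintype.ofFinite _

theorem rank (c : Shuffle₄ p q r s n) (j : Fin (n + 1)) :
    ((c.1 j).1.1 : ℕ) + (c.1 j).1.2 + ((c.1 j).2.1 + (c.1 j).2.2) = j := by
  have hs : StrictMono fun j : Fin (n + 1) =>
      (⟨((c.1 j).1.1 : ℕ) + (c.1 j).1.2 + ((c.1 j).2.1 + (c.1 j).2.2), by
        have := c.2.1; omega⟩ : Fin (n + 1)) := by
    intro a b h
    have h' := c.2.2 h
    simp only [Prod.lt_iff, Prod.le_def, Fin.lt_def, Fin.le_def] at h'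
    simp only [Fin.mk_lt_mk]
    omega
  have := OrderHom.eq_id_of_injective ⟨_, hs.monotone⟩ hs.injective
  exact congrArg Fin.val (DFunLike.congr_fun this j)

/-- Exchange of the two middle coordinates. -/
def mid (c : Shuffle₄ p q r s n) : Shuffle₄ p r q s n :=
  ⟨fun j => (((c.1 j).1.1, (c.1 j).2.1), ((c.1 j).1.2, (c.1 j).2.2)), by
    have := c.2.1; omega, fun a b h => by
    have := c.2.2 h
    simp only [Prod.lt_iff, Prod.le_def, Fin.lt_def, Fin.le_def] at this ⊢
    omega⟩

/-- A shuffle of shuffles is a maximal chain in the fourfold product. -/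
def ofShuffles (x : Shuffle m l n × Shuffle p q m × Shuffle r s l) : Shuffle₄ p q r s n :=
  ⟨fun j => (x.2.1.1 (x.1.1 j).1, x.2.2.1 (x.1.1 j).2), by
    have := x.1.2.1; have := x.2.1.2.1; have := x.2.2.2.1; omega, fun a b h => by
    have := x.1.2.2 h
    rw [Prod.lt_iff] at this ⊢
    exact this.imp (fun h => ⟨x.2.1.2.2 h.1, x.2.2.2.2.monotone h.2⟩)
      (fun h => ⟨x.2.1.2.2.monotone h.1, x.2.2.2.2 h.2⟩)⟩

theorem ofShuffles_injective : Function.Injective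
    (ofShuffles : Shuffle m l n × Shuffle p q m × Shuffle r s l → Shuffle₄ p q r s n) := by
  rintro ⟨c, a, b⟩ ⟨c', a', b'⟩ h
  have h1 : ∀ j, a.1 (c.1 j).1 = a'.1 (c'.1 j).1 := fun j =>
    congrArg Prod.fst (congrFun (congrArg Subtype.val h) j)
  have h2 : ∀ j, b.1 (c.1 j).2 = b'.1 (c'.1 j).2 := fun j =>
    congrArg Prod.snd (congrFun (congrArg Subtype.val h) j)
  have hc : c = c' := Subtype.ext (funext fun j => Prod.ext
    (Fin.ext (by rw [← a.rank, ← a'.rank, h1])) (Fin.ext (by rw [← b.rank, ← b'.rank, h2])))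
  subst hc
  have ha : a = a' := Subtype.ext (funext fun i => by
    obtain ⟨j, rfl⟩ := c.exists_fst_eq i
    exact h1 j)
  have hb : b = b' := Subtype.ext (funext fun i => by
    obtain ⟨j, rfl⟩ := c.exists_snd_eq i
    exact h2 j)
  rw [ha, hb]

/-- Elements of a product of two chains that are comparable and have the same rank agree. -/
theorem eq_of_rank_eq {a b : Fin (p + 1) × Fin (q + 1)} (h : a ≤ b ∨ b ≤ a)
    (hr : (a.1 : ℕ) + a.2 = b.1 + b.2) : a = b := by
  simp only [Prod.le_def, Fin.le_def] at h
  exact Prod.ext (Fin.ext (by omega)) (Fin.ext (by omega))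

/-- A monotone map to a product of two chains factors through the rank, if the latter
attains all values. -/
theorem exists_shuffle {c : Fin (n + 1) → Fin (p + 1) × Fin (q + 1)} (hc : Monotone c)
    {ρ : Fin (n + 1) → Fin (m + 1)} (hm : p + q = m)
    (hρ : ∀ j, ((c j).1 : ℕ) + (c j).2 = ρ j) (hsurj : ∀ i, ∃ j, ρ j = i) :
    ∃ a : Shuffle p q m, ∀ j, a.1 (ρ j) = c j := by
  choose t ht using hsurj
  have key : ∀ j, c (t (ρ j)) = c j := fun j =>
    eq_of_rank_eq ((le_total (t (ρ j)) j).imp (fun h => hc h) (fun h => hc h))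
      (by rw [hρ, hρ, ht])
  refine ⟨⟨fun i => c (t i), hm, fun i i' h => ?_⟩, key⟩
  have r1 := hρ (t i)
  have r2 := hρ (t i')
  rw [ht] at r1 r2
  have h' : (i : ℕ) < i' := h
  rcases le_total (t i) (t i') with h1 | h1
  · refine lt_of_le_of_ne (hc h1) fun he => ?_
    have he' : c (t i) = c (t i') := he
    rw [he'] at r1
    omega
  · have := hc h1
    simp only [Prod.le_def, Fin.le_def] at this
    omega

theorem ofShuffles_surjective (hm : p + q = m) (hl : r + s = l) : Function.Surjective
    (ofShuffles : Shuffle m l n × Shuffle p q m × Shuffle r s l → Shuffle₄ p q r s n) := by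
  intro C
  have hn := C.2.1
  have hC := C.2.2.monotone
  let c : Shuffle m l n := ⟨fun j => (⟨(C.1 j).1.1 + (C.1 j).1.2, by omega⟩,
    ⟨(C.1 j).2.1 + (C.1 j).2.2, by omega⟩), by omega, fun a b h => by
      have h' := C.2.2 h
      simp only [Prod.lt_iff, Prod.le_def, Fin.lt_def, Fin.le_def] at h' ⊢
      omega⟩
  obtain ⟨a, ha⟩ := exists_shuffle (c := fun j => (C.1 j).1) (fun _ _ h => (hC h).1) hm
    (ρ := fun j => (c.1 j).1) (fun _ => rfl) c.exists_fst_eq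
  obtain ⟨b, hb⟩ := exists_shuffle (c := fun j => (C.1 j).2) (fun _ _ h => (hC h).2) hl
    (ρ := fun j => (c.1 j).2) (fun _ => rfl) c.exists_snd_eq
  exact ⟨(c, a, b), Subtype.ext (funext fun j => Prod.ext (ha j) (hb j))⟩

end Shuffle₄

section Interchange

variable (A B C D : SSet.{u})

/-- The map `(A × B) × (C × D) → (A × C) × (B × D)` that exchanges the middle factors. -/
def mid : (A ⊗ B) ⊗ (C ⊗ D) ⟶ (A ⊗ C) ⊗ (B ⊗ D) where
  app _ := ↾ fun z => ((z.1.1, z.2.1), (z.1.2, z.2.2))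
  naturality _ _ _ := rfl

variable {A B C D} {p q r s m l n : ℕ}

/-- The simplex of `(A × B) × (C × D)` obtained by restricting four simplices along
a chain in `([p] × [q]) × ([r] × [s])`. -/
def pull₄ (a : A _⦋p⦌) (b : B _⦋q⦌) (c : C _⦋r⦌) (d : D _⦋s⦌) (x : Shuffle₄ p q r s n) :
    ((A ⊗ B) ⊗ (C ⊗ D) : SSet.{u}) _⦋n⦌ :=
  let f : Fin (n + 1) →o (Fin (p + 1) × Fin (q + 1)) × (Fin (r + 1) × Fin (s + 1)) :=
    ⟨x.1, x.2.2.monotone⟩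
  let f₁ : Chain p q n := OrderHom.fst.comp f
  let f₂ : Chain r s n := OrderHom.snd.comp f
  (pull a b f₁, pull c d f₂)

/-- The terms of a shuffle of shuffles correspond to the maximal chains in a fourfold product. -/
theorem shuffle_shuffle_cl (hm : p + q = m) (hl : r + s = l) (a : A _⦋p⦌) (b : B _⦋q⦌)
    (c : C _⦋r⦌) (d : D _⦋s⦌) :
    shuffle (A ⊗ B) (C ⊗ D) m l n (shuffle A B p q m (cl a) (cl b))
      (shuffle C D r s l (cl c) (cl d)) = ∑ x : Shuffle₄ p q r s n, cl (pull₄ a b c d x) := by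
  rw [← (Equiv.ofBijective _ ⟨Shuffle₄.ofShuffles_injective,
    Shuffle₄.ofShuffles_surjective (n := n) hm hl⟩).sum_comp, Fintype.sum_prod_type,
    Finset.sum_comm, Fintype.sum_prod_type, Finset.sum_comm, shuffle_cl a b, shuffle_cl c d,
    map_sum]
  refine Finset.sum_congr rfl fun z _ => ?_
  rw [map_sum, LinearMap.sum_apply]
  refine Finset.sum_congr rfl fun y _ => ?_
  rw [shuffle_cl]
  refine Finset.sum_congr rfl fun x _ => congrArg cl (Prod.ext (Prod.ext ?_ ?_) (Prod.ext ?_ ?_))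
  · exact (Functor.map_comp_apply A y.chain.fst.op x.chain.fst.op a).symm
  · exact (Functor.map_comp_apply B y.chain.snd.op x.chain.fst.op b).symm
  · exact (Functor.map_comp_apply C z.chain.fst.op x.chain.snd.op c).symm
  · exact (Functor.map_comp_apply D z.chain.snd.op x.chain.snd.op d).symm

/-- A property of normalized chains that is additive may be checked on simplices. -/
theorem N_induction {Z : SSet.{u}} {P : N Z q → Prop} (h0 : P 0)
    (hadd : ∀ x y, P x → P y → P (x + y)) (hcl : ∀ z, P (cl z)) (x : N Z q) : P x := by
  obtain ⟨x, rfl⟩ := Submodule.Quotient.mk_surjective _ x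
  induction x using Finsupp.induction_linear with
  | zero => exact h0
  | add x y hx hy => exact hadd _ _ hx hy
  | single z a =>
    obtain rfl | rfl : a = 0 ∨ a = 1 := by revert a; decide
    · rw [Finsupp.single_zero]; exact h0
    · exact hcl z

/-- The interchange law for the shuffle map: the shuffles of a shuffle of `a`, `b` with a shuffle
of `c`, `d` and those of a shuffle of `a`, `c` with a shuffle of `b`, `d` are the same maximal
chains in a fourfold product. -/
theorem nmap_mid_shuffle (a : N A p) (b : N B q) (c : N C r) (d : N D s) :
    nmap (mid A B C D) n (shuffle (A ⊗ B) (C ⊗ D) (p + q) (r + s) n (shuffle A B p q _ a b)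
      (shuffle C D r s _ c d)) =
    shuffle (A ⊗ C) (B ⊗ D) (p + r) (q + s) n (shuffle A C p r _ a c)
      (shuffle B D q s _ b d) := by
  induction a using N_induction with
  | h0 => simp only [map_zero, LinearMap.zero_apply]
  | hadd x y hx hy => simp only [map_add, LinearMap.add_apply, hx, hy]
  | hcl a =>
  induction b using N_induction with
  | h0 => simp only [map_zero, LinearMap.zero_apply]
  | hadd x y hx hy => simp only [map_add, LinearMap.add_apply, hx, hy]
  | hcl b =>
  induction c using N_induction with
  | h0 => simp only [map_zero, LinearMap.zero_apply]
  | hadd x y hx hy => simp only [map_add, LinearMap.add_apply, hx, hy]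
  | hcl c =>
  induction d using N_induction with
  | h0 => simp only [map_zero]
  | hadd x y hx hy => simp only [map_add, hx, hy]
  | hcl d =>
  rw [shuffle_shuffle_cl rfl rfl, shuffle_shuffle_cl rfl rfl, map_sum]
  refine Fintype.sum_equiv (⟨Shuffle₄.mid, Shuffle₄.mid, fun _ => rfl, fun _ => rfl⟩ :
    Shuffle₄ p q r s n ≃ Shuffle₄ p r q s n) _ _ fun x => ?_
  rw [nmap_cl]
  rfl

/-- A sum over an antidiagonal as a sum over a square, if the other summands vanish. This gives index
sets that do not depend on one another. -/
theorem sum_antidiagonal_eq {M : Type w} [AddCommMonoid M] {F : ℕ → ℕ → M} {k : ℕ}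
    (hF : ∀ i j, i + j ≠ k → F i j = 0) (K : ℕ) (hk : k < K) :
    ∑ x ∈ Finset.HasAntidiagonal.antidiagonal k, F x.1 x.2 =
      ∑ i ∈ Finset.range K, ∑ j ∈ Finset.range K, F i j := by
  rw [← Finset.sum_product' (f := F)]
  refine Finset.sum_subset (fun x hx => ?_) (fun x _ hx => hF _ _ ?_)
  · rw [Finset.HasAntidiagonal.mem_antidiagonal] at hx
    rw [Finset.mem_product, Finset.mem_range, Finset.mem_range]
    omega
  · rwa [Finset.HasAntidiagonal.mem_antidiagonal] at hx

theorem chShuffle_chShuffle (a : Ch A) (b : Ch B) (c : Ch C) (d : Ch D) (n : ℕ) :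
    chShuffle (A ⊗ B) (C ⊗ D) (chShuffle A B a b) (chShuffle C D c d) n =
      ∑ p ∈ Finset.range (n + 1), ∑ q ∈ Finset.range (n + 1), ∑ r ∈ Finset.range (n + 1),
        ∑ s ∈ Finset.range (n + 1), shuffle (A ⊗ B) (C ⊗ D) (p + q) (r + s) n
          (shuffle A B p q _ (a p) (b q)) (shuffle C D r s _ (c r) (d s)) := by
  -- the degrees `m = p + q` and `l = r + s` are determined by the other indices, as the shuffle map
  -- vanishes in all other degrees
  have h1 : ∀ m l, m + l = n → shuffle (A ⊗ B) (C ⊗ D) m l n (chShuffle A B a b m)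
      (chShuffle C D c d l) = ∑ p ∈ Finset.range (n + 1), ∑ q ∈ Finset.range (n + 1),
        ∑ r ∈ Finset.range (n + 1), ∑ s ∈ Finset.range (n + 1),
        shuffle (A ⊗ B) (C ⊗ D) m l n
          (shuffle A B p q m (a p) (b q)) (shuffle C D r s l (c r) (d s)) := by
    intro m l h
    rw [chShuffle_apply,
      sum_antidiagonal_eq (F := fun i j => shuffle A B i j m (a i) (b j))
        (fun _ _ h => shuffle_eq_zero h _ _) (n + 1) (by omega), map_sum, LinearMap.sum_apply]
    refine Finset.sum_congr rfl fun p _ => ?_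
    rw [map_sum, LinearMap.sum_apply]
    refine Finset.sum_congr rfl fun q _ => ?_
    rw [chShuffle_apply,
      sum_antidiagonal_eq (F := fun i j => shuffle C D i j l (c i) (d j))
        (fun _ _ h => shuffle_eq_zero h _ _) (n + 1) (by omega), map_sum]
    refine Finset.sum_congr rfl fun r _ => ?_
    rw [map_sum]
  rw [chShuffle_apply, Finset.sum_congr rfl fun x hx => h1 x.1 x.2
    (Finset.HasAntidiagonal.mem_antidiagonal.1 hx), Finset.sum_comm]
  refine Finset.sum_congr rfl fun p _ => ?_
  rw [Finset.sum_comm]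
  refine Finset.sum_congr rfl fun q _ => ?_
  rw [Finset.sum_comm]
  refine Finset.sum_congr rfl fun r _ => ?_
  rw [Finset.sum_comm]
  refine Finset.sum_congr rfl fun s _ => ?_
  by_cases h : p + q + (r + s) = n
  · refine Finset.sum_eq_single (p + q, r + s) (fun x _ hx => ?_) (fun hx => ?_)
    · by_cases h2 : p + q = x.1
      · have h3 : r + s ≠ x.2 := fun h3 => hx (Prod.ext h2.symm h3.symm)
        rw [shuffle_eq_zero h3, map_zero]
      · rw [shuffle_eq_zero h2, map_zero, LinearMap.zero_apply]
    · exact absurd (Finset.HasAntidiagonal.mem_antidiagonal.2 h) hx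
  · rw [shuffle_eq_zero h]
    refine Finset.sum_eq_zero fun x hx => ?_
    rw [Finset.HasAntidiagonal.mem_antidiagonal] at hx
    by_cases h2 : p + q = x.1
    · rw [shuffle_eq_zero (show r + s ≠ x.2 by omega), map_zero]
    · rw [shuffle_eq_zero h2, map_zero, LinearMap.zero_apply]

theorem chMap_mid_chShuffle (a : Ch A) (b : Ch B) (c : Ch C) (d : Ch D) :
    chMap (mid A B C D) (chShuffle (A ⊗ B) (C ⊗ D) (chShuffle A B a b) (chShuffle C D c d)) =
      chShuffle (A ⊗ C) (B ⊗ D) (chShuffle A C a c) (chShuffle B D b d) := by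
  funext n
  change nmap _ n (chShuffle _ _ _ _ n) = _
  rw [chShuffle_chShuffle, chShuffle_chShuffle]
  simp only [map_sum, nmap_mid_shuffle]
  exact Finset.sum_congr rfl fun p _ => Finset.sum_comm

end Interchange

/-! ### The cone contraction of the chains of products of simplices -/

section Cone

variable {k l k' l' n : ℕ}

/-- The order preserving map `[n + 1] → [k]` that extends a map on the last `n + 1` elements by
`0 ↦ 0`. -/
def coneHom (θ : ⦋n⦌ ⟶ ⦋k⦌) : ⦋n + 1⦌ ⟶ ⦋k⦌ :=
  SimplexCategory.mkHom ⟨Fin.cons (α := fun _ => Fin (k + 1)) 0 θ.toOrderHom, fun i j h => by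
    induction i using Fin.cases with
    | zero => exact Fin.zero_le _
    | succ i =>
      induction j using Fin.cases with
      | zero => exact absurd h (by simp)
      | succ j => exact θ.toOrderHom.monotone (Fin.succ_le_succ_iff.1 h)⟩

theorem coneHom_comp (θ : ⦋n⦌ ⟶ ⦋k⦌) (f : ⦋k⦌ ⟶ ⦋k'⦌)
    (hf : f.toOrderHom (0 : Fin (k + 1)) = (0 : Fin (k' + 1))) :
    coneHom θ ≫ f = coneHom (θ ≫ f) := by
  refine SimplexCategory.Hom.ext _ _ (OrderHom.ext _ _ (funext fun i => ?_))
  induction i using Fin.cases with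
  | zero => exact hf
  | succ i => rfl

theorem δ_zero_coneHom (θ : ⦋n⦌ ⟶ ⦋k⦌) : SimplexCategory.δ 0 ≫ coneHom θ = θ := by
  refine SimplexCategory.Hom.ext _ _ (OrderHom.ext _ _ (funext fun j => ?_))
  change (coneHom θ).toOrderHom ((0 : Fin (n + 2)).succAbove j) = θ.toOrderHom j
  rw [Fin.zero_succAbove]; rfl

theorem δ_succ_coneHom (θ : ⦋n + 1⦌ ⟶ ⦋k⦌) (i : Fin (n + 2)) :
    SimplexCategory.δ i.succ ≫ coneHom θ = coneHom (SimplexCategory.δ i ≫ θ) := by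
  refine SimplexCategory.Hom.ext _ _ (OrderHom.ext _ _ (funext fun j => ?_))
  induction j using Fin.cases with
  | zero => rfl
  | succ j =>
    change (coneHom θ).toOrderHom (i.succ.succAbove j.succ) = θ.toOrderHom (i.succAbove j)
    rw [Fin.succ_succAbove_succ]; rfl

theorem σ_succ_coneHom (θ : ⦋n⦌ ⟶ ⦋k⦌) (i : Fin (n + 1)) :
    SimplexCategory.σ i.succ ≫ coneHom θ = coneHom (SimplexCategory.σ i ≫ θ) := by
  refine SimplexCategory.Hom.ext _ _ (OrderHom.ext _ _ (funext fun j => ?_))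
  induction j using Fin.cases with
  | zero => rfl
  | succ j =>
    change (coneHom θ).toOrderHom (i.succ.predAbove j.succ) = θ.toOrderHom (i.predAbove j)
    rw [Fin.succ_predAbove_succ]; rfl

/-- The simplex of `Δ^k` with an additional first vertex `0`. -/
def coneStd (z : (Δ[k] : SSet.{u}) _⦋n⦌) : (Δ[k] : SSet.{u}) _⦋n + 1⦌ :=
  SSet.stdSimplex.objEquiv.symm (coneHom (SSet.stdSimplex.objEquiv z))

/-- The simplex of `Δ^k × Δ^l` with an additional first vertex `(0, 0)`. -/
def coneProd (z : (Δ[k] ⊗ Δ[l] : SSet.{u}) _⦋n⦌) : (Δ[k] ⊗ Δ[l] : SSet.{u}) _⦋n + 1⦌ :=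
  (coneStd z.1, coneStd z.2)

theorem δ_zero_coneProd (z : (Δ[k] ⊗ Δ[l] : SSet.{u}) _⦋n⦌) :
    (Δ[k] ⊗ Δ[l] : SSet.{u}).δ 0 (coneProd z) = z :=
  Prod.ext (congrArg SSet.stdSimplex.objEquiv.symm (δ_zero_coneHom _))
    (congrArg SSet.stdSimplex.objEquiv.symm (δ_zero_coneHom _))

theorem δ_succ_coneProd (z : (Δ[k] ⊗ Δ[l] : SSet.{u}) _⦋n + 1⦌) (i : Fin (n + 2)) :
    (Δ[k] ⊗ Δ[l] : SSet.{u}).δ i.succ (coneProd z) =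
      coneProd ((Δ[k] ⊗ Δ[l] : SSet.{u}).δ i z) :=
  Prod.ext (congrArg SSet.stdSimplex.objEquiv.symm (δ_succ_coneHom _ i))
    (congrArg SSet.stdSimplex.objEquiv.symm (δ_succ_coneHom _ i))

theorem σ_succ_coneProd (z : (Δ[k] ⊗ Δ[l] : SSet.{u}) _⦋n⦌) (i : Fin (n + 1)) :
    (Δ[k] ⊗ Δ[l] : SSet.{u}).σ i.succ (coneProd z) =
      coneProd ((Δ[k] ⊗ Δ[l] : SSet.{u}).σ i z) :=
  Prod.ext (congrArg SSet.stdSimplex.objEquiv.symm (σ_succ_coneHom _ i))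
    (congrArg SSet.stdSimplex.objEquiv.symm (σ_succ_coneHom _ i))

theorem coneProd_degenerate {z : (Δ[k] ⊗ Δ[l] : SSet.{u}) _⦋n⦌}
    (hz : z ∈ (Δ[k] ⊗ Δ[l] : SSet.{u}).degenerate n) :
    coneProd z ∈ (Δ[k] ⊗ Δ[l] : SSet.{u}).degenerate (n + 1) := by
  obtain _ | n := n
  · rw [SSet.degenerate_zero] at hz
    exact hz.elim
  · rw [SSet.degenerate_eq_iUnion_range_σ, Set.mem_iUnion] at hz
    obtain ⟨i, y, rfl⟩ := hz
    rw [← σ_succ_coneProd]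
    exact SSet.σ_mem_degenerate _ _ _

variable (k l) in
/-- The operator on the chains of `Δ^k × Δ^l` that adds the first vertex `(0, 0)`. -/
noncomputable def cone (n : ℕ) :
    N (Δ[k] ⊗ Δ[l] : SSet.{u}) n →ₗ[𝕂] N (Δ[k] ⊗ Δ[l] : SSet.{u}) (n + 1) :=
  lift (fun z => cl (coneProd z)) (fun _ hz => cl_degenerate (coneProd_degenerate hz))

theorem cone_cl (z : (Δ[k] ⊗ Δ[l] : SSet.{u}) _⦋n⦌) : cone k l n (cl z) = cl (coneProd z) :=
  lift_cl ..

/-- The cone operator is a contraction. In degree `0` there would be an additional term, the vertex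
`(0, 0)`. -/
theorem bdry_cone (x : N (Δ[k] ⊗ Δ[l] : SSet.{u}) (n + 1)) :
    bdry _ (n + 1) (cone k l (n + 1) x) = x + cone k l n (bdry _ n x) := by
  suffices bdry _ (n + 1) ∘ₗ cone k l (n + 1) = LinearMap.id + cone k l n ∘ₗ bdry _ n from
    LinearMap.congr_fun this x
  refine N_ext fun z => ?_
  rw [LinearMap.comp_apply, LinearMap.add_apply, LinearMap.comp_apply, cone_cl, bdry_cl, bdry_cl,
    map_sum, Fin.sum_univ_succ]
  refine congrArg₂ (· + ·) (congrArg cl (δ_zero_coneProd z)) (Finset.sum_congr rfl fun i _ => ?_)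
  rw [cone_cl, δ_succ_coneProd]

/-- The cone operator commutes with maps that preserve the first vertex; these include
the codegeneracies, but not the coface `d^0`. -/
theorem nmap_cone (f : ⦋k⦌ ⟶ ⦋k'⦌) (g : ⦋l⦌ ⟶ ⦋l'⦌)
    (hf : f.toOrderHom (0 : Fin (k + 1)) = (0 : Fin (k' + 1)))
    (hg : g.toOrderHom (0 : Fin (l + 1)) = (0 : Fin (l' + 1)))
    (x : N (Δ[k] ⊗ Δ[l] : SSet.{u}) n) :
    nmap (SSet.stdSimplex.map f ⊗ₘ SSet.stdSimplex.map g) (n + 1) (cone k l n x) =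
      cone k' l' n (nmap (SSet.stdSimplex.map f ⊗ₘ SSet.stdSimplex.map g) n x) := by
  suffices nmap (SSet.stdSimplex.{u}.map f ⊗ₘ SSet.stdSimplex.map g) (n + 1) ∘ₗ cone k l n =
      cone k' l' n ∘ₗ nmap (SSet.stdSimplex.map f ⊗ₘ SSet.stdSimplex.map g) n from
    LinearMap.congr_fun this x
  refine N_ext fun z => ?_
  rw [LinearMap.comp_apply, LinearMap.comp_apply, cone_cl, nmap_cl, nmap_cl, cone_cl]
  refine congrArg cl (Prod.ext ?_ ?_)
  · exact congrArg SSet.stdSimplex.objEquiv.symm (coneHom_comp (SSet.stdSimplex.objEquiv z.1) f hf)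
  · exact congrArg SSet.stdSimplex.objEquiv.symm (coneHom_comp (SSet.stdSimplex.objEquiv z.2) g hg)

variable (k l) in
/-- The cone operator on all chains. -/
noncomputable def chCone : Ch (Δ[k] ⊗ Δ[l] : SSet.{u}) →ₗ[𝕂] Ch (Δ[k] ⊗ Δ[l] : SSet.{u}) :=
  LinearMap.pi fun n => match n with
    | 0 => 0
    | n + 1 => cone k l n ∘ₗ LinearMap.proj n

theorem chBdry_chCone {x : Ch (Δ[k] ⊗ Δ[l] : SSet.{u})} (hx : x 0 = 0) :
    chBdry _ (chCone k l x) = x + chCone k l (chBdry _ x) := by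
  funext n
  change bdry _ n (cone k l n (x n)) = x n + chCone k l (chBdry _ x) n
  obtain _ | n := n
  · rw [hx, map_zero, map_zero, zero_add]; rfl
  · exact bdry_cone (x (n + 1))

theorem chMap_chCone (f : ⦋k⦌ ⟶ ⦋k'⦌) (g : ⦋l⦌ ⟶ ⦋l'⦌)
    (hf : f.toOrderHom (0 : Fin (k + 1)) = (0 : Fin (k' + 1)))
    (hg : g.toOrderHom (0 : Fin (l + 1)) = (0 : Fin (l' + 1)))
    (x : Ch (Δ[k] ⊗ Δ[l] : SSet.{u})) :
    chMap (SSet.stdSimplex.map f ⊗ₘ SSet.stdSimplex.map g) (chCone k l x) =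
      chCone k' l' (chMap (SSet.stdSimplex.map f ⊗ₘ SSet.stdSimplex.map g) x) := by
  funext n
  obtain _ | n := n
  · exact map_zero (nmap (SSet.stdSimplex.map f ⊗ₘ SSet.stdSimplex.map g) 0)
  · exact nmap_cone f g hf hg (x n)

theorem chCone_deg {n : ℤ} {x : Ch (Δ[k] ⊗ Δ[l] : SSet.{u})} (hx : x ∈ chDeg _ n) :
    chCone k l x ∈ chDeg _ (n + 1) := by
  intro q hq
  obtain _ | q := q
  · rfl
  · change cone k l q (x q) = 0
    rw [hx q (by push_cast at hq; omega), map_zero]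

end Cone

section Contraction

/-- The cosimplicial space `Δ^•`. It is a separate definition because `SSet.stdSimplex` has the type
`CosimplicialObject SSet`, which agrees with `CosSp` only up to
unfolding. -/
def Δs : CosSp.{u} := SSet.stdSimplex.{u}

/-- The cosimplicial space `Δ^• × Δ^•`. -/
abbrev ΔΔ : CosSp.{u} := Δs ⊗ Δs

/-- The operator `x ↦ C (b + d x)`, where `C` is the cone operator and `d` is the horizontal
differential, with value `0` in cosimplicial degree `0`. Its fixed point `x` has vertical boundary
`b + d x` if `b` is a cycle of degree `0` that vanishes in cosimplicial degree `0`. -/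
noncomputable def coneStep (b x : CCh ΔΔ.{u}) : CCh ΔΔ.{u} := fun k => match k with
  | 0 => 0
  | k + 1 => chCone (k + 1) (k + 1) (b (k + 1) + cobdry ΔΔ k (x k))

theorem coneStep_conorm {b x : CCh ΔΔ.{u}} (hb : b ∈ conorm ΔΔ) (hx : x ∈ conorm ΔΔ) :
    coneStep b x ∈ conorm ΔΔ := by
  intro p i
  have h1 : chMap (ΔΔ.map (SimplexCategory.σ i)) (b (p + 1) + cobdry ΔΔ p (x p)) = 0 := by
    rw [map_add, hb, zero_add]
    exact hBdry_conorm hx p i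
  have h2 : (SimplexCategory.σ i).toOrderHom (0 : Fin (p + 2)) = (0 : Fin (p + 1)) :=
    Fin.ext (by rw [σ_val]; simp)
  refine (chMap_chCone _ _ h2 h2 _).trans ?_
  exact (congrArg (chCone p p) h1).trans (map_zero _)

theorem coneStep_deg {b x : CCh ΔΔ.{u}} (hb : b ∈ totDeg ΔΔ 0) (hx : x ∈ totDeg ΔΔ 1) :
    coneStep b x ∈ totDeg ΔΔ 1 := by
  intro p
  obtain _ | p := p
  · exact zero_mem _
  · have h := hBdry_deg hx (p + 1)
    have hb' := hb (p + 1)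
    rw [show (0 : ℤ) = 1 - 1 by rfl] at hb'
    have := chCone_deg (add_mem hb' h)
    rwa [show 1 - 1 + ((p + 1 : ℕ) : ℤ) + 1 = 1 + ((p + 1 : ℕ) : ℤ) by ring] at this

/-- The fixed point of `coneStep b`. Since `coneStep b x` depends in cosimplicial degree `k + 1` only
on `x_k`, iterates from the `k`-th on have the same component of degree `k`. -/
noncomputable def coneFix (b : CCh ΔΔ.{u}) : CCh ΔΔ.{u} := fun k => ((coneStep b)^[k] 0) k

theorem coneFix_succ (b : CCh ΔΔ.{u}) (p : ℕ) : coneFix b (p + 1) =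
    chCone (p + 1) (p + 1) (b (p + 1) + cobdry ΔΔ p (coneFix b p)) := by
  rw [coneFix, Function.iterate_succ_apply']; rfl

theorem coneFix_mem_deg {b : CCh ΔΔ.{u}} (hb : b ∈ (T ΔΔ.{u}).deg 0) :
    coneFix b ∈ (T ΔΔ.{u}).deg 1 := by
  have h : ∀ n, (coneStep b)^[n] 0 ∈ conorm ΔΔ ⊓ totDeg ΔΔ 1 := by
    intro n
    induction n with
    | zero => exact zero_mem _
    | succ n ih =>
      rw [Function.iterate_succ_apply']
      exact ⟨coneStep_conorm hb.1 ih.1, coneStep_deg hb.2 ih.2⟩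
  exact ⟨fun p i => (h (p + 1)).1 p i, fun p => (h p).2 p⟩

/-- The contraction of the columns shows that a cycle of degree `0` that vanishes in cosimplicial
degree `0` is a boundary. -/
theorem d_coneFix {b : CCh ΔΔ.{u}} (hb : b ∈ (T ΔΔ.{u}).cycles 0) (h0 : b 0 = 0) :
    (T ΔΔ.{u}).d (coneFix b) = b := by
  have hd : ∀ k, hBdry ΔΔ b k + vBdry ΔΔ b k = 0 := fun k => congrFun hb.2 k
  suffices h : ∀ k, vBdry ΔΔ (coneFix b) k = b k + hBdry ΔΔ (coneFix b) k by
    funext k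
    change hBdry ΔΔ (coneFix b) k + vBdry ΔΔ (coneFix b) k = b k
    rw [h, add_left_comm, add_self_eq_zero, add_zero]
  intro k
  induction k with
  | zero =>
    rw [h0]
    exact (map_zero (chBdry _)).trans (add_zero _).symm
  | succ k ih =>
    have hdeg : (b (k + 1) + cobdry ΔΔ k (coneFix b k)) 0 = 0 :=
      add_mem (hb.1.2 (k + 1)) (hBdry_deg (coneFix_mem_deg hb.1).2 (k + 1)) 0 (by push_cast; omega)
    change chBdry _ (coneFix b (k + 1)) = b (k + 1) + cobdry ΔΔ k (coneFix b k)
    rw [coneFix_succ]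
    refine (chBdry_chCone hdeg).trans ?_
    have e : chBdry _ (b (k + 1) + cobdry ΔΔ k (coneFix b k)) = 0 := by
      have e1 := congrFun (vBdry_hBdry (coneFix b)) (k + 1)
      have e2 := hd (k + 1)
      change chBdry _ (cobdry ΔΔ k (coneFix b k)) = cobdry ΔΔ k (vBdry ΔΔ (coneFix b) k) at e1
      change cobdry ΔΔ k (b k) + chBdry _ (b (k + 1)) = 0 at e2
      have e3 : cobdry ΔΔ k (hBdry ΔΔ (coneFix b) k) = 0 :=
        congrFun (hBdry_hBdry (coneFix b)) (k + 1)
      rw [map_add, e1, ih, map_add, e3, add_zero]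
      exact (add_comm _ _).trans e2
    exact (congrArg _ ((congrArg (chCone _ _) e).trans (map_zero _))).trans (add_zero _)

end Contraction

/-! ### Evaluation of the totalization, and multiplicativity of the comparison map in homology -/

section Evaluation

variable {X Y : CosSp.{u}}

/-- The component `Δ^k × Δ^q → X^k` of a `q`-simplex of `Tot X`. -/
def totApp {m : SimplexCategoryᵒᵖ} (f : (Tot X).obj m) (k : SimplexCategory) :
    Δs.{u}.obj k ⊗ SSet.stdSimplex.{u}.obj m.unop ⟶ X.obj k :=
  (f : cyl.obj m.unop ⟶ X).app k

/-- The top dimensional simplex of `Δ^q`. -/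
def topSimplex (m : SimplexCategoryᵒᵖ) : (SSet.stdSimplex.{u}.obj m.unop).obj m :=
  SSet.stdSimplex.objEquiv.symm (𝟙 m.unop)

variable (X) in
/-- The evaluation map `Δ^k × Tot X → X^k`, which sends an `m`-simplex `(a, f)` to `f (a, ι)`, where
`ι` is the top dimensional simplex of `Δ^m`. -/
def ev (k : SimplexCategory) : Δs.{u}.obj k ⊗ Tot X ⟶ X.obj k where
  app m := ↾ fun a => (totApp a.2 k).app m (a.1, topSimplex m)
  naturality m m' θ := by
    ext a
    refine Eq.trans ?_ (NatTrans.naturality_apply (totApp a.2 k) θ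
      (show (Δs.{u}.obj k ⊗ SSet.stdSimplex.{u}.obj m.unop).obj m from (a.1, topSimplex m)))
    refine congrArg (fun z : (Δs.{u}.obj k ⊗ SSet.stdSimplex.{u}.obj m.unop).obj m' =>
      (totApp a.2 k).app m' z) (Prod.ext rfl ?_)
    apply SSet.stdSimplex.objEquiv.injective
    exact (Category.id_comp θ.unop).trans (Category.comp_id θ.unop).symm

theorem ev_naturality {k k' : SimplexCategory} (θ : k ⟶ k') :
    (Δs.map θ ⊗ₘ 𝟙 (Tot X)) ≫ ev X k' = ev X k ≫ X.map θ := by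
  ext m a
  exact congrArg (fun g : Δs.{u}.obj k ⊗ SSet.stdSimplex.{u}.obj m.unop ⟶ X.obj k' =>
    g.app m (a.1, topSimplex m)) ((a.2 : cyl.obj m.unop ⟶ X).naturality θ)

theorem phi_eq (k q m : ℕ) (x : N (Tot X) q) :
    phi X k q m x = nmap (ev X ⦋k⦌) m (shuffle (Δs.obj ⦋k⦌) (Tot X) k q m (top k) x) := by
  suffices phi X k q m = nmap (ev X ⦋k⦌) m ∘ₗ shuffle (Δs.obj ⦋k⦌) (Tot X) k q m (top k) from
    LinearMap.congr_fun this x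
  refine N_ext fun f => ?_
  rw [phi_cl, LinearMap.comp_apply, wedge, top, top, shuffle_cl]
  refine (map_sum (nmap ((toHom f).app ⦋k⦌) m) _ _).trans ?_
  refine Eq.trans ?_ (congrArg (nmap (ev X ⦋k⦌) m) (shuffle_cl _ _)).symm
  rw [map_sum]
  refine Finset.sum_congr rfl fun c _ => ?_
  refine (nmap_cl ((toHom f).app ⦋k⦌) m _).trans (Eq.trans ?_ (nmap_cl (ev X ⦋k⦌) m _).symm)
  refine congrArg (fun z => cl ((totApp f ⦋k⦌).app (op ⦋m⦌) z)) (Prod.ext rfl ?_)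
  apply SSet.stdSimplex.objEquiv.injective
  exact (Category.comp_id c.chain.snd).trans (Category.id_comp c.chain.snd).symm

/-- The family of the top dimensional simplices of the spaces `Δ^k`, as an element of
`TCS_*(Δ^•)`. -/
noncomputable def tops : CCh Δs.{u} := fun k => Pi.single k (top k)

theorem tops_apply (k : ℕ) : tops.{u} k k = top k := Pi.single_eq_same ..

theorem tops_mem_cycles : tops.{u} ∈ (T Δs.{u}).cycles 0 := by
  have hdeg : ∀ k : ℕ, tops.{u} k ∈ chDeg Δ[k] (0 + (k : ℤ)) := fun k q hq =>
    Pi.single_eq_of_ne (by omega) _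
  refine ⟨⟨fun p i => ?_, hdeg⟩, ?_⟩
  · funext q
    change nmap _ q (tops (p + 1) q) = 0
    by_cases h : q = p + 1
    · subst h
      rw [tops_apply]
      exact nmap_top_eq_zero _ (Nat.lt_succ_self p)
    · exact (congrArg _ (hdeg (p + 1) q (by push_cast; omega))).trans (map_zero _)
  · funext k
    funext q
    change hBdry Δs tops k q + bdry (Δs.obj ⦋k⦌) q (tops k (q + 1)) = 0
    obtain _ | k := k
    · have h : tops.{u} 0 (q + 1) = 0 := hdeg 0 (q + 1) (by push_cast; omega)
      rw [h, map_zero, add_zero]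
      rfl
    · change cobdry Δs k (tops k) q + bdry (Δs.obj ⦋k + 1⦌) q (tops (k + 1) (q + 1)) = 0
      rw [cobdry_apply, Finset.sum_apply]
      change ∑ i : Fin (k + 2), nmap (Δs.map (SimplexCategory.δ i)) q (tops k q) + _ = 0
      by_cases h : q = k
      · subst h
        rw [tops_apply, tops_apply]
        exact (congrArg (fun z : N (Δs.obj ⦋q + 1⦌) q => _ + z) (bdry_top q)).trans (add_self_eq_zero _)
      · have e1 : tops.{u} k q = 0 := hdeg k q (by omega)
        have e2 : tops.{u} (k + 1) (q + 1) = 0 := hdeg (k + 1) (q + 1) (by push_cast; omega)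
        exact (congrArg₂ (· + ·) (Finset.sum_eq_zero fun i _ => (congrArg _ e1).trans (map_zero _))
          ((congrArg _ e2).trans (map_zero _))).trans (add_zero _)

/-- The map `φ` in terms of evaluation: the component of `φ(x)` in `X^k` is the image of
`ι_k ∧ x`. -/
theorem phiCh_eq (x : Ch (Tot X)) (k : ℕ) :
    phiCh X x k = chMap (ev X ⦋k⦌) (chShuffle _ (Tot X) (tops k) x) := by
  funext m
  change _ = nmap _ m (chShuffle _ _ _ _ m)
  rw [phiCh_apply, chShuffle_apply, sum_antidiagonal_eq
    (F := fun i j => shuffle (Δs.obj ⦋k⦌) (Tot X) i j m (tops k i) (x j))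
    (fun _ _ h => shuffle_eq_zero h _ _) (m + 1) m.lt_succ_self, Finset.sum_comm, map_sum]
  refine Finset.sum_congr rfl fun q _ => ?_
  by_cases h : k + q = m
  · rw [Finset.sum_eq_single k, tops_apply, phi_eq]
    · intro i _ hi
      rw [shuffle_eq_zero (show i + q ≠ m by omega)]
    · intro hk
      rw [Finset.mem_range] at hk
      omega
  · rw [phi_eq_zero h, Finset.sum_eq_zero, map_zero]
    intro i _
    by_cases hi : i = k
    · subst hi
      exact shuffle_eq_zero h _ _
    · have : tops k i = 0 := Pi.single_eq_of_ne hi _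
      rw [this, map_zero, LinearMap.zero_apply]

end Evaluation

section Homotopy

variable {X Y : CosSp.{u}}

variable (X Y) in
/-- The map `(Δ^k × Δ^k) × (Tot X × Tot Y) → X^k × Y^k`, `((a, b), (f, g)) ↦ (f(a), g(b))`. -/
def ev₂ (k : SimplexCategory) : ΔΔ.{u}.obj k ⊗ (Tot X ⊗ Tot Y) ⟶ (X ⊗ Y).obj k :=
  mid (Δs.obj k) (Δs.obj k) (Tot X) (Tot Y) ≫ (ev X k ⊗ₘ ev Y k)

theorem ev₂_naturality {k k' : SimplexCategory} (θ : k ⟶ k') :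
    (ΔΔ.map θ ⊗ₘ 𝟙 (Tot X ⊗ Tot Y)) ≫ ev₂ X Y k' = ev₂ X Y k ≫ (X ⊗ Y).map θ := by
  ext m a
  exact Prod.ext
    (congrArg (fun g : Δs.{u}.obj k ⊗ Tot X ⟶ X.obj k' => g.app m (a.1.1, a.2.1))
      (ev_naturality θ))
    (congrArg (fun g : Δs.{u}.obj k ⊗ Tot Y ⟶ Y.obj k' => g.app m (a.1.2, a.2.2))
      (ev_naturality θ))

/-- The diagonal map of the cosimplicial space `Δ^•`. -/
def diagΔ : Δs.{u} ⟶ ΔΔ.{u} := pairing (𝟙 _) (𝟙 _)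

theorem diagΔ_ev₂ (k : SimplexCategory) :
    (diagΔ.app k ⊗ₘ 𝟙 (Tot X ⊗ Tot Y)) ≫ ev₂ X Y k =
      (𝟙 (Δs.{u}.obj k) ⊗ₘ totProd X Y) ≫ ev (X ⊗ Y) k := by
  ext m a
  rfl

variable (X Y) in
/-- The family of the images of the chains `w_k ∧ z` under the maps
`(Δ^k × Δ^k) × (Tot X × Tot Y) → X^k × Y^k`. -/
noncomputable def evCh (w : CCh ΔΔ.{u}) (z : Ch (Tot X ⊗ Tot Y)) : CCh (X ⊗ Y) := fun k =>
  chMap (ev₂ X Y ⦋k⦌) (chShuffle _ _ (w k) z)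

theorem chMap_ev₂ {k k' : SimplexCategory} (θ : k ⟶ k') (w : Ch (ΔΔ.obj k))
    (z : Ch (Tot X ⊗ Tot Y)) :
    chMap ((X ⊗ Y).map θ) (chMap (ev₂ X Y k) (chShuffle _ _ w z)) =
      chMap (ev₂ X Y k') (chShuffle _ _ (chMap (ΔΔ.map θ) w) z) := by
  have h := chMap_chShuffle (ΔΔ.map θ) (𝟙 (Tot X ⊗ Tot Y)) w z
  rw [chMap_id] at h
  rw [chMap_comp, ← h, chMap_comp, ev₂_naturality]

theorem chMap_ev {k k' : SimplexCategory} (θ : k ⟶ k') (w : Ch (Δs.obj k))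
    (x : Ch (Tot X)) :
    chMap (X.map θ) (chMap (ev X k) (chShuffle _ _ w x)) =
      chMap (ev X k') (chShuffle _ _ (chMap (Δs.map θ) w) x) := by
  have h := chMap_chShuffle (Δs.map θ) (𝟙 (Tot X)) w x
  rw [chMap_id] at h
  rw [chMap_comp, ← h, chMap_comp, ev_naturality]

theorem hBdry_evCh (w : CCh ΔΔ.{u}) (z : Ch (Tot X ⊗ Tot Y)) :
    hBdry _ (evCh X Y w z) = evCh X Y (hBdry _ w) z := by
  funext k
  obtain _ | k := k
  · change 0 = chMap (ev₂ X Y ⦋0⦌) (chShuffle _ _ 0 z)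
    rw [map_zero, LinearMap.zero_apply, map_zero]
  · change cobdry _ k (evCh X Y w z k) = chMap (ev₂ X Y ⦋k + 1⦌) (chShuffle _ _ (cobdry _ k (w k)) z)
    rw [cobdry_apply, cobdry_apply, map_sum, LinearMap.sum_apply, map_sum]
    exact Finset.sum_congr rfl fun i _ => chMap_ev₂ _ _ _

theorem vBdry_evCh (w : CCh ΔΔ.{u}) (z : Ch (Tot X ⊗ Tot Y)) :
    vBdry _ (evCh X Y w z) = evCh X Y (vBdry _ w) z + evCh X Y w (chBdry _ z) := by
  funext k
  change chBdry _ (chMap (ev₂ X Y ⦋k⦌) (chShuffle _ _ (w k) z)) = _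
  rw [← chMap_chBdry, chBdry_chShuffle, map_add]
  rfl

theorem evCh_mem_deg {m n : ℤ} {w : CCh ΔΔ.{u}} {z : Ch (Tot X ⊗ Tot Y)}
    (hw : w ∈ (T ΔΔ.{u}).deg m) (hz : z ∈ chDeg _ n) :
    evCh X Y w z ∈ (T (X ⊗ Y)).deg (m + n) := by
  refine ⟨fun p i => ?_, fun p => ?_⟩
  · refine (chMap_ev₂ _ _ _).trans ?_
    rw [hw.1, map_zero, LinearMap.zero_apply, map_zero]
  · have := chMap_deg (ev₂ X Y ⦋p⦌) (chShuffle_deg (hw.2 p) hz)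
    rwa [add_right_comm] at this

/-- The images of the top dimensional simplices of the `Δ^k` under the diagonal maps. -/
noncomputable def diagCh : CCh ΔΔ.{u} := fun k => chMap (diagΔ.app ⦋k⦌) (tops k)

/-- For the diagonals of the top dimensional simplices, one obtains `φ` on products. -/
theorem evCh_diagΔ (z : Ch (Tot X ⊗ Tot Y)) :
    evCh X Y diagCh z = phiCh (X ⊗ Y) (chMap (totProd X Y) z) := by
  funext k
  have h := chMap_chShuffle (diagΔ.app ⦋k⦌) (𝟙 (Tot X ⊗ Tot Y)) (tops k) z
  have h' := chMap_chShuffle (𝟙 (Δs.{u}.obj ⦋k⦌)) (totProd X Y) (tops k) z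
  rw [chMap_id] at h h'
  rw [phiCh_eq]
  change chMap (ev₂ X Y ⦋k⦌) (chShuffle _ _ (chMap (diagΔ.app ⦋k⦌) (tops k)) z) =
    chMap (ev (X ⊗ Y) ⦋k⦌) (chShuffle _ _ (tops k) (chMap (totProd X Y) z))
  rw [← h, ← h', chMap_comp, chMap_comp, diagΔ_ev₂]

/-- For the external square of the family of the top dimensional simplices, one obtains the external
product of the values of `φ`. -/
theorem evCh_tShuffle (x : Ch (Tot X)) (y : Ch (Tot Y)) :
    evCh X Y (tShuffle _ _ tops tops) (chShuffle _ _ x y) =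
      tShuffle X Y (phiCh X x) (phiCh Y y) := by
  funext k
  change chMap (ev₂ X Y ⦋k⦌) (chShuffle _ _ (tShuffle _ _ tops tops k) _) = _
  rw [tShuffle_apply, tShuffle_apply, map_sum, LinearMap.sum_apply, map_sum]
  refine Finset.sum_congr rfl fun a _ => ?_
  rw [phiCh_eq, phiCh_eq, chMap_ev, chMap_ev, ev₂]
  refine (chMap_comp (mid _ _ (Tot X) (Tot Y)) (ev X ⦋k⦌ ⊗ₘ ev Y ⦋k⦌) _).symm.trans ?_
  refine (congrArg _ (chMap_mid_chShuffle _ _ x y)).trans ?_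
  exact chMap_chShuffle _ _ _ _

/-- The difference (which is also the sum, as `𝕂` has characteristic two) of the Alexander-Whitney
and the geometric diagonal of the family of the top dimensional simplices. -/
noncomputable def diagDiff : CCh ΔΔ.{u} :=
  tShuffle Δs Δs tops tops + diagCh

theorem diagDiff_mem_cycles : diagDiff.{u} ∈ (T ΔΔ.{u}).cycles 0 := by
  have h := tops_mem_cycles.{u}
  have hd : (hBdry Δs.{u} + vBdry Δs) tops = 0 := h.2
  refine ((T ΔΔ.{u}).cycles 0).add_mem
    ⟨(T.shuffle _ _).map_deg 0 0 _ h.1 _ h.1, ?_⟩ ⟨(T.map diagΔ).map_deg _ _ h.1, ?_⟩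
  · change (T ΔΔ.{u}).d ((T.shuffle _ _).f tops tops) = 0
    refine (tShuffle_leibniz tops tops).trans ?_
    rw [hd, map_zero, map_zero, LinearMap.zero_apply, add_zero]
    rfl
  · change (T ΔΔ.{u}).d ((T.map diagΔ).f tops) = 0
    exact ((T.map diagΔ).comm 0 _ h.1).symm.trans ((congrArg _ hd).trans (map_zero _))

/-- The Alexander-Whitney diagonal of a vertex is the geometric one. -/
theorem diagDiff_zero : diagDiff.{u} 0 = 0 := by
  funext q
  obtain _ | q := q
  · -- in degree zero, both terms are the class of the only simplex of `Δ^0 × Δ^0`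
    have hs : ∀ z z' : (Δ[0] ⊗ Δ[0] : SSet.{u}) _⦋0⦌, z = z' := fun z z' => by
      have h : ∀ a b : (Δ[0] : SSet.{u}) _⦋0⦌, a = b := fun a b =>
        SSet.stdSimplex.objEquiv.injective
          (SimplexCategory.Hom.ext _ _ (OrderHom.ext _ _ (funext fun i =>
            Subsingleton.elim (α := Fin 1) _ _)))
      exact Prod.ext (h _ _) (h _ _)
    have h1 : diagCh.{u} 0 0 = cl (diagΔ.{u}.app ⦋0⦌ |>.app _
        (SSet.stdSimplex.objEquiv.symm (𝟙 ⦋0⦌))) := by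
      change nmap (diagΔ.app ⦋0⦌) 0 (tops 0 0) = _
      rw [tops_apply]
      exact nmap_cl _ _ _
    let c : Shuffle 0 0 0 := ⟨fun _ => 0, rfl, fun a b h => absurd h (by
      rw [Subsingleton.elim (α := Fin 1) a b]; exact lt_irrefl _)⟩
    have hc : ∀ c' : Shuffle 0 0 0, c' = c := fun c' => Subtype.ext (funext fun i =>
      Subsingleton.elim (α := Fin 1 × Fin 1) _ _)
    have h2 : tShuffle Δs.{u} Δs tops tops 0 0 = shuffle Δ[0] Δ[0] 0 0 0
        (nmap (SSet.stdSimplex.map (front 0 0)) 0 (top 0))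
        (nmap (SSet.stdSimplex.map (back 0 0)) 0 (top 0)) := by
      rw [tShuffle_apply, Finset.HasAntidiagonal.antidiagonal_zero, Finset.sum_singleton]
      change chShuffle (Δs.obj ⦋0⦌) (Δs.obj ⦋0⦌) _ _ 0 = _
      rw [chShuffle_apply, Finset.HasAntidiagonal.antidiagonal_zero, Finset.sum_singleton]
      change shuffle (Δs.obj ⦋0⦌) (Δs.obj ⦋0⦌) 0 0 0 (nmap (Δs.map (front 0 0)) 0 (tops 0 0))
        (nmap (Δs.map (back 0 0)) 0 (tops 0 0)) = _
      rw [tops_apply]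
      rfl
    change tShuffle Δs.{u} Δs tops tops 0 0 + diagCh 0 0 = 0
    rw [h1, h2, nmap_top, nmap_top, shuffle_cl, Fintype.sum_eq_single c fun c' h => absurd (hc c') h]
    exact (congrArg (_ + ·) (congrArg cl (hs _ _))).trans (add_self_eq_zero _)
  · exact diagDiff_mem_cycles.1.2 0 (q + 1) (by push_cast; omega)

/-- The two families of chains obtained from a pair of cycles `x`, `y` by applying `φ` before or after
the external product differ by a boundary. -/
theorem d_evCh {x : Ch (Tot X)} {y : Ch (Tot Y)} (hx : chBdry _ x = 0) (hy : chBdry _ y = 0) :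
    (hBdry (X ⊗ Y) + vBdry (X ⊗ Y)) (evCh X Y (coneFix diagDiff) (chShuffle _ _ x y)) =
      tShuffle X Y (phiCh X x) (phiCh Y y) +
        phiCh (X ⊗ Y) (chMap (totProd X Y) (chShuffle _ _ x y)) := by
  have hz : chBdry _ (chShuffle (Tot X) (Tot Y) x y) = 0 := by
    rw [chBdry_chShuffle, hx, hy, map_zero, map_zero, LinearMap.zero_apply, add_zero]
  have hd : hBdry ΔΔ (coneFix diagDiff) + vBdry ΔΔ (coneFix diagDiff) = diagDiff :=
    d_coneFix diagDiff_mem_cycles.{u} diagDiff_zero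
  have h0 : ∀ w, evCh X Y w 0 = 0 := fun w => funext fun k =>
    (congrArg _ (map_zero _)).trans (map_zero _)
  have hadd : ∀ w w' z, evCh X Y (w + w') z = evCh X Y w z + evCh X Y w' z := fun w w' z =>
    funext fun k => by
      change chMap _ (chShuffle _ _ (w k + w' k) z) = _
      rw [map_add, LinearMap.add_apply, map_add]; rfl
  rw [LinearMap.add_apply, hBdry_evCh, vBdry_evCh, hz, h0, add_zero, ← hadd, hd, diagDiff, hadd,
    evCh_tShuffle, evCh_diagΔ]

/-- The map `φ` is multiplicative in homology. -/
theorem φ_cross (m n : ℤ) (a : HTot X m) (b : HTot Y n) :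
    (φ (X ⊗ Y)).H (m + n) (cross X Y m n a b) =
      (T.shuffle X Y).toPairing.H m n ((φ X).H m a) ((φ Y).H n b) := by
  obtain ⟨x, rfl⟩ := Submodule.Quotient.mk_surjective _ a
  obtain ⟨y, rfl⟩ := Submodule.Quotient.mk_surjective _ b
  refine (Submodule.Quotient.eq _).2 ?_
  refine ⟨evCh X Y (coneFix diagDiff) (chShuffle (Tot X) (Tot Y) x.1 y.1), ?_, ?_⟩
  · have := evCh_mem_deg (coneFix_mem_deg diagDiff_mem_cycles.1) (chShuffle_deg x.2.1 y.2.1)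
    rwa [add_comm] at this
  · refine (d_evCh x.2.2 y.2.2).trans ?_
    have h : ∀ u v : CCh (X ⊗ Y), u + v = v - u := fun u v => by
      rw [eq_sub_iff_add_eq, add_right_comm, add_self_eq_zero, zero_add]
    exact h _ _

end Homotopy

/-! ### The abutment map of a cosimplicial space -/

section Abutment

variable {X Y : CosSp.{u}}

theorem phi_map (g : X ⟶ Y) (k q m : ℕ) (x : N (Tot X) q) :
    phi Y k q m (nmap (Tot.map g) q x) = nmap (g.app ⦋k⦌) m (phi X k q m x) := by
  suffices phi Y k q m ∘ₗ nmap (Tot.map g) q = nmap (g.app ⦋k⦌) m ∘ₗ phi X k q m from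
    LinearMap.congr_fun this x
  refine N_ext fun f => ?_
  rw [LinearMap.comp_apply, LinearMap.comp_apply, nmap_cl, phi_cl, phi_cl, nmap_comp]
  rfl

theorem phiCh_map (g : X ⟶ Y) (x : Ch (Tot X)) (k : ℕ) :
    phiCh Y (chMap (Tot.map g) x) k = chMap (g.app ⦋k⦌) (phiCh X x k) := by
  funext m
  change _ = nmap (g.app ⦋k⦌) m (phiCh X x k m)
  rw [phiCh_apply, phiCh_apply, map_sum]
  exact Finset.sum_congr rfl fun q _ => phi_map g k q m (x q)

theorem φ_map (g : X ⟶ Y) (n : ℤ) (c : HTot X n) :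
    (φ Y).H n ((S.map (Tot.map g)).H n c) = (T.map g).toHom.H n ((φ X).H n c) := by
  obtain ⟨x, rfl⟩ := Submodule.Quotient.mk_surjective _ c
  exact congrArg (SubQ.mk _) (Subtype.ext (funext fun k => phiCh_map g x.1 k))

theorem map_mem_filTot (g : X ⟶ Y) {n s : ℤ} {c : HTot X n} (hc : c ∈ filTot X n s) :
    (S.map (Tot.map g)).H n c ∈ filTot Y n s := by
  change (φ Y).H n ((S.map (Tot.map g)).H n c) ∈ (T Y).filH n s
  rw [φ_map]
  exact (T.map g).map_filH hc

theorem cross_mem_filTot {m n s t : ℤ} {a : HTot X m} {b : HTot Y n} (ha : a ∈ filTot X m s)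
    (hb : b ∈ filTot Y n t) : cross X Y m n a b ∈ filTot (X ⊗ Y) (m + n) (s + t) := by
  change (φ (X ⊗ Y)).H (m + n) (cross X Y m n a b) ∈ (T (X ⊗ Y)).filH (m + n) (s + t)
  rw [φ_cross]
  exact (T.shuffle X Y).map_filH ha hb

theorem ι_map (g : X ⟶ Y) (s n : ℤ) (a : SubQ (filTot X n s) (filTot X n (s + 1))) :
    ι Y s n (grMap (F := filTot X n) (F' := filTot Y n) ((S.map (Tot.map g)).H n)
      (fun _ _ => map_mem_filTot g) s a) = (T.map g).Einf s n (ι X s n a) := by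
  obtain ⟨⟨c, hc⟩, rfl⟩ := Submodule.Quotient.mk_surjective _ a
  refine Eq.trans ?_ ((T.map g).abut_grMap s n (SubQ.mk _ ⟨(φ X).H n c, hc⟩))
  exact congrArg (fun x => (T Y).abut s n (SubQ.mk _ x)) (Subtype.ext (φ_map g n c))

theorem ι_cross (s t m n : ℤ) (a : SubQ (filTot X m s) (filTot X m (s + 1)))
    (b : SubQ (filTot Y n t) (filTot Y n (t + 1))) :
    ι (X ⊗ Y) (s + t) (m + n) (grMap₂ (F := filTot X m) (F' := filTot Y n)
      (F'' := filTot (X ⊗ Y) (m + n)) (cross X Y m n)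
      (fun _ _ _ ha _ hb => cross_mem_filTot ha hb) s t a b) =
      (T.shuffle X Y).Einf s t m n (ι X s m a) (ι Y t n b) := by
  obtain ⟨⟨a, ha⟩, rfl⟩ := Submodule.Quotient.mk_surjective _ a
  obtain ⟨⟨b, hb⟩, rfl⟩ := Submodule.Quotient.mk_surjective _ b
  refine Eq.trans ?_ ((T.shuffle X Y).abut_grMap₂ s t m n (SubQ.mk _ ⟨(φ X).H m a, ha⟩)
    (SubQ.mk _ ⟨(φ Y).H n b, hb⟩))
  exact congrArg (fun x => (T (X ⊗ Y)).abut (s + t) (m + n) (SubQ.mk _ x))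
    (Subtype.ext (φ_cross m n a b))

end Abutment

end CosimplicialSS

open CosimplicialSS
theorem theoremT (X : CosSp.{u}) :
    ∃ (hmul : ∀ n n' s s' : ℤ, ∀ a ∈ filTot X n s, ∀ b ∈ filTot X n' s',
        cross X X n n' a b ∈ filTot (X ⊗ X) (n + n') (s + s'))
      (horb : ∀ n s : ℤ, ∀ c ∈ filTot (X ⊗ X) n s,
        (S.map (Tot.map (κ X))).H n c ∈ filTot (X ⋙ hOrb) n s),
      ∀ s s' n n' : ℤ,
        ι (X ⊗ X) (s + s') (n + n') ∘ₗ
            TensorProduct.lift (grMap₂ (cross X X n n') (hmul n n') s s') =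
          TensorProduct.lift ((T.shuffle X X).Einf s s' n n') ∘ₗ
            TensorProduct.map (ι X s n) (ι X s' n') ∧
        ι (X ⋙ hOrb) (s + s') (n + n') ∘ₗ
            grMap ((S.map (Tot.map (κ X))).H (n + n')) (horb (n + n')) (s + s') =
          (T.map (κ X)).Einf (s + s') (n + n') ∘ₗ ι (X ⊗ X) (s + s') (n + n') := by
  refine ⟨fun _ _ _ _ _ ha _ hb => cross_mem_filTot ha hb,
    fun _ _ _ hc => map_mem_filTot (κ X) hc, fun s s' n n' => ⟨?_, ?_⟩⟩
  · exact TensorProduct.ext' fun a b => ι_cross s s' n n' a b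
  · exact LinearMap.ext fun a => ι_map (κ X) (s + s') (n + n') a
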